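/- All hypergraphs are finite and without repeated hyperedges. A cycle of length $l\ge 2$ in a hypergraph is a cyclic sequence $v_0,e_0,v_1,e_1,\dots,v_{l-1},e_{l-1},v_0$ with distinct vertices $v_i$ and distinct hyperedges $e_i$ such that $v_i,v_{i+1}\in e_i$ (indices modulo $l$); sequences that differ by a rotation or a reversal describe the same cycle. A hypergraph is unicyclic if it is connected and has exactly one cycle; it is linear if any two different hyperedges share at most one vertex; its girth is the minimum length of a cycle. A cored vertex is a vertex of degree one. The $d$-th order trace of a tensor $\mathcal T=(t_{i_1\cdots i_k})$ of order $k$ and dimension $n$ is $$\mathrm{Tr}_d(\mathcal T)=(k-1)^{n-1}\sum_{d_1+\cdots+d_n=d}\ \prod_{i=1}^n\frac{1}{(d_i(k-1))!}\Big(\sum_{\beta\in[n]^{k-1}}t_{i\beta}\,\frac{\partial}{\partial a_{i\beta_1}}\cdots\frac{\partial}{\partial a_{i\beta_{k-1}}}\Big)^{d_i}\mathrm{tr}\big(A^{d(k-1)}\big),$$ where $A=(a_{ij})$ is an $n\times n$ matrix of independent variables. (It equals the sum of the $d$-th powers of the eigenvalues of $\mathcal T$.) For a $k$-uniform hypergraph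 $\mathcal H$ let $\mathcal A_\alpha(\mathcal H)=\alpha\mathcal D(\mathcal H)+(1-\alpha)\mathcal A(\mathcal H)$, where $\mathcal D(\mathcal H)$ is the diagonal tensor of vertex degrees and the adjacency tensor $\mathcal A(\mathcal H)$ has entry $\frac1{(k-1)!}$ at $i_1\cdots i_k$ if $\{i_1,\dots,i_k\}$ is a hyperedge, and $0$ otherwise. For two $k$-uniform hypergraphs $\mathcal H_1,\mathcal H_2$ with $n$ vertices each, $\mathcal H_1\prec_\alpha\mathcal H_2$ means that for some $1\le d\le n(k-1)^{n-1}-1$ one has $\mathrm{Tr}_t(\mathcal A_\alpha(\mathcal H_1))=\mathrm{Tr}_t(\mathcal A_\alpha(\mathcal H_2))$ for $0\le t<d$ and $\mathrm{Tr}_d(\mathcal A_\alpha(\mathcal H_1))<\mathrm{Tr}_d(\mathcal A_\alpha(\mathcal H_2))$; $\mathcal H_1=_\alpha\mathcal H_2$ means that these traces agree for all $0\le t\le n(k-1)^{n-1}-1$; and $\mathcal H_1\preceq_\alpha\mathcal H_2$ means $\mathcal H_1\prec_\alpha\mathcal H_2$ or $\mathcal H_1=_\alpha\mathcal H_2$.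 The hypercycle $C_g^{(k)}$ ($g\ge3$) has the $g$ hyperedges $\{u_i,w_{i,1},\dots,w_{i,k-2},u_{i+1}\}$, $i\in\mathbb Z/g$, all the vertices $u_i$, $w_{i,j}$ being distinct. The hyperpath $P_r^{(k)}$ has the $r$ hyperedges $\{u_{i-1},w_{i,1},\dots,w_{i,k-2},u_i\}$, $1\le i\le r$, with distinct vertices $u_0,\dots,u_r$, $w_{i,j}$; $P_0^{(k)}$ is the single vertex $u_0$. For $k\ge3$ the hypercycle has cored vertices, and $C_g^{(k)}\cdot P_{r}^{(k)}$ denotes the hypergraph obtained from disjoint copies of $C_g^{(k)}$ and $P_r^{(k)}$ by identifying a cored vertex of $C_g^{(k)}$ with the end vertex $u_0$ of $P_r^{(k)}$; in particular $C_g^{(k)}\cdot P_0^{(k)}\cong C_g^{(k)}$. **Theorem.** Let $k\ge3$, $3\le g\le m$ and $0<\alpha<1$. Among all $k$-uniform linear unicyclic hypergraphs with $m$ hyperedges and girth $g$, the first one in $S_\alpha$-order is $C_g^{(k)}\cdot P_{m-g}^{(k)}$. That is, $C_g^{(k)}\cdot P_{m-g}^{(k)}$ (for any choice of the cored vertex)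 belongs to this class, and every $\mathcal H$ in this class satisfies $C_g^{(k)}\cdot P_{m-g}^{(k)}\preceq_\alpha\mathcal H$, with $C_g^{(k)}\cdot P_{m-g}^{(k)}=_\alpha\mathcal H$ if and only if $\mathcal H\cong C_g^{(k)}\cdot P_{m-g}^{(k)}$. -/

import Mathlib

universe u

/-! ### Tensors and their traces -/

/-- A real tensor of order `k` whose indices range over `V`: the first index is separated from the
remaining `k - 1` ones, so `A i β` is the entry `a_{i β₁ ⋯ β_{k-1}}`. -/
abbrev Tensor (k : ℕ) (V : Type*) : Type _ := V → (Fin (k - 1) → V) → ℝ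

namespace Tensor

variable {k : ℕ} {V : Type*}

/-- The partial derivative with respect to the variable `p`, as a linear operator. -/
noncomputable def partialOp (p : V × V) : Module.End ℝ (MvPolynomial (V × V) ℝ) :=
  (MvPolynomial.pderiv p).toLinearMap

theorem commute_partialOp (p q : V × V) : Commute (partialOp p) (partialOp q) := by
  have h : ⁅(MvPolynomial.pderiv p : Derivation ℝ (MvPolynomial (V × V) ℝ)
        (MvPolynomial (V × V) ℝ)), (MvPolynomial.pderiv q : Derivation ℝ (MvPolynomial (V × V) ℝ)
        (MvPolynomial (V × V) ℝ))⁆ = 0 := by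
    classical
    apply MvPolynomial.derivation_ext
    intro r
    simp only [Derivation.commutator_apply, MvPolynomial.pderiv_X, Derivation.coe_zero,
      Pi.zero_apply, Pi.single_apply]
    split_ifs <;> simp
  refine LinearMap.ext fun f => ?_
  have h2 := congrArg (fun D : Derivation ℝ (MvPolynomial (V × V) ℝ) (MvPolynomial (V × V) ℝ) => D f) h
  simp only [Derivation.commutator_apply, Derivation.coe_zero, Pi.zero_apply] at h2
  exact sub_eq_zero.mp h2

theorem pairwise_partialOp (i : V) (β : Fin (k - 1) → V) :
    ((Finset.univ : Finset (Fin (k - 1))) : Set (Fin (k - 1))).Pairwise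
      (Function.onFun Commute fun j => partialOp (i, β j)) :=
  fun _ _ _ _ _ => commute_partialOp _ _

/-- The operator `∂/∂a_{i β₁} ⋯ ∂/∂a_{i β_{k-1}}`. -/
noncomputable def entryOp (i : V) (β : Fin (k - 1) → V) :
    Module.End ℝ (MvPolynomial (V × V) ℝ) :=
  Finset.univ.noncommProd (fun j => partialOp (i, β j)) (pairwise_partialOp i β)

theorem commute_entryOp (i i' : V) (β β' : Fin (k - 1) → V) :
    Commute (entryOp i β) (entryOp i' β') :=
  Finset.noncommProd_commute _ _ _ _ fun _ _ =>
    (Finset.noncommProd_commute _ _ _ _ fun _ _ => commute_partialOp _ _).symm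

variable [Fintype V]

/-- The operator `∑_β a_{i β} ∂/∂a_{i β}`, the coefficients being the entries of the tensor. -/
noncomputable def rowOp (A : Tensor k V) (i : V) : Module.End ℝ (MvPolynomial (V × V) ℝ) :=
  open Classical in ∑ β : Fin (k - 1) → V, A i β • entryOp i β

theorem commute_rowOp (A : Tensor k V) (i i' : V) : Commute (rowOp A i) (rowOp A i') :=
  Commute.sum_left _ _ _ fun _ _ => Commute.sum_right _ _ _ fun _ _ =>
    ((commute_entryOp _ _ _ _).smul_left _).smul_right _

theorem pairwise_rowOp (A : Tensor k V) (δ : V → ℕ) :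
    ((Finset.univ : Finset V) : Set V).Pairwise
      (Function.onFun Commute fun i => rowOp A i ^ δ i) :=
  fun _ _ _ _ _ => (commute_rowOp A _ _).pow_pow _ _

/-- The auxiliary matrix `(a_{ij})` of independent variables. -/
noncomputable def auxMatrix (V : Type*) : Matrix V V (MvPolynomial (V × V) ℝ) :=
  Matrix.of fun i j => MvPolynomial.X (i, j)

/-- The `d`-th order trace of a tensor of order `k` and dimension `n`:
`(k-1)^(n-1) ∑_{d₁+⋯+dₙ=d} ∏ᵢ (1/(dᵢ(k-1))!) (∑_β a_{iβ} ∂/∂a_{iβ})^{dᵢ} tr(a^{d(k-1)})`.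
The operators commute, and they turn `tr(a^{d(k-1)})`, which is homogeneous of degree `d(k-1)`,
into a constant polynomial, which is read as a real number. -/
noncomputable def trace [DecidableEq V] (d : ℕ) (A : Tensor k V) : ℝ :=
  ((k : ℝ) - 1) ^ (Fintype.card V - 1) *
    ∑ δ ∈ Finset.univ.piAntidiag d,
      (∏ i : V, 1 / ((δ i * (k - 1)).factorial : ℝ)) *
        MvPolynomial.constantCoeff
          (Finset.univ.noncommProd (fun i => rowOp A i ^ δ i) (pairwise_rowOp A δ)
            (Matrix.trace (auxMatrix V ^ (d * (k - 1)))))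

end Tensor

/-! ### Hypergraphs -/

namespace Hypergraph

variable {V W : Type*}

/-- The degree of a vertex: the number of edges that contain it. -/
noncomputable def degree (H : Hypergraph V) (v : V) : ℕ :=
  {e | e ∈ H.edgeSet ∧ v ∈ e}.ncard

/-- A cored vertex is a vertex of degree one. -/
def IsCored (H : Hypergraph V) (v : V) : Prop := H.degree v = 1

/-- Every edge has exactly `k` vertices. -/
def IsUniform (H : Hypergraph V) (k : ℕ) : Prop := ∀ e ∈ H.edgeSet, e.ncard = k

/-- Two different edges have at most one vertex in common. -/
def IsLinear (H : Hypergraph V) : Prop :=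
  ∀ e ∈ H.edgeSet, ∀ f ∈ H.edgeSet, e ≠ f → (e ∩ f).Subsingleton

/-- There is a vertex, and any two vertices are joined by a path. -/
def IsConnected (H : Hypergraph V) : Prop :=
  H.vertexSet.Nonempty ∧
    ∀ u ∈ H.vertexSet, ∀ v ∈ H.vertexSet, Relation.ReflTransGen H.Adj u v

/-- The sequence `v₀, e₀, v₁, e₁, …, v_{l-1}, e_{l-1}, v₀` is a cycle of length `l ≥ 2`: the `vᵢ`
are different vertices, the `eᵢ` are different edges, and `vᵢ` and `vᵢ₊₁` lie in `eᵢ` (indices are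
read cyclically). -/
structure IsCycle (H : Hypergraph V) {l : ℕ} (v : Fin l → V) (e : Fin l → Set V) : Prop where
  two_le : 2 ≤ l
  vertex_injective : Function.Injective v
  edge_injective : Function.Injective e
  edge_mem : ∀ i, e i ∈ H.edgeSet
  left_mem : ∀ i, v i ∈ e i
  right_mem : ∀ i, v (finRotate l i) ∈ e i

/-- The vertex-edge incidences that a cycle runs through. Two sequences describe the same cycle
(that is, they differ by a rotation or a reversal) if and only if these sets agree. -/
def cycleIncidences {l : ℕ} (v : Fin l → V) (e : Fin l → Set V) : Set (V × Set V) :=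
  {p | ∃ i, p = (v i, e i) ∨ p = (v (finRotate l i), e i)}

/-- A unicyclic hypergraph: connected, with exactly one cycle. -/
def IsUnicyclic (H : Hypergraph V) : Prop :=
  H.IsConnected ∧
    ∃! C : Set (V × Set V), ∃ (l : ℕ) (v : Fin l → V) (e : Fin l → Set V),
      H.IsCycle v e ∧ cycleIncidences v e = C

/-- The girth: the minimum length of a cycle (used only for hypergraphs that have one). -/
noncomputable def girth (H : Hypergraph V) : ℕ :=
  sInf {l | ∃ (v : Fin l → V) (e : Fin l → Set V), H.IsCycle v e}

/-- `H` is a `k`-uniform linear unicyclic hypergraph with `m` edges and girth `g`, whose vertices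
are all the elements of `V`. -/
structure IsLinearUnicyclic (H : Hypergraph V) (k m g : ℕ) : Prop where
  vertexSet_eq : H.vertexSet = Set.univ
  uniform : H.IsUniform k
  linear : H.IsLinear
  unicyclic : H.IsUnicyclic
  card_edges : H.edgeSet.ncard = m
  girth_eq : H.girth = g

/-- Isomorphism of hypergraphs whose vertices are all the elements of their vertex types. -/
def Iso (H : Hypergraph V) (H' : Hypergraph W) : Prop :=
  ∃ f : V ≃ W, H.image f = H'

/-! ### The `𝒜_α`-tensor and the `S_α`-order -/

/-- The adjacency tensor of a `k`-uniform hypergraph. -/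
noncomputable def adjTensor (H : Hypergraph V) (k : ℕ) : Tensor k V := fun i β =>
  open Classical in
  if insert i (Set.range β) ∈ H.edgeSet then 1 / ((k - 1).factorial : ℝ) else 0

/-- The diagonal tensor of vertex degrees. -/
noncomputable def degTensor (H : Hypergraph V) (k : ℕ) : Tensor k V := fun i β =>
  open Classical in
  if ∀ j, β j = i then (H.degree i : ℝ) else 0

/-- The tensor `𝒜_α = α 𝒟 + (1 - α) 𝒜`. -/
noncomputable def alphaTensor (H : Hypergraph V) (k : ℕ) (α : ℝ) : Tensor k V :=
  α • H.degTensor k + (1 - α) • H.adjTensor k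

section Order

variable [Fintype V] [DecidableEq V] [Fintype W] [DecidableEq W]

/-- The `d`-th order `𝒜_α`-spectral moment. -/
noncomputable def moment (H : Hypergraph V) (k : ℕ) (α : ℝ) (d : ℕ) : ℝ :=
  (H.alphaTensor k α).trace d

/-- `H` comes strictly before `H'` in `S_α`-order: they have the same number `n` of vertices, and
for some `1 ≤ d ≤ n(k-1)^(n-1) - 1` the moments of order less than `d` agree while that of order
`d` is smaller for `H`. -/
def SLT (k : ℕ) (α : ℝ) (H : Hypergraph V) (H' : Hypergraph W) : Prop :=
  Fintype.card V = Fintype.card W ∧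
    ∃ d, 1 ≤ d ∧ d < Fintype.card V * (k - 1) ^ (Fintype.card V - 1) ∧
      (∀ t < d, H.moment k α t = H'.moment k α t) ∧ H.moment k α d < H'.moment k α d

/-- `H =_α H'`: the same number `n` of vertices, and the same moments of the orders
`0, 1, …, n(k-1)^(n-1) - 1`. -/
def SEq (k : ℕ) (α : ℝ) (H : Hypergraph V) (H' : Hypergraph W) : Prop :=
  Fintype.card V = Fintype.card W ∧
    ∀ t < Fintype.card V * (k - 1) ^ (Fintype.card V - 1), H.moment k α t = H'.moment k α t

/-- `H ⪯_α H'`. -/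
def SLE (k : ℕ) (α : ℝ) (H : Hypergraph V) (H' : Hypergraph W) : Prop :=
  SLT k α H H' ∨ SEq k α H H'

end Order

/-! ### Hypercycles, hyperpaths and coalescence -/

/-- The vertices of the hypercycle: the vertices `uᵢ` (`i ∈ ℤ/g`) in which consecutive edges meet,
and `k - 2` further vertices `w_{i,j}` for each edge. -/
abbrev CycleVertex (k g : ℕ) : Type := Fin g ⊕ Fin g × Fin (k - 2)

/-- The `k`-uniform hypercycle with the `g` edges `{uᵢ, w_{i,1}, …, w_{i,k-2}, uᵢ₊₁}`, indices
read cyclically. -/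
def hypercycle (k g : ℕ) : Hypergraph (CycleVertex k g) where
  vertexSet := Set.univ
  edgeSet := Set.range fun i : Fin g =>
    {Sum.inl i, Sum.inl (finRotate g i)} ∪ Set.range fun j => Sum.inr (i, j)
  subset_vertexSet_of_mem_edgeSet' _ _ := Set.subset_univ _

/-- The vertices of the hyperpath: `u₀, …, u_r`, and `k - 2` further vertices `w_{i,j}` for each
edge. -/
abbrev PathVertex (k r : ℕ) : Type := Fin (r + 1) ⊕ Fin r × Fin (k - 2)

/-- The `k`-uniform hyperpath with the `r` edges `{uᵢ, w_{i,1}, …, w_{i,k-2}, uᵢ₊₁}`; for `r = 0`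
it is a single vertex. -/
def hyperpath (k r : ℕ) : Hypergraph (PathVertex k r) where
  vertexSet := Set.univ
  edgeSet := Set.range fun i : Fin r =>
    {Sum.inl i.castSucc, Sum.inl i.succ} ∪ Set.range fun j => Sum.inr (i, j)
  subset_vertexSet_of_mem_edgeSet' _ _ := Set.subset_univ _

/-- The vertices of a coalescence: those of both hypergraphs, without the vertex `w` of the second
one, which is identified with a vertex of the first. -/
abbrev CoalVertex (V : Type*) {W : Type*} (w : W) : Type _ := V ⊕ {x : W // x ≠ w}

/-- The map of the vertices of the second hypergraph into the coalescence; it sends `w` to `v`. -/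
def coalMap [DecidableEq W] (v : V) (w : W) (x : W) : CoalVertex V w :=
  if h : x = w then Sum.inl v else Sum.inr ⟨x, h⟩

/-- The coalescence of `H` at its vertex `v` with `H'` at its vertex `w`: the union of the two
hypergraphs after `w` has been identified with `v`. -/
def coalescence [DecidableEq W] (H : Hypergraph V) (v : V) (H' : Hypergraph W) (w : W) :
    Hypergraph (CoalVertex V w) where
  vertexSet := (H.image Sum.inl).vertexSet ∪ (H'.image (coalMap v w)).vertexSet
  edgeSet := (H.image Sum.inl).edgeSet ∪ (H'.image (coalMap v w)).edgeSet
  subset_vertexSet_of_mem_edgeSet' _ he := he.elim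
    (fun h => (Hypergraph.subset_vertexSet_of_mem_edgeSet h).trans Set.subset_union_left)
    (fun h => (Hypergraph.subset_vertexSet_of_mem_edgeSet h).trans Set.subset_union_right)

/-- The coalescence of the hypercycle with `g` edges at its vertex `c` with the hyperpath with `r`
edges at its end vertex `u₀`. -/
def cyclePath (k g r : ℕ) (c : CycleVertex k g) :
    Hypergraph (CoalVertex (CycleVertex k g) (Sum.inl 0 : PathVertex k r)) :=
  (hypercycle k g).coalescence c (hyperpath k r) (Sum.inl 0)

end Hypergraph

/-! ### The apolar pairing and the trace formula -/

/-! For the apolar pairing, the differential operators in the trace are adjoint to multiplication by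
polynomials in the arc variables, and a monomial occurs in tr(a^N) exactly when it is the arc
multiset of a closed walk of length N. So the trace of order d pairs products of d row polynomials
with closed walks. Each factor is either a power of a loop at i, weighted by α d_i, or an edge
rooted at i, weighted by 1 - α. Closed walks are balanced at every vertex, and a nonempty balanced
family of at most k + 2 rooted edges of a linear hypergraph is one edge rooted once at each of its
vertices (`Finset.rooted_edges_eq_of_balanced`). This yields the moments of orders 1 to k + 2
(`exists_familyTrace_formula`): besides power sums of the degrees they involve only the number of
edges (order k), the sum of d_v over all incidences (order k + 1), and at order k + 2 the sum of
d_v² over all incidences and, with a positive constant, the sum of d_v d_w over pairs of different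
vertices in an edge.

The incidence graph of a unicyclic hypergraph is connected with as many edges as nodes, so n = (k -
1)m throughout the class. At order 2 the sum of d² decides; as (d - 1)(d - 2) ≥ 0, it is least
exactly when all degrees are at most 2 (`SLT_of_sum_degree_sq_lt`). In that case all power sums of
the degrees are determined by k, m and n, and the first possible difference is at order k + 2, where
the sum over the edges of (∑_{v ∈ e} d_v)² decides (`SLT_of_sum_edge_sq_lt`).

By linearity ∑_{v ∈ e} d_v = k + 2 + x_e, where x_e + 2 is the number of edges meeting e. The x_e
sum to 0, so ∑ x_e² decides. If m = g, all x_e vanish. If m > g, some cycle edge has a third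
neighbour, whence ∑ x_e² ≥ 2 (`IsLinearUnicyclic.two_le_sum_sq`). Equality leaves one cycle edge
with three neighbours and no other edge with more than two, so the edges form a cycle with one
pendant path. Linearity and degrees at most 2 recover the hypergraph from the pairs of edges that
meet (`IsEdgeEnum.iso`). -/

namespace MvPolynomial

variable {σ τ : Type*}

/-- The pairing of real polynomials in which the monomials are orthogonal, and the square of the
norm of a monomial is the product of the factorials of its exponents. -/
noncomputable def pairing : MvPolynomial σ ℝ →ₗ[ℝ] MvPolynomial σ ℝ →ₗ[ℝ] ℝ :=
  (basisMonomials σ ℝ).constr ℝ fun M => (M.prod fun _ n => (n.factorial : ℝ)) • lcoeff ℝ M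

theorem pairing_monomial (M : σ →₀ ℕ) (q : MvPolynomial σ ℝ) :
    pairing (monomial M 1) q = (M.prod fun _ n => (n.factorial : ℝ)) * coeff M q := by
  have := (basisMonomials σ ℝ).constr_basis ℝ
    (fun M => (M.prod fun _ n => (n.factorial : ℝ)) • lcoeff (σ := σ) ℝ M) M
  rw [coe_basisMonomials] at this
  rw [pairing, this]
  simp

theorem pairing_one (q : MvPolynomial σ ℝ) : pairing 1 q = constantCoeff q := by
  have := pairing_monomial 0 q
  simpa [constantCoeff_eq] using this

/-- The norm of a monomial is a product of factorials for this reason: (n + 1)! = (n + 1) n!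
supplies exactly the factor produced by differentiation. -/
theorem pairing_X_mul (p : σ) (r q : MvPolynomial σ ℝ) :
    pairing (X p * r) q = pairing r (pderiv p q) := by
  classical
  have h : ∀ M, pairing (X p * monomial M 1) q = pairing (monomial M 1) (pderiv p q) := by
    intro M
    rw [mul_comm, X, monomial_mul, one_mul, pairing_monomial, pairing_monomial]
    have h1 : ((M + Finsupp.single p 1).prod fun _ n => (n.factorial : ℝ)) =
        (M p + 1) * M.prod fun _ n => (n.factorial : ℝ) := by
      rw [← Finsupp.mul_prod_erase' (M + Finsupp.single p 1) p _ (by simp),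
        ← Finsupp.mul_prod_erase' M p _ (by simp)]
      have : (M + Finsupp.single p 1).erase p = M.erase p := by
        ext a; by_cases h : a = p <;> simp [Finsupp.erase, h, Finsupp.single_apply, Ne.symm]
      rw [this]
      simp [Nat.factorial_succ, mul_assoc]
    have h2 : coeff M (pderiv p q) = (M p + 1) * coeff (M + Finsupp.single p 1) q := by
      rw [coeff_pderiv, mul_comm]
    rw [h1, h2]; ring
  induction r using MvPolynomial.induction_on' with
  | monomial u a =>
    have : monomial u a = a • monomial u (1 : ℝ) := by simp [smul_monomial]
    rw [this, mul_smul_comm, map_smul, map_smul, LinearMap.smul_apply, LinearMap.smul_apply, h]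
  | add r s hr hs => simp [mul_add, hr, hs]

theorem pairing_rename (f : σ ≃ τ) (p q : MvPolynomial σ ℝ) :
    pairing (rename f p) (rename f q) = pairing p q := by
  induction p using MvPolynomial.induction_on' with
  | monomial u a =>
    have : monomial u a = a • monomial u (1 : ℝ) := by simp [smul_monomial]
    rw [this, map_smul, map_smul, map_smul, LinearMap.smul_apply, LinearMap.smul_apply,
      rename_monomial, pairing_monomial, pairing_monomial,
      coeff_rename_mapDomain f f.injective, Finsupp.prod_mapDomain_index_inj f.injective]
  | add r s hr hs => simp [hr, hs]

/-- `T` is adjoint to multiplication by `p`. -/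
def IsAdjointMul (T : Module.End ℝ (MvPolynomial σ ℝ)) (p : MvPolynomial σ ℝ) : Prop :=
  ∀ r q, pairing (p * r) q = pairing r (T q)

namespace IsAdjointMul

variable {T T' : Module.End ℝ (MvPolynomial σ ℝ)} {p p' : MvPolynomial σ ℝ}

theorem one : IsAdjointMul (σ := σ) 1 1 := fun r q => by simp

/-- Taking adjoints reverses the order of composition; commutativity of polynomials restores it. -/
theorem mul (h : IsAdjointMul T p) (h' : IsAdjointMul T' p') : IsAdjointMul (T * T') (p * p') :=
  fun r q => by rw [mul_comm p, mul_assoc, h', h]; rfl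

theorem smul (h : IsAdjointMul T p) (c : ℝ) : IsAdjointMul (c • T) (c • p) := fun r q => by
  rw [smul_mul_assoc, map_smul, LinearMap.smul_apply, h, LinearMap.smul_apply, map_smul]

theorem pow (h : IsAdjointMul T p) (n : ℕ) : IsAdjointMul (T ^ n) (p ^ n) := by
  induction n with
  | zero => simpa using one
  | succ n ih => rw [pow_succ, pow_succ]; exact ih.mul h

theorem sum {ι : Type*} (s : Finset ι) {T : ι → Module.End ℝ (MvPolynomial σ ℝ)}
    {p : ι → MvPolynomial σ ℝ} (h : ∀ i ∈ s, IsAdjointMul (T i) (p i)) :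
    IsAdjointMul (∑ i ∈ s, T i) (∑ i ∈ s, p i) := fun r q => by
  rw [Finset.sum_mul, map_sum, LinearMap.sum_apply, LinearMap.sum_apply, map_sum]
  exact Finset.sum_congr rfl fun i hi => h i hi r q

theorem noncommProd {ι : Type*} (s : Finset ι) {T : ι → Module.End ℝ (MvPolynomial σ ℝ)}
    {p : ι → MvPolynomial σ ℝ} (hc : (s : Set ι).Pairwise (Function.onFun Commute T))
    (h : ∀ i ∈ s, IsAdjointMul (T i) (p i)) :
    IsAdjointMul (s.noncommProd T hc) (∏ i ∈ s, p i) := by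
  classical
  induction s using Finset.induction_on with
  | empty => simpa using one
  | insert a s ha ih =>
    rw [Finset.noncommProd_insert_of_notMem _ _ _ _ ha, Finset.prod_insert ha]
    exact (h a (by simp)).mul (ih _ fun i hi => h i (by simp [hi]))

end IsAdjointMul

end MvPolynomial

namespace Tensor

open MvPolynomial

variable {k : ℕ} {V W : Type*}

theorem isAdjointMul_partialOp (p : V × V) : IsAdjointMul (partialOp p) (X p) :=
  fun r q => pairing_X_mul p r q

variable [Fintype V] [Fintype W]

/-- The polynomial whose variables are the arcs, which encodes a row of a tensor. -/
noncomputable def rowPoly (A : Tensor k V) (i : V) : MvPolynomial (V × V) ℝ :=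
  open Classical in ∑ β : Fin (k - 1) → V, A i β • ∏ j, X (i, β j)

theorem isAdjointMul_rowOp (A : Tensor k V) (i : V) : IsAdjointMul (rowOp A i) (rowPoly A i) :=
  .sum _ fun _ _ => .smul (.noncommProd _ _ fun _ _ => isAdjointMul_partialOp _) _

theorem rename_rowPoly (f : V ≃ W) (A : Tensor k V) (B : Tensor k W)
    (h : ∀ i β, B (f i) (f ∘ β) = A i β) (i : V) :
    rename (f.prodCongr f) (rowPoly A i) = rowPoly B (f i) := by
  classical
  unfold rowPoly
  rw [map_sum]
  refine Fintype.sum_equiv ((Equiv.refl (Fin (k - 1))).arrowCongr f) _ _ fun β => ?_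
  rw [map_smul, map_prod, ← h]
  simp only [rename_X]
  rfl

/-- The pairing with `tr(a^N)`. -/
noncomputable def walkFunctional (V : Type*) [Fintype V] [DecidableEq V] (N : ℕ) :
    MvPolynomial (V × V) ℝ →ₗ[ℝ] ℝ :=
  pairing.flip (Matrix.trace (auxMatrix V ^ N))

variable [DecidableEq V] [DecidableEq W]

/-- Reading off the constant term is pairing with 1, so by adjointness the operators move to the
other side of the pairing, where they multiply 1 by the row polynomials. -/
theorem trace_eq_sum_walkFunctional (d : ℕ) (A : Tensor k V) :
    trace d A = ((k : ℝ) - 1) ^ (Fintype.card V - 1) *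
      ∑ δ ∈ (Finset.univ : Finset V).piAntidiag d,
        (∏ i : V, 1 / ((δ i * (k - 1)).factorial : ℝ)) *
          walkFunctional V (d * (k - 1)) (∏ i, rowPoly A i ^ δ i) := by
  unfold trace
  congr 1
  refine Finset.sum_congr rfl fun δ _ => ?_
  congr 1
  have h := IsAdjointMul.noncommProd Finset.univ (pairwise_rowOp A δ)
    (p := fun i => rowPoly A i ^ δ i) fun i _ => (isAdjointMul_rowOp A i).pow _
  rw [walkFunctional, LinearMap.flip_apply, ← mul_one (∏ i, _), h, pairing_one]

theorem rename_trace_auxMatrix (f : V ≃ W) (N : ℕ) :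
    rename (f.prodCongr f) (Matrix.trace (auxMatrix V ^ N)) =
      Matrix.trace (auxMatrix W ^ N) := by
  have h : (auxMatrix V).map (rename (f.prodCongr f)) =
      (auxMatrix W).submatrix f f := by
    ext i j : 2
    simp [auxMatrix]
  have h2 : (auxMatrix V ^ N).map (rename (f.prodCongr f) : _ →ₐ[ℝ] _) =
      (auxMatrix W ^ N).submatrix f f := by
    have := map_pow ((rename (f.prodCongr f) : _ →ₐ[ℝ] MvPolynomial (W × W) ℝ).toRingHom.mapMatrix)
      (auxMatrix V) N
    refine this.trans ?_
    have h3 := map_pow (Matrix.reindexAlgEquiv ℝ (MvPolynomial (W × W) ℝ) f.symm) (auxMatrix W) N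
    simp only [Matrix.coe_reindexAlgEquiv, Matrix.reindex_apply, Equiv.symm_symm] at h3
    rw [h3, ← h]
    rfl
  rw [Matrix.trace, map_sum, Matrix.trace]
  rw [← Equiv.sum_comp f]
  refine Finset.sum_congr rfl fun i _ => ?_
  exact congrFun (congrFun h2 i) i

theorem walkFunctional_rename (f : V ≃ W) (N : ℕ) (p : MvPolynomial (V × V) ℝ) :
    walkFunctional W N (rename (f.prodCongr f) p) = walkFunctional V N p := by
  rw [walkFunctional, walkFunctional, LinearMap.flip_apply, LinearMap.flip_apply,
    ← rename_trace_auxMatrix f, pairing_rename]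

theorem trace_congr (f : V ≃ W) (A : Tensor k V) (B : Tensor k W)
    (h : ∀ i β, B (f i) (f ∘ β) = A i β) (d : ℕ) : trace d A = trace d B := by
  rw [trace_eq_sum_walkFunctional, trace_eq_sum_walkFunctional, Fintype.card_congr f]
  congr 1
  refine Finset.sum_bij' (fun δ _ => δ ∘ f.symm) (fun δ _ => δ ∘ f) ?_ ?_ ?_ ?_ ?_
  · intro δ hδ
    simp only [Finset.mem_piAntidiag] at hδ ⊢
    refine ⟨?_, by simp⟩
    rw [← hδ.1]
    exact Equiv.sum_comp f.symm δ
  · intro δ hδ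
    simp only [Finset.mem_piAntidiag] at hδ ⊢
    refine ⟨?_, by simp⟩
    rw [← hδ.1]
    exact Equiv.sum_comp f δ
  · intro δ _; ext; simp
  · intro δ _; ext; simp
  · intro δ _
    congr 1
    · exact Fintype.prod_equiv f _ _ fun i => by simp
    · rw [← walkFunctional_rename f, map_prod]
      congr 1
      refine Fintype.prod_equiv f _ _ fun i => ?_
      rw [map_pow, rename_rowPoly f A B h, Function.comp_apply, Equiv.symm_apply_apply]

end Tensor

/-! ### Closed walks -/

/-- There is a walk from `a` to `b` that runs through each arc as often as the multiplicity
function `M` says. -/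
inductive ArcWalk {V : Type*} (a : V) : V → (V × V →₀ ℕ) → Prop
  | nil : ArcWalk a a 0
  | snoc {b : V} {M : V × V →₀ ℕ} (h : ArcWalk a b M) (c : V) :
      ArcWalk a c (M + Finsupp.single (b, c) 1)

namespace ArcWalk

variable {V : Type*} {a b c : V} {M M' : V × V →₀ ℕ}

theorem trans (h : ArcWalk a b M) (h' : ArcWalk b c M') : ArcWalk a c (M + M') := by
  induction h' with
  | nil => simpa using h
  | snoc h' c ih => rw [← add_assoc]; exact ih.snoc c

theorem single (a b : V) : ArcWalk a b (Finsupp.single (a, b) 1) := by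
  simpa using (nil (a := a)).snoc b

theorem nsmul (h : ArcWalk a a M) (n : ℕ) : ArcWalk a a (n • M) := by
  induction n with
  | zero => simpa using nil
  | succ n ih => rw [succ_nsmul]; exact ih.trans h

theorem sum {ι : Type*} (s : Finset ι) {M : ι → V × V →₀ ℕ} (h : ∀ i ∈ s, ArcWalk a a (M i)) :
    ArcWalk a a (∑ i ∈ s, M i) := by
  classical
  induction s using Finset.induction_on with
  | empty => simpa using nil
  | insert i s hi ih =>
    rw [Finset.sum_insert hi]
    exact (h i (by simp)).trans (ih fun j hj => h j (by simp [hj]))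

/-- A walk that does not leave a set of vertices which is closed under its arcs. -/
theorem mem_iff (h : ArcWalk a b M) (S : Set V)
    (hS : ∀ u v, M (u, v) ≠ 0 → (u ∈ S ↔ v ∈ S)) :
    (a ∈ S ↔ b ∈ S) ∧ ∀ u v, M (u, v) ≠ 0 → (a ∈ S ↔ u ∈ S) := by
  classical
  induction h with
  | nil => simp
  | @snoc b M h c ih =>
    have h1 := ih fun u v huv => hS u v (by simp [huv])
    refine ⟨h1.1.trans (hS b c (by simp)), fun u v huv => ?_⟩
    by_cases h2 : M (u, v) = 0
    · have : u = b := by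
        by_contra h3
        simp [h2, Ne.symm h3] at huv
      rw [this]; exact h1.1
    · exact h1.2 u v h2

/-- The balance of the arcs of a walk at each vertex. -/
theorem balance [Fintype V] [DecidableEq V] (h : ArcWalk a b M) (u : V) :
    (∑ v, M (u, v)) + (if u = b then 1 else 0) = (∑ v, M (v, u)) + if u = a then 1 else 0 := by
  induction h with
  | nil => simp
  | @snoc b M h c ih =>
    simp only [Finsupp.add_apply, Finset.sum_add_distrib, Finsupp.single_apply, Prod.mk.injEq]
    have h1 : (∑ v, if b = u ∧ c = v then 1 else 0) = if u = b then 1 else 0 := by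
      by_cases h : b = u <;> simp [h, Ne.symm]
    have h2 : (∑ v, if b = v ∧ c = u then 1 else 0) = if u = c then 1 else 0 := by
      by_cases h : c = u <;> simp [h]
      simp [Ne.symm h]
    rw [h1, h2]
    omega

end ArcWalk

namespace Tensor

open MvPolynomial

variable {V : Type*} [Fintype V] [DecidableEq V]

/-- Splits off the last arc of a walk of length N + 1. -/
theorem coeff_auxMatrix_pow_succ (N : ℕ) (a c : V) (M : V × V →₀ ℕ) :
    coeff M ((auxMatrix V ^ (N + 1)) a c) =
      ∑ b, if (b, c) ∈ M.support then
        coeff (M - Finsupp.single (b, c) 1) ((auxMatrix V ^ N) a b) else 0 := by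
  rw [pow_succ, Matrix.mul_apply, coeff_sum]
  exact Finset.sum_congr rfl fun b _ => by
    rw [← coeff_mul_X']; rfl

theorem coeff_auxMatrix_pow_nonneg (N : ℕ) (a b : V) (M : V × V →₀ ℕ) :
    0 ≤ coeff M ((auxMatrix V ^ N) a b) := by
  induction N generalizing b M with
  | zero =>
    rw [pow_zero, Matrix.one_apply]
    split_ifs
    · rw [coeff_one]; split_ifs <;> simp
    · simp
  | succ N ih =>
    rw [coeff_auxMatrix_pow_succ]
    exact Finset.sum_nonneg fun c _ => by split_ifs <;> simp [ih]

theorem arcWalk_of_coeff_ne_zero {N : ℕ} {a b : V} {M : V × V →₀ ℕ}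
    (h : coeff M ((auxMatrix V ^ N) a b) ≠ 0) : ArcWalk a b M := by
  induction N generalizing b M with
  | zero =>
    rw [pow_zero, Matrix.one_apply] at h
    split_ifs at h with h1
    · rw [coeff_one] at h
      split_ifs at h with h2
      · subst h1 h2; exact .nil
      · simp at h
    · simp at h
  | succ N ih =>
    rw [coeff_auxMatrix_pow_succ] at h
    obtain ⟨c, _, hc⟩ := Finset.exists_ne_zero_of_sum_ne_zero h
    split_ifs at hc with h1
    · have := (ih hc).snoc b
      rwa [tsub_add_cancel_of_le] at this
      rw [Finsupp.single_le_iff]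
      exact Nat.one_le_iff_ne_zero.2 (Finsupp.mem_support_iff.1 h1)
    · simp at hc

/-- The coefficients count walks, so nothing cancels and a single walk makes the coefficient
positive. -/
theorem coeff_auxMatrix_pow_pos {a b : V} {M : V × V →₀ ℕ} (h : ArcWalk a b M) :
    0 < coeff M ((auxMatrix V ^ M.degree) a b) := by
  induction h with
  | nil => simp
  | @snoc b M h c ih =>
    have : (M + Finsupp.single (b, c) 1).degree = M.degree + 1 := by simp
    rw [this, coeff_auxMatrix_pow_succ]
    refine Finset.sum_pos' (fun c _ => ?_) ⟨b, by simp, ?_⟩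
    · split_ifs
      · exact coeff_auxMatrix_pow_nonneg _ _ _ _
      · simp
    · rw [if_pos (by simp), add_tsub_cancel_right]
      exact ih

theorem walkFunctional_monomial (N : ℕ) (M : V × V →₀ ℕ) :
    walkFunctional V N (monomial M 1) =
      (M.prod fun _ n => (n.factorial : ℝ)) * ∑ a, coeff M ((auxMatrix V ^ N) a a) := by
  rw [walkFunctional, LinearMap.flip_apply, pairing_monomial, Matrix.trace, coeff_sum]
  rfl

theorem exists_arcWalk_of_walkFunctional_ne_zero {N : ℕ} {M : V × V →₀ ℕ}
    (h : walkFunctional V N (monomial M 1) ≠ 0) : ∃ a, ArcWalk a a M := by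
  rw [walkFunctional_monomial] at h
  obtain ⟨a, _, ha⟩ := Finset.exists_ne_zero_of_sum_ne_zero (right_ne_zero_of_mul h)
  exact ⟨a, arcWalk_of_coeff_ne_zero ha⟩

theorem walkFunctional_monomial_pos {N : ℕ} {M : V × V →₀ ℕ} {a : V} (h : ArcWalk a a M)
    (hN : M.degree = N) : 0 < walkFunctional V N (monomial M 1) := by
  rw [walkFunctional_monomial, ← hN]
  refine mul_pos (Finset.prod_pos fun _ _ => by positivity) ?_
  exact Finset.sum_pos' (fun _ _ => coeff_auxMatrix_pow_nonneg _ _ _ _)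
    ⟨a, by simp, coeff_auxMatrix_pow_pos h⟩

end Tensor

/-! ### The trace of a sum of a diagonal tensor and an adjacency tensor -/

namespace Finset

variable {V : Type*} [DecidableEq V]

/-- Inclusion-exclusion loses at most one vertex for each of the three pairs. For k ≥ 3 the bound 3k
- 3 exceeds k + 2. -/
theorem card_union_three_ge {k : ℕ} {e f g : Finset V} (he : #e = k) (hf : #f = k) (hg : #g = k)
    (hef : #(e ∩ f) ≤ 1) (heg : #(e ∩ g) ≤ 1) (hfg : #(f ∩ g) ≤ 1) :
    3 * k ≤ #(e ∪ f ∪ g) + 3 := by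
  have h1 := card_union_add_card_inter e f
  have h2 := card_union_add_card_inter (e ∪ f) g
  have h3 : #((e ∪ f) ∩ g) ≤ #(e ∩ g) + #(f ∩ g) := by
    rw [union_inter_distrib_right]; exact card_union_le _ _
  omega

/-- A balanced family of at most `k + 2` rooted edges of a linear `k`-uniform family of sets
consists of one edge, rooted once at each of its vertices. -/
theorem rooted_edges_eq_of_balanced {k : ℕ} (hk : 3 ≤ k) {E : Finset (Finset V)}
    (hu : ∀ e ∈ E, #e = k) (hl : ∀ e ∈ E, ∀ f ∈ E, e ≠ f → #(e ∩ f) ≤ 1)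
    {I : Type*} [Fintype I] [Nonempty I] (hI : Fintype.card I ≤ k + 2)
    (ρ : I → V) (f : I → Finset V) (hf : ∀ p, f p ∈ E)
    (hb : ∀ u, k * #{p | ρ p = u} = #{p | u ∈ f p}) :
    ∃ e ∈ E, (∀ p, f p = e) ∧ ∀ u, #{p | ρ p = u} = if u ∈ e then 1 else 0 := by
  classical
  -- A vertex covered by an edge has a positive right-hand side in the balance, so it is itself a
  -- root.
  have hcover : ∀ p, ∀ u ∈ f p, u ∈ univ.image ρ := by
    intro p u hu
    have h1 : 0 < #{p | u ∈ f p} := card_pos.2 ⟨p, by simpa using hu⟩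
    rw [← hb] at h1
    obtain ⟨q, hq⟩ := card_pos.1 (Nat.pos_of_mul_pos_left h1)
    exact mem_image.2 ⟨q, by simp, by simpa using hq⟩
  -- If `f p` is the only edge of the family through `u`, the number of its occurrences is a
  -- positive multiple of k.
  have hlarge : ∀ p u, u ∈ f p → (∀ q, u ∈ f q → f q = f p) → k ≤ #{q | f q = f p} := by
    intro p u hu h
    have h1 : #{q | u ∈ f q} = #{q | f q = f p} := by
      congr 1; ext q; simp only [mem_filter, mem_univ, true_and]
      exact ⟨h q, fun h' => h' ▸ hu⟩
    have h2 : 0 < #{q | u ∈ f q} := card_pos.2 ⟨p, by simpa using hu⟩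
    rw [← h1, ← hb] at *
    exact Nat.le_mul_of_pos_right _ (Nat.pos_of_mul_pos_left h2)
  have p₀ : I := Classical.arbitrary I
  have hall : ∀ p, f p = f p₀ := by
    by_contra! hne
    obtain ⟨p₁, h₁⟩ := hne
    -- Three different edges cover at least 3k - 3 > k + 2 vertices, all of them roots, which is too
    -- many.
    by_cases h3 : ∃ p₂, f p₂ ≠ f p₀ ∧ f p₂ ≠ f p₁
    · obtain ⟨p₂, h20, h21⟩ := h3
      have h := card_union_three_ge (hu _ (hf p₀)) (hu _ (hf p₁)) (hu _ (hf p₂))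
        (hl _ (hf _) _ (hf _) h₁.symm) (hl _ (hf _) _ (hf _) h20.symm)
        (hl _ (hf _) _ (hf _) h21.symm)
      have h' : #(f p₀ ∪ f p₁ ∪ f p₂) ≤ #(univ.image ρ) := by
        refine card_le_card fun u hu => ?_
        simp only [mem_union] at hu
        rcases hu with (hu | hu) | hu
        exacts [hcover _ _ hu, hcover _ _ hu, hcover _ _ hu]
      have h'' : #(univ.image ρ) ≤ Fintype.card I := card_image_le
      omega
    -- With exactly two different edges, linearity gives each a private vertex, so each occurs at
    -- least k times, and 2k > k + 2.
    · push Not at h3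
      have hpriv : ∀ p q, f p ≠ f q → (∀ r, f r = f p ∨ f r = f q) → k ≤ #{r | f r = f p} := by
        intro p q hpq hr
        have h1 : 0 < #(f p \ f q) := by
          have := card_sdiff_add_card_inter (f p) (f q)
          have := hl _ (hf p) _ (hf q) hpq
          have := hu _ (hf p)
          omega
        obtain ⟨u, hu⟩ := card_pos.1 h1
        rw [mem_sdiff] at hu
        refine hlarge p u hu.1 fun r hur => (hr r).resolve_right fun h => hu.2 (h ▸ hur)
      have hr : ∀ r, f r = f p₀ ∨ f r = f p₁ := fun r => or_iff_not_imp_left.2 (h3 r)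
      have ha := hpriv p₀ p₁ h₁.symm hr
      have hb := hpriv p₁ p₀ h₁ fun r => (hr r).symm
      have hd : Disjoint ({r | f r = f p₀} : Finset I) ({r | f r = f p₁} : Finset I) := by
        rw [disjoint_filter]
        intro r _ h h'
        exact h₁ (h'.symm.trans h)
      have hc := card_union_of_disjoint hd
      have := card_le_univ (({r | f r = f p₀} : Finset I) ∪ ({r | f r = f p₁} : Finset I))
      omega
  refine ⟨f p₀, hf p₀, hall, fun u => ?_⟩
  have h1 := hb u
  simp only [hall] at h1
  split_ifs with h
  -- Every vertex of the only edge is a root the same number x of times, with k x = card I. As 0 <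
  -- card I ≤ k + 2 < 2k, this forces x = 1.
  · simp only [h, filter_true, card_univ] at h1
    have h2 : 0 < Fintype.card I := Fintype.card_pos
    generalize #{p | ρ p = u} = x at *
    rcases x with _ | _ | x
    · omega
    · rfl
    · exfalso
      have : k * (x + 2) = k * x + 2 * k := by ring
      have h5 : 0 ≤ k * x := Nat.zero_le _
      rw [show x + 1 + 1 = x + 2 by ring] at h1
      omega
  · simp only [h, filter_false, card_empty, mul_eq_zero] at h1
    omega

end Finset

namespace Tensor

open MvPolynomial Finset

variable {V : Type*}

/-- The loops, the loop at `i` being taken `δ i * (k - 1)` times. -/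
noncomputable def loopArcs [Fintype V] (k : ℕ) (δ : V → ℕ) : V × V →₀ ℕ :=
  ∑ i, Finsupp.single (i, i) (δ i * (k - 1))

theorem prod_loops_eq [Fintype V] (k : ℕ) (δ : V → ℕ) :
    ∏ i, (X (i, i) ^ (k - 1) : MvPolynomial (V × V) ℝ) ^ δ i = monomial (loopArcs k δ) 1 := by
  rw [loopArcs, monomial_sum_one]
  refine prod_congr rfl fun i _ => ?_
  rw [← pow_mul, X_pow_eq_monomial, mul_comm]

variable [DecidableEq V]

/-- The arcs from a vertex to the other vertices of an edge. -/
noncomputable def edgeArcs (i : V) (e : Finset V) : V × V →₀ ℕ :=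
  ∑ j ∈ e.erase i, Finsupp.single (i, j) 1

theorem edgeArcs_apply (i : V) (e : Finset V) (u v : V) :
    edgeArcs i e (u, v) = if u = i ∧ v ∈ e ∧ v ≠ i then 1 else 0 := by
  rw [edgeArcs, Finsupp.finsetSum_apply]
  by_cases hu : i = u
  · subst hu
    simp [Finsupp.single_apply, and_comm]
  · simp [Ne.symm hu]

variable [Fintype V]

theorem loopArcs_apply (k : ℕ) (δ : V → ℕ) (u v : V) :
    loopArcs k δ (u, v) = if u = v then δ u * (k - 1) else 0 := by
  rw [loopArcs, Finsupp.finsetSum_apply]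
  simp only [Finsupp.single_apply, Prod.mk.injEq]
  by_cases h : u = v
  · subst h; simp
  · rw [if_neg h]
    refine sum_eq_zero fun i _ => if_neg ?_
    rintro ⟨rfl, h'⟩; exact h h'

/-- The row polynomial of the sum of a diagonal tensor and a multiple of the adjacency tensor of a
family of sets. -/
noncomputable def familyRow (k : ℕ) (D : V → ℝ) (b : ℝ) (E : Finset (Finset V)) (i : V) :
    MvPolynomial (V × V) ℝ :=
  b • (∑ e ∈ E with i ∈ e, monomial (edgeArcs i e) 1) + D i • X (i, i) ^ (k - 1)

variable {k : ℕ} {E : Finset (Finset V)}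

/-- A closed walk leaves each vertex as often as it enters it, and loops contribute equally to both
counts. At u this says that k - 1 times the number of edges rooted at u is the number of rooted
edges through u with another root. Adding the number of edges rooted at u to both sides gives the
hypothesis of `rooted_edges_eq_of_balanced`. -/
theorem rooted_edges_eq_of_arcWalk (hk : 3 ≤ k) (hu : ∀ e ∈ E, #e = k)
    (hl : ∀ e ∈ E, ∀ f ∈ E, e ≠ f → #(e ∩ f) ≤ 1) (z y : V → ℕ) (hy : ∑ i, y i ≤ k + 2)
    (hy0 : y ≠ 0) (f : (Σ i, Fin (y i)) → Finset V) (hf : ∀ p, f p ∈ E ∧ p.1 ∈ f p) {a : V}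
    (hw : ArcWalk a a (loopArcs k z + ∑ p, edgeArcs p.1 (f p))) :
    ∃ e ∈ E, (∀ p, f p = e) ∧ y = fun u => if u ∈ e then 1 else 0 := by
  obtain ⟨i₀, hi₀⟩ := Function.ne_iff.1 hy0
  have : Nonempty (Σ i, Fin (y i)) := ⟨⟨i₀, ⟨0, Nat.pos_of_ne_zero hi₀⟩⟩⟩
  have hcard : ∀ u, #{p : Σ i, Fin (y i) | p.1 = u} = y u := by
    intro u
    rw [card_filter, Fintype.sum_sigma]
    rw [sum_eq_single u (fun v _ h => by simp [h]) (by simp)]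
    simp
  obtain ⟨e, he, h1, h2⟩ := rooted_edges_eq_of_balanced hk hu hl
    (I := Σ i, Fin (y i)) (by simpa using hy) (fun p => p.1) f (fun p => (hf p).1) (by
      intro u
      have hb := hw.balance u
      rw [add_left_inj] at hb
      simp only [Finsupp.add_apply, Finsupp.finsetSum_apply, sum_add_distrib, loopArcs_apply,
        edgeArcs_apply] at hb
      simp only [sum_ite_eq, sum_ite_eq', mem_univ, if_true, add_right_inj] at hb
      replace hb := (sum_comm.symm.trans hb).trans sum_comm
      have hout : ∀ p : Σ i, Fin (y i), (∑ v, if u = p.1 ∧ v ∈ f p ∧ v ≠ p.1 then 1 else 0) =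
          if p.1 = u then k - 1 else 0 := by
        intro p
        split_ifs with h
        · subst h
          rw [← card_filter]
          have : ({v | p.1 = p.1 ∧ v ∈ f p ∧ v ≠ p.1} : Finset V) = (f p).erase p.1 := by
            ext v; simp [and_comm]
          rw [this, card_erase_of_mem (hf p).2, hu _ (hf p).1]
        · simp [Ne.symm h]
      have hin : ∀ p : Σ i, Fin (y i), (∑ v, if v = p.1 ∧ u ∈ f p ∧ u ≠ p.1 then 1 else 0) +
          (if p.1 = u then 1 else 0) = if u ∈ f p then 1 else 0 := by
        intro p
        by_cases h : p.1 = u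
        · subst h; simp [(hf p).2]
        · by_cases h' : u ∈ f p <;> simp [h, h', Ne.symm h]
      simp only [hout] at hb
      have h3 := congrArg (· + ∑ p : Σ i, Fin (y i), if p.1 = u then 1 else 0) hb
      simp only [← sum_add_distrib, hin] at h3
      rw [card_filter, card_filter, ← h3, mul_sum]
      refine sum_congr rfl fun p _ => ?_
      split_ifs <;> omega)
  exact ⟨e, he, h1, funext fun u => by rw [← hcard, h2]⟩

end Tensor

/-! ### Expansion of products of row polynomials -/

namespace Tensor

open MvPolynomial Finset

variable {V : Type*} [DecidableEq V] {k : ℕ} {E : Finset (Finset V)}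

/-- All the arcs between different vertices of an edge. -/
noncomputable def edgeStar (e : Finset V) : V × V →₀ ℕ := ∑ i ∈ e, edgeArcs i e

/-- The indicator function of a set. -/
def ind (e : Finset V) (u : V) : ℕ := if u ∈ e then 1 else 0

theorem sum_ind [Fintype V] (e : Finset V) : ∑ u, ind e u = #e := by simp [ind]

theorem ind_injective : Function.Injective (ind (V := V)) := by
  intro e f h
  ext u
  have := congrFun h u
  simp only [ind] at this
  split_ifs at this with h1 h2 h2 <;> simp_all

variable [Fintype V]

/-- The product expands into a sum over all choices of an edge for each factor. Only choices
supporting a closed walk survive, and these choose one and the same edge everywhere, once at each of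
its vertices. -/
theorem walkFunctional_loops_mul_rows (hk : 3 ≤ k) (hu : ∀ e ∈ E, #e = k)
    (hl : ∀ e ∈ E, ∀ f ∈ E, e ≠ f → #(e ∩ f) ≤ 1) (N : ℕ) (z y : V → ℕ)
    (hy : ∑ i, y i ≤ k + 2) :
    walkFunctional V N (monomial (loopArcs k z) 1 *
      ∏ i, (∑ e ∈ E with i ∈ e, monomial (edgeArcs i e) 1) ^ y i) =
    (if y = 0 then walkFunctional V N (monomial (loopArcs k z) 1) else 0) +
      ∑ e ∈ E, if y = ind e then walkFunctional V N (monomial (loopArcs k z + edgeStar e) 1)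
        else 0 := by
  by_cases hy0 : y = 0
  · subst hy0
    rw [if_pos rfl, sum_eq_zero, add_zero]
    · simp
    · intro e he
      rw [if_neg]
      intro h
      have := sum_ind e
      rw [← h, hu e he] at this
      simp at this
      omega
  rw [if_neg hy0, zero_add]
  have h1 : ∏ i, (∑ e ∈ E with i ∈ e, monomial (edgeArcs i e) (1 : ℝ)) ^ y i =
      ∏ p : (Σ i, Fin (y i)), ∑ e ∈ E with p.1 ∈ e, monomial (edgeArcs p.1 e) (1 : ℝ) := by
    rw [Fintype.prod_sigma]
    exact prod_congr rfl fun i _ => by simp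
  rw [h1, prod_univ_sum, mul_sum, map_sum]
  simp only [← monomial_sum_one, monomial_mul, one_mul]
  have key : ∀ f ∈ Fintype.piFinset (fun p : (Σ i, Fin (y i)) => {e ∈ E | p.1 ∈ e}),
      walkFunctional V N (monomial (loopArcs k z + ∑ p, edgeArcs p.1 (f p)) 1) ≠ 0 →
      ∃ e ∈ E, (∀ p, f p = e) ∧ y = ind e := by
    intro f hf h
    obtain ⟨a, ha⟩ := exists_arcWalk_of_walkFunctional_ne_zero h
    refine rooted_edges_eq_of_arcWalk hk hu hl z y hy hy0 f (fun p => ?_) ha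
    simpa using Fintype.mem_piFinset.1 hf p
  by_cases hye : ∃ e ∈ E, y = ind e
  · obtain ⟨e, he, rfl⟩ := hye
    rw [sum_eq_single (fun _ => e), sum_eq_single e, if_pos rfl]
    · congr 4
      rw [Fintype.sum_sigma, edgeStar, ← sum_subset (subset_univ e)]
      · refine sum_congr rfl fun i hi => ?_
        change (∑ _y : Fin (ind e i), edgeArcs i e) = _
        rw [sum_const, card_univ, Fintype.card_fin, ind, if_pos hi, one_smul]
      · intro i _ hi
        change (∑ _y : Fin (ind e i), edgeArcs i e) = _
        rw [sum_const, card_univ, Fintype.card_fin, ind, if_neg hi, zero_smul]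
    · intro f _ hfe
      rw [if_neg fun h => hfe (ind_injective h).symm]
    · exact fun h => absurd he h
    · intro f hf hne
      by_contra h
      obtain ⟨e', _, h1, h2⟩ := key f hf h
      obtain rfl := ind_injective h2
      exact hne (funext h1)
    · intro h
      refine absurd (Fintype.mem_piFinset.2 fun p => ?_) h
      have : 0 < ind e p.1 := p.2.pos
      simp only [mem_filter]
      refine ⟨he, ?_⟩
      by_contra h'
      simp [ind, h'] at this
  · rw [sum_eq_zero, sum_eq_zero]
    · intro e he
      rw [if_neg fun h => hye ⟨e, he, h⟩]
    · intro f hf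
      by_contra h
      obtain ⟨e, he, _, h2⟩ := key f hf h
      exact hye ⟨e, he, h2⟩

/-- Each power is expanded binomially, `y i` counting the factors at i that contribute an edge
instead of loops. Only `y = 0` and `y = ind e` survive; for the latter the binomial coefficients
multiply to the product of the `δ i` over e. -/
theorem walkFunctional_prod_familyRow (hk : 3 ≤ k) (hu : ∀ e ∈ E, #e = k)
    (hl : ∀ e ∈ E, ∀ f ∈ E, e ≠ f → #(e ∩ f) ≤ 1) (D : V → ℝ) (b : ℝ) (N : ℕ) (δ : V → ℕ)
    (hδ : ∑ i, δ i ≤ k + 2) :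
    walkFunctional V N (∏ i, familyRow k D b E i ^ δ i) =
      (∏ i, D i ^ δ i) * walkFunctional V N (monomial (loopArcs k δ) 1) +
      ∑ e ∈ E, b ^ k * ((∏ i ∈ e, (δ i : ℝ)) * (∏ i, D i ^ (δ i - ind e i)) *
        walkFunctional V N (monomial (loopArcs k (δ - ind e) + edgeStar e) 1)) := by
  set c : (V → ℕ) → ℝ := fun y =>
    b ^ (∑ i, y i) * (∏ i, D i ^ (δ i - y i)) * ∏ i, ((δ i).choose (y i) : ℝ) with hc
  have h1 : ∏ i, familyRow k D b E i ^ δ i =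
      ∑ y ∈ Fintype.piFinset (fun i => range (δ i + 1)), c y •
        (monomial (loopArcs k (δ - y)) 1 *
          ∏ i, (∑ e ∈ E with i ∈ e, monomial (edgeArcs i e) 1) ^ y i) := by
    simp only [familyRow, add_pow]
    rw [prod_univ_sum]
    refine sum_congr rfl fun y _ => ?_
    rw [← prod_loops_eq, ← prod_mul_distrib, hc]
    simp only [smul_eq_C_mul, map_mul, map_prod, map_pow, map_natCast]
    rw [← prod_pow_eq_pow_sum, ← prod_mul_distrib, ← prod_mul_distrib, ← prod_mul_distrib]
    refine prod_congr rfl fun i _ => ?_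
    simp only [mul_pow, Pi.sub_apply]
    ring
  rw [h1, map_sum]
  have h2 : ∀ y ∈ Fintype.piFinset (fun i => range (δ i + 1)),
      walkFunctional V N (c y • (monomial (loopArcs k (δ - y)) 1 *
          ∏ i, (∑ e ∈ E with i ∈ e, monomial (edgeArcs i e) 1) ^ y i)) =
      (if y = 0 then c 0 * walkFunctional V N (monomial (loopArcs k δ) 1) else 0) +
      ∑ e ∈ E, if y = ind e then c (ind e) * walkFunctional V N
        (monomial (loopArcs k (δ - ind e) + edgeStar e) 1) else 0 := by
    intro y hy
    have hy' : ∑ i, y i ≤ k + 2 := by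
      refine (sum_le_sum fun i _ => ?_).trans hδ
      have := Fintype.mem_piFinset.1 hy i
      simp at this; omega
    rw [map_smul, walkFunctional_loops_mul_rows hk hu hl N _ y hy', smul_eq_mul, mul_add, mul_sum]
    congr 1
    · split_ifs with h
      · subst h; simp
      · simp
    · refine sum_congr rfl fun e _ => ?_
      split_ifs with h
      · subst h; rfl
      · simp
  rw [sum_congr rfl h2, sum_add_distrib]
  congr 1
  · rw [sum_ite_eq', if_pos (by simp)]
    simp [hc]
  · rw [sum_comm]
    refine sum_congr rfl fun e he => ?_
    rw [sum_ite_eq']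
    have h3 : ∏ i, ((δ i).choose (ind e i) : ℝ) = ∏ i ∈ e, (δ i : ℝ) := by
      rw [← prod_subset (subset_univ e)]
      · exact prod_congr rfl fun i hi => by simp [ind, hi]
      · intro i _ hi; simp [ind, hi]
    split_ifs with h
    · rw [hc]
      simp only [h3, sum_ind, hu e he]
      ring
    -- If `ind e ≤ δ` fails, the choice `y = ind e` does not occur. The term on the right vanishes
    -- as well, since some `δ i` with i in e is 0, so the truncated subtraction does no harm.
    · have : ∃ i ∈ e, δ i = 0 := by
        by_contra! h'
        refine h (Fintype.mem_piFinset.2 fun i => ?_)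
        by_cases hi : i ∈ e
        · have := h' i hi
          simp [ind, hi]; omega
        · simp [ind, hi]
      obtain ⟨i, hi, h0⟩ := this
      rw [prod_eq_zero hi (by simp [h0])]
      simp

end Tensor

/-! ### Closed walks on one edge with loops, and their weights -/

namespace Tensor

open MvPolynomial Finset

variable {V : Type*} [DecidableEq V] {k : ℕ}

theorem edgeStar_apply (e : Finset V) (u v : V) :
    edgeStar e (u, v) = if u ∈ e ∧ v ∈ e ∧ v ≠ u then 1 else 0 := by
  rw [edgeStar, Finsupp.finsetSum_apply]
  simp only [edgeArcs_apply]
  by_cases hu : u ∈ e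
  · rw [sum_eq_single u (fun i _ hi => by simp [hi.symm]) (fun h => absurd hu h)]
    simp [hu]
  · rw [sum_eq_zero fun i hi => if_neg fun h : u = i ∧ _ => hu (h.1 ▸ hi)]
    simp [hu]

theorem edgeStar_insert {r : V} {s : Finset V} (hr : r ∉ s) :
    edgeStar (insert r s) = edgeStar s +
      ∑ c ∈ s, (Finsupp.single (r, c) 1 + Finsupp.single (c, r) 1) := by
  ext ⟨u, v⟩
  have h1 : (∑ c ∈ s, if r = u ∧ c = v then 1 else 0) = if u = r ∧ v ∈ s then 1 else 0 := by
    by_cases h : r = u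
    · simp [h]
    · simp [h, Ne.symm h]
  have h2 : (∑ c ∈ s, if c = u ∧ r = v then 1 else 0) = if u ∈ s ∧ v = r then 1 else 0 := by
    by_cases h : r = v
    · simp [h]
    · simp [h, Ne.symm h]
  rw [Finsupp.add_apply, Finsupp.finsetSum_apply, edgeStar_apply, edgeStar_apply]
  simp only [Finsupp.add_apply, sum_add_distrib, Finsupp.single_apply, Prod.mk.injEq, h1, h2]
  by_cases hu : u = r
  · subst hu
    by_cases hv : v = u
    · subst hv; simp [hr]
    · simp [hr, hv]
  · by_cases hv : v = r
    · subst hv; simp [hr, hu, Ne.symm hu]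
    · simp [hu, hv]

/-- Induction on the set: go from r to b, run through everything on `insert b s`, return to r, visit
each remaining vertex and come back, and finally take the loops at r. -/
theorem arcWalk_edgeStar_insert (n : V → ℕ) (s : Finset V) :
    ∀ r ∉ s, ArcWalk r r (edgeStar (insert r s) +
      ∑ i ∈ insert r s, n i • Finsupp.single (i, i) 1) := by
  induction s using Finset.induction_on with
  | empty =>
    intro r _
    have : edgeStar ({r} : Finset V) = 0 := by
      ext ⟨u, v⟩
      rw [edgeStar_apply, if_neg (by simp; rintro rfl h; exact h)]; rfl
    simpa [this] using (ArcWalk.single r r).nsmul (n r)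
  | insert b s hb ih =>
    intro r hr
    have hrb : r ≠ b := fun h => hr (by simp [h])
    have hrs : r ∉ s := fun h => hr (by simp [h])
    have h1 := ((ArcWalk.single r b).trans (ih b hb)).trans (ArcWalk.single b r)
    have h2 := ArcWalk.sum s fun c _ => (ArcWalk.single r c).trans (ArcWalk.single c r)
    have h3 := (h1.trans h2).trans ((ArcWalk.single r r).nsmul (n r))
    rw [edgeStar_insert hr, sum_insert hr, sum_insert (f := fun c => _ + _) hb]
    convert h3 using 1
    abel

theorem degree_edgeStar (e : Finset V) : (edgeStar e).degree = #e * (#e - 1) := by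
  rw [edgeStar, map_sum, ← smul_eq_mul, ← sum_const]
  refine sum_congr rfl fun i hi => ?_
  rw [edgeArcs, map_sum]
  simp [card_erase_of_mem hi]

theorem mapDomain_edgeStar (σ : Equiv.Perm V) (e : Finset V) :
    (edgeStar e).mapDomain (σ.prodCongr σ) = edgeStar (e.map σ.toEmbedding) := by
  rw [edgeStar, edgeStar, Finsupp.mapDomain_finsetSum, sum_map]
  refine sum_congr rfl fun i _ => ?_
  rw [edgeArcs, edgeArcs, Finsupp.mapDomain_finsetSum]
  change _ = ∑ j ∈ (e.map σ.toEmbedding).erase (σ.toEmbedding i), _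
  rw [← map_erase, sum_map]
  simp [Finsupp.mapDomain_single]

variable [Fintype V]

theorem arcWalk_loopArcs_add_edgeStar {e : Finset V} {r : V} (hr : r ∈ e) {z : V → ℕ}
    (hz : ∀ i, z i ≠ 0 → i ∈ e) : ArcWalk r r (loopArcs k z + edgeStar e) := by
  have h := arcWalk_edgeStar_insert (fun i => z i * (k - 1)) (e.erase r) r (by simp)
  rw [insert_erase hr] at h
  rw [add_comm]
  convert h using 2
  rw [loopArcs, ← sum_subset (subset_univ e)]
  · simp
  · intro i _ hi
    have : z i = 0 := by_contra fun h => hi (hz i h)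
    simp [this]

theorem mem_of_arcWalk_loopArcs_add_edgeStar (hk : 2 ≤ k) {e : Finset V} (he : 2 ≤ #e)
    {z : V → ℕ} {a : V} (h : ArcWalk a a (loopArcs k z + edgeStar e)) {u : V} (hu : z u ≠ 0) :
    u ∈ e := by
  have hS := (h.mem_iff (e : Set V) fun u v huv => by
    rw [Finsupp.add_apply, loopArcs_apply, edgeStar_apply] at huv
    split_ifs at huv with h1 h2 h2
    · subst h1; simp
    · subst h1; simp
    · simp [h2.1, h2.2.1]
    · simp at huv).2
  obtain ⟨i, hi, j, hj, hij⟩ := one_lt_card.1 he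
  have ha : a ∈ (e : Set V) := (hS i j (by
    rw [Finsupp.add_apply, edgeStar_apply, if_pos ⟨hi, hj, hij.symm⟩]; simp)).2 hi
  refine (hS u u ?_).1 ha
  rw [Finsupp.add_apply, loopArcs_apply, if_pos rfl]
  have : 0 < z u * (k - 1) := Nat.mul_pos (Nat.pos_of_ne_zero hu) (by omega)
  omega

theorem eq_of_arcWalk_loopArcs (hk : 2 ≤ k) {z : V → ℕ} {a : V} (h : ArcWalk a a (loopArcs k z))
    {u : V} (hu : z u ≠ 0) : u = a := by
  have hS := (h.mem_iff {a} fun u v huv => by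
    rw [loopArcs_apply] at huv
    split_ifs at huv with h1
    · subst h1; simp
    · simp at huv).2
  refine (hS u u ?_).1 rfl
  rw [loopArcs_apply, if_pos rfl]
  have : 0 < z u * (k - 1) := Nat.mul_pos (Nat.pos_of_ne_zero hu) (by omega)
  omega

omit [DecidableEq V] in
theorem degree_loopArcs (z : V → ℕ) : (loopArcs k z).degree = (∑ i, z i) * (k - 1) := by
  rw [loopArcs, map_sum, sum_mul]
  exact sum_congr rfl fun i _ => Finsupp.degree_single _ _

/-- The weight of the loops `δ` in the trace. -/
noncomputable def diagWeight (k : ℕ) (δ : V → ℕ) : ℝ :=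
  (∏ i, 1 / ((δ i * (k - 1)).factorial : ℝ)) *
    walkFunctional V ((∑ i, δ i) * (k - 1)) (monomial (loopArcs k δ) 1)

/-- The weight of an edge together with the loops `z` in the trace. -/
noncomputable def edgeWeight (k : ℕ) (e : Finset V) (z : V → ℕ) : ℝ :=
  (∏ i, 1 / (((z i + ind e i) * (k - 1)).factorial : ℝ)) * (∏ i ∈ e, ((z i : ℝ) + 1)) *
    walkFunctional V ((∑ i, z i + #e) * (k - 1)) (monomial (loopArcs k z + edgeStar e) 1)

theorem diagWeight_single_pos (v : V) (d : ℕ) : 0 < diagWeight k (Pi.single v d) := by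
  refine mul_pos (prod_pos fun i _ => by positivity) (walkFunctional_monomial_pos (a := v) ?_ ?_)
  · rw [loopArcs, sum_eq_single v (fun i _ hi => by simp [hi]) (by simp)]
    have := (ArcWalk.single v v).nsmul (d * (k - 1))
    simpa using this
  · rw [degree_loopArcs]

/-- A walk that uses only loops never leaves its starting vertex. -/
theorem diagWeight_ne_zero (hk : 2 ≤ k) {δ : V → ℕ} (h : diagWeight k δ ≠ 0) :
    ∃ v, δ = Pi.single v (∑ i, δ i) := by
  obtain ⟨a, ha⟩ := exists_arcWalk_of_walkFunctional_ne_zero (right_ne_zero_of_mul h)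
  have h0 : ∀ u, u ≠ a → δ u = 0 := fun u hu =>
    by_contra fun h => hu (eq_of_arcWalk_loopArcs hk ha h)
  refine ⟨a, funext fun u => ?_⟩
  rw [sum_eq_single a (fun i _ hi => h0 i hi) (by simp)]
  by_cases hu : u = a
  · subst hu; simp
  · simp [hu, h0 u hu]

theorem edgeWeight_pos (hk : 1 ≤ k) {e : Finset V} (he : #e = k) {z : V → ℕ}
    (hz : ∀ i, z i ≠ 0 → i ∈ e) : 0 < edgeWeight k e z := by
  obtain ⟨r, hr⟩ := card_pos.1 (he.symm ▸ hk)
  refine mul_pos (mul_pos (prod_pos fun i _ => by positivity) (prod_pos fun i _ => by positivity))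
    (walkFunctional_monomial_pos (arcWalk_loopArcs_add_edgeStar hr hz) ?_)
  rw [map_add, degree_loopArcs, degree_edgeStar, he, add_mul]

theorem edgeWeight_ne_zero (hk : 2 ≤ k) {e : Finset V} (he : #e = k) {z : V → ℕ}
    (h : edgeWeight k e z ≠ 0) {i : V} (hi : z i ≠ 0) : i ∈ e := by
  obtain ⟨a, ha⟩ := exists_arcWalk_of_walkFunctional_ne_zero (right_ne_zero_of_mul h)
  exact mem_of_arcWalk_loopArcs_add_edgeStar hk (he.symm ▸ hk) ha hi

omit [DecidableEq V] in
theorem mapDomain_loopArcs (σ : Equiv.Perm V) (z : V → ℕ) :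
    (loopArcs k z).mapDomain (σ.prodCongr σ) = loopArcs k (z ∘ σ.symm) := by
  rw [loopArcs, loopArcs, Finsupp.mapDomain_finsetSum]
  refine Fintype.sum_equiv σ _ _ fun i => ?_
  rw [Finsupp.mapDomain_single, Function.comp_apply, Equiv.symm_apply_apply]
  rfl

theorem diagWeight_perm (σ : Equiv.Perm V) (δ : V → ℕ) :
    diagWeight k (δ ∘ σ.symm) = diagWeight k δ := by
  unfold diagWeight
  rw [← walkFunctional_rename σ _ (monomial (loopArcs k δ) 1), rename_monomial, mapDomain_loopArcs,
    ← Equiv.sum_comp σ, ← Equiv.prod_comp σ]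
  simp

/-- The matrix trace is invariant under renaming the vertices. Hence a weight depends only on the
orbit of the edge with its loops, which makes the constants in the trace formula independent of the
hypergraph. -/
theorem edgeWeight_perm (σ : Equiv.Perm V) (e : Finset V) (z : V → ℕ) :
    edgeWeight k (e.map σ.toEmbedding) (z ∘ σ.symm) = edgeWeight k e z := by
  unfold edgeWeight
  rw [← walkFunctional_rename σ _ (monomial (loopArcs k z + edgeStar e) 1), rename_monomial,
    Finsupp.mapDomain_add, mapDomain_loopArcs, mapDomain_edgeStar,
    ← Equiv.sum_comp σ, ← Equiv.prod_comp σ, prod_map]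
  simp [ind]

end Tensor

/-! ### Sums over distributions of one or two loops -/

namespace Finset

variable {V : Type*} [DecidableEq V]

theorem sum_piAntidiag_cons {i : V} {s : Finset V} (hi : i ∉ s) (n : ℕ) (F : (V → ℕ) → ℝ) :
    ∑ z ∈ piAntidiag (cons i s hi) n, F z =
      ∑ p ∈ antidiagonal n, ∑ z ∈ piAntidiag s p.2, F (z + Pi.single i p.1) := by
  rw [piAntidiag_cons, sum_disjiUnion]
  refine sum_congr rfl fun p _ => ?_
  rw [sum_map]
  refine sum_congr rfl fun z _ => congrArg F ?_
  ext t
  simp [Pi.single_apply]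

theorem sum_piAntidiag_one (s : Finset V) (F : (V → ℕ) → ℝ) :
    ∑ z ∈ piAntidiag s 1, F z = ∑ v ∈ s, F (Pi.single v 1) := by
  induction s using Finset.cons_induction generalizing F with
  | empty => simp
  | cons i s hi ih =>
    rw [sum_piAntidiag_cons, sum_cons, show antidiagonal 1 = {(0, 1), (1, 0)} from rfl]
    simp [ih, add_comm]

/-- The factor 2 lets the double sum run over ordered pairs, each unordered pair being counted
twice. -/
theorem two_mul_sum_piAntidiag_two (s : Finset V) (F : (V → ℕ) → ℝ) :
    2 * ∑ z ∈ piAntidiag s 2, F z = 2 * ∑ v ∈ s, F (Pi.single v 2) +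
      ∑ v ∈ s, ∑ w ∈ s.erase v, F (Pi.single v 1 + Pi.single w 1) := by
  induction s using Finset.cons_induction generalizing F with
  | empty => simp
  | cons i s hi ih =>
    have h1 : ∀ v ∈ s, ∑ w ∈ (cons i s hi).erase v, F (Pi.single v 1 + Pi.single w 1) =
        F (Pi.single i 1 + Pi.single v 1) +
          ∑ w ∈ s.erase v, F (Pi.single v 1 + Pi.single w 1) := by
      intro v hv
      have hiv : i ≠ v := fun h => hi (h ▸ hv)
      rw [erase_cons_of_ne hi hiv, sum_cons, add_comm (Pi.single v 1)]
    rw [sum_piAntidiag_cons, sum_cons, sum_cons, sum_congr rfl h1, erase_cons, sum_add_distrib,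
      show antidiagonal 2 = {(0, 2), (1, 1), (2, 0)} from rfl]
    have := ih F
    have h2 := sum_piAntidiag_one s fun z => F (z + Pi.single i 1)
    simp only [add_comm _ (Pi.single i 1)] at h2
    simp [add_comm _ (Pi.single i 1), h2]
    linarith

end Finset

/-! ### The traces of order at most k + 2 -/

namespace Tensor

open MvPolynomial Finset

variable {V : Type*} [DecidableEq V] [Fintype V] {k : ℕ} {E : Finset (Finset V)}

/-- The trace, without the factor `(k-1)^(n-1)`, of the sum of a diagonal tensor and a multiple of
the adjacency tensor of a family of sets. -/
noncomputable def familyTrace (k : ℕ) (D : V → ℝ) (b : ℝ) (E : Finset (Finset V)) (d : ℕ) : ℝ :=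
  ∑ δ ∈ (univ : Finset V).piAntidiag d, (∏ i : V, 1 / ((δ i * (k - 1)).factorial : ℝ)) *
    walkFunctional V (d * (k - 1)) (∏ i, familyRow k D b E i ^ δ i)

/-- This is the substitution `δ = z + ind e`. Terms with `δ i = 0` for some i in e vanish through
the product of the `δ i`. Terms in which z has a loop outside e vanish because no closed walk joins
such a loop to the arcs of e. -/
theorem sum_edge_term_eq (hk : 2 ≤ k) {e : Finset V} (he : #e = k) (D : V → ℝ) (d : ℕ) :
    ∑ δ ∈ (univ : Finset V).piAntidiag d, (∏ i : V, 1 / ((δ i * (k - 1)).factorial : ℝ)) *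
      ((∏ i ∈ e, (δ i : ℝ)) * (∏ i, D i ^ (δ i - ind e i)) *
        walkFunctional V (d * (k - 1)) (monomial (loopArcs k (δ - ind e) + edgeStar e) 1)) =
    if k ≤ d then ∑ z ∈ e.piAntidiag (d - k), edgeWeight k e z * ∏ i, D i ^ z i else 0 := by
  have hpos : ∀ δ : V → ℕ, ∏ i ∈ e, (δ i : ℝ) ≠ 0 → ind e ≤ δ := by
    intro δ h i
    by_cases hi : i ∈ e
    · have := prod_ne_zero_iff.1 h i hi
      simp only [ind, if_pos hi]
      exact Nat.one_le_iff_ne_zero.2 (by simpa using this)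
    · simp [ind, hi]
  split_ifs with hd
  · symm
    have hsum : ∀ z ∈ e.piAntidiag (d - k), ∑ i, z i = d - k := by
      intro z hz
      rw [mem_piAntidiag] at hz
      rw [← hz.1]
      exact (sum_subset (subset_univ e) fun i _ hi => by_contra fun h => hi (hz.2 i h)).symm
    have heq : ∀ z : V → ℕ, ∑ i, z i = d - k → edgeWeight k e z * ∏ i, D i ^ z i =
        (∏ i : V, 1 / (((z + ind e) i * (k - 1)).factorial : ℝ)) *
      ((∏ i ∈ e, ((z + ind e) i : ℝ)) * (∏ i, D i ^ ((z + ind e) i - ind e i)) *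
        walkFunctional V (d * (k - 1))
          (monomial (loopArcs k (z + ind e - ind e) + edgeStar e) 1)) := by
      intro z hz
      have h1 : ∏ i ∈ e, ((z + ind e) i : ℝ) = ∏ i ∈ e, ((z i : ℝ) + 1) :=
        prod_congr rfl fun i hi => by simp [ind, hi]
      have h2 : d - k + #e = d := by omega
      rw [h1, edgeWeight, hz, h2]
      simp only [Pi.add_apply, add_tsub_cancel_right]
      ring
    refine sum_of_injOn (fun z => z + ind e) (fun z _ z' _ h => add_right_cancel h) ?_ ?_ ?_
    · intro z hz
      have := hsum z hz
      simp only [mem_coe, mem_piAntidiag, Pi.add_apply,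
        sum_add_distrib, sum_ind]
      rw [this]
      exact ⟨by omega, by simp⟩
    · intro δ hδ hne
      by_contra h
      have hle := hpos δ (left_ne_zero_of_mul (left_ne_zero_of_mul (right_ne_zero_of_mul h)))
      rw [mem_piAntidiag] at hδ
      refine hne ⟨δ - ind e, ?_, tsub_add_cancel_of_le hle⟩
      have hs : ∑ i, (δ - ind e) i = d - k := by
        have : ∑ i, (δ - ind e) i + ∑ i, ind e i = d := by
          rw [← sum_add_distrib, ← hδ.1]
          exact sum_congr rfl fun i _ => Nat.sub_add_cancel (hle i)
        rw [sum_ind] at this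
        omega
      have hmem : ∀ i, (δ - ind e) i ≠ 0 → i ∈ e := by
        intro i hi
        refine edgeWeight_ne_zero hk he (z := δ - ind e) ?_ hi
        have := heq (δ - ind e) hs
        rw [tsub_add_cancel_of_le hle] at this
        rw [← this] at h
        exact left_ne_zero_of_mul h
      rw [mem_coe, mem_piAntidiag]
      refine ⟨?_, hmem⟩
      rw [← hs]
      exact sum_subset (subset_univ e) fun i _ hi => by_contra fun h => hi (hmem i h)
    · intro z hz
      exact heq z (hsum z hz)
  · refine sum_eq_zero fun δ hδ => ?_
    by_contra h
    have hle := hpos δ (left_ne_zero_of_mul (left_ne_zero_of_mul (right_ne_zero_of_mul h)))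
    have := sum_le_sum fun i (_ : i ∈ univ) => hle i
    rw [sum_ind, (mem_piAntidiag.1 hδ).1] at this
    omega

theorem familyTrace_eq (hk : 3 ≤ k) (hu : ∀ e ∈ E, #e = k)
    (hl : ∀ e ∈ E, ∀ f ∈ E, e ≠ f → #(e ∩ f) ≤ 1) (D : V → ℝ) (b : ℝ) {d : ℕ} (hd : d ≤ k + 2) :
    familyTrace k D b E d =
      ∑ δ ∈ (univ : Finset V).piAntidiag d, diagWeight k δ * ∏ i, D i ^ δ i +
      b ^ k * ∑ e ∈ E, if k ≤ d then
        ∑ z ∈ e.piAntidiag (d - k), edgeWeight k e z * ∏ i, D i ^ z i else 0 := by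
  rw [familyTrace, mul_sum, ← sum_congr rfl fun e he => congrArg (b ^ k * ·)
    (sum_edge_term_eq (by omega) (hu e he) D d)]
  simp only [mul_sum]
  rw [sum_comm, ← sum_add_distrib]
  refine sum_congr rfl fun δ hδ => ?_
  rw [mem_piAntidiag] at hδ
  rw [walkFunctional_prod_familyRow hk hu hl D b _ δ (hδ.1.trans_le hd), mul_add, mul_sum,
    diagWeight, hδ.1]
  congr 1
  · ring
  · exact sum_congr rfl fun e _ => by ring

/-- Only δ concentrated at one vertex contributes, and transpositions show that all these weights
are equal. The condition `1 ≤ d` stands inside the existential so that c can be chosen for every d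
at once; for d = 0 the functions `Pi.single v 0` all coincide. -/
theorem exists_diagWeight_eq (hk : 2 ≤ k) (d : ℕ) : ∃ c : ℝ, 0 < c ∧ ∀ (_ : 1 ≤ d) (D : V → ℝ),
    ∑ δ ∈ (univ : Finset V).piAntidiag d, diagWeight k δ * ∏ i, D i ^ δ i =
      c * ∑ v, D v ^ d := by
  rcases isEmpty_or_nonempty V with hV | ⟨⟨v₀⟩⟩
  · refine ⟨1, one_pos, fun hd D => ?_⟩
    rw [univ_eq_empty, piAntidiag_empty_of_ne_zero (by omega)]
    simp
  refine ⟨diagWeight k (Pi.single v₀ d), diagWeight_single_pos v₀ d, fun hd D => ?_⟩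
  rw [mul_sum]
  symm
  refine sum_of_injOn (fun v => Pi.single v d) ?_ ?_ ?_ ?_
  · intro v _ w _ h
    by_contra hvw
    have := congrFun h v
    simp [hvw] at this
    omega
  · intro v _
    simp [mem_piAntidiag]
  · intro δ hδ hne
    by_contra h
    obtain ⟨v, hv⟩ := diagWeight_ne_zero hk (left_ne_zero_of_mul h)
    rw [(mem_piAntidiag.1 hδ).1] at hv
    exact hne ⟨v, by simp, hv.symm⟩
  · intro v _
    have h1 := diagWeight_perm (k := k) (Equiv.swap v₀ v) (Pi.single v₀ d)
    have h2 : (Pi.single v₀ d : V → ℕ) ∘ (Equiv.swap v₀ v).symm = Pi.single v d := by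
      ext u
      by_cases hu : u = v
      · subst hu; simp
      · by_cases hu' : u = v₀
        · subst hu'; simp [hu, Ne.symm hu]
        · simp [hu, hu', Equiv.swap_apply_of_ne_of_ne hu' hu]
    rw [← h1, h2]
    congr 1
    rw [prod_eq_single v (fun i _ hi => by simp [hi]) (by simp)]
    simp

end Tensor

namespace Tensor

open MvPolynomial Finset

/-- The set may be empty, for instance when there are fewer than k vertices; any positive constant
then serves. -/
theorem exists_pos_const {ι : Type*} (S : Set ι) (F : ι → ℝ) (hpos : ∀ x ∈ S, 0 < F x)
    (h : ∀ x ∈ S, ∀ y ∈ S, F x = F y) : ∃ c : ℝ, 0 < c ∧ ∀ x ∈ S, F x = c := by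
  rcases S.eq_empty_or_nonempty with rfl | ⟨x, hx⟩
  · exact ⟨1, one_pos, by simp⟩
  · exact ⟨F x, hpos x hx, fun y hy => h y hy x hx⟩

variable {V : Type*} [DecidableEq V] [Fintype V] {k : ℕ} {E : Finset (Finset V)}

/-- Together with the pointed versions below: permutations act transitively on sets of a given size,
also with one or two different marked elements. Hence the edge weights are constant for each pattern
of at most two loops. -/
theorem exists_perm_map_eq {e e' : Finset V} (h : #e = #e') :
    ∃ σ : Equiv.Perm V, e.map σ.toEmbedding = e' := by
  let f : {x // x ∈ e} ≃ {x // x ∈ e'} := Finset.equivOfCardEq h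
  refine ⟨f.extendSubtype, eq_of_subset_of_card_le (fun x hx => ?_) (by simp [h])⟩
  obtain ⟨y, hy, rfl⟩ := mem_map.1 hx
  exact f.extendSubtype_mem y hy

omit [Fintype V] in
theorem map_swap_eq {e : Finset V} {v w : V} (hv : v ∈ e) (hw : w ∈ e) :
    e.map (Equiv.swap v w).toEmbedding = e := by
  refine eq_of_subset_of_card_le (fun x hx => ?_) (by simp)
  obtain ⟨y, hy, rfl⟩ := mem_map.1 hx
  simp only [Equiv.toEmbedding_apply, Equiv.swap_apply_def]
  split_ifs <;> assumption

theorem exists_perm_map_eq_of_mem {e e' : Finset V} (h : #e = #e') {v v' : V} (hv : v ∈ e)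
    (hv' : v' ∈ e') : ∃ σ : Equiv.Perm V, e.map σ.toEmbedding = e' ∧ σ v = v' := by
  obtain ⟨σ, rfl⟩ := exists_perm_map_eq h
  refine ⟨σ.trans (Equiv.swap (σ v) v'), ?_, by simp⟩
  rw [Equiv.trans_toEmbedding, ← map_map, map_swap_eq (by simpa using hv) hv']

theorem exists_perm_map_eq_of_mem_pair {e e' : Finset V} (h : #e = #e') {v v' w w' : V}
    (hv : v ∈ e) (hv' : v' ∈ e') (hw : w ∈ e) (hw' : w' ∈ e') (hvw : v ≠ w) (hvw' : v' ≠ w') :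
    ∃ σ : Equiv.Perm V, e.map σ.toEmbedding = e' ∧ σ v = v' ∧ σ w = w' := by
  obtain ⟨σ, rfl, rfl⟩ := exists_perm_map_eq_of_mem h hv hv'
  refine ⟨σ.trans (Equiv.swap (σ w) w'), ?_, ?_, by simp⟩
  · rw [Equiv.trans_toEmbedding, ← map_map, map_swap_eq (by simpa using hw) hw']
  · exact Equiv.swap_apply_of_ne_of_ne (by simpa using hvw) hvw'

omit [Fintype V] in
theorem single_comp_symm (σ : Equiv.Perm V) (v : V) (n : ℕ) :
    (Pi.single v n : V → ℕ) ∘ σ.symm = Pi.single (σ v) n := by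
  ext u
  simp [Pi.single_apply, Equiv.symm_apply_eq]

theorem edgeWeight_congr {e e' : Finset V} {z z' : V → ℕ} {σ : Equiv.Perm V}
    (he : e.map σ.toEmbedding = e') (hz : z ∘ σ.symm = z') :
    edgeWeight k e z = edgeWeight k e' z' := by
  rw [← he, ← hz, edgeWeight_perm]

variable (V) in
/-- The traces of order at most `k + 2` of the sum of a diagonal tensor and a multiple of the
adjacency tensor of a linear family of sets. -/
theorem exists_familyTrace_formula (hk : 3 ≤ k) :
    ∃ (c : ℕ → ℝ) (κ₀ κ₁ κ₂ κ₁₁ : ℝ), (∀ d, 0 < c d) ∧ 0 < κ₁₁ ∧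
      ∀ E : Finset (Finset V), (∀ e ∈ E, #e = k) →
        (∀ e ∈ E, ∀ f ∈ E, e ≠ f → #(e ∩ f) ≤ 1) → ∀ (D : V → ℝ) (b : ℝ),
        (∀ d, 1 ≤ d → d < k → familyTrace k D b E d = c d * ∑ v, D v ^ d) ∧
        familyTrace k D b E k = c k * ∑ v, D v ^ k + b ^ k * (κ₀ * #E) ∧
        familyTrace k D b E (k + 1) = c (k + 1) * ∑ v, D v ^ (k + 1) +
          b ^ k * (κ₁ * ∑ e ∈ E, ∑ v ∈ e, D v) ∧
        familyTrace k D b E (k + 2) = c (k + 2) * ∑ v, D v ^ (k + 2) +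
          b ^ k * (κ₂ * ∑ e ∈ E, ∑ v ∈ e, D v ^ 2 +
            κ₁₁ * ∑ e ∈ E, ∑ v ∈ e, ∑ w ∈ e.erase v, D v * D w) := by
  choose c hc hc' using exists_diagWeight_eq (V := V) (k := k) (by omega)
  obtain ⟨κ₀, -, h₀⟩ := exists_pos_const {e : Finset V | #e = k} (fun e => edgeWeight k e 0)
    (fun e he => edgeWeight_pos (by omega) he (by simp)) (by
      intro e he e' he'
      obtain ⟨σ, hσ⟩ := exists_perm_map_eq (he.trans he'.symm)
      exact edgeWeight_congr hσ rfl)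
  have hone : ∀ n : ℕ, ∃ κ : ℝ, 0 < κ ∧ ∀ x ∈ {x : Finset V × V | #x.1 = k ∧ x.2 ∈ x.1},
      edgeWeight k x.1 (Pi.single x.2 n) = κ := by
    intro n
    refine exists_pos_const _ _ ?_ ?_
    · rintro ⟨e, v⟩ ⟨he, hv⟩
      refine edgeWeight_pos (by omega) he fun i hi => ?_
      by_contra h
      have : i ≠ v := fun h' => h (h' ▸ hv)
      simp [this] at hi
    · rintro ⟨e, v⟩ ⟨he, hv⟩ ⟨e', v'⟩ ⟨he', hv'⟩
      obtain ⟨σ, hσ, rfl⟩ := exists_perm_map_eq_of_mem (he.trans he'.symm) hv hv'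
      exact edgeWeight_congr hσ (single_comp_symm σ v n)
  obtain ⟨κ₁, -, h₁⟩ := hone 1
  obtain ⟨κ₂, -, h₂⟩ := hone 2
  obtain ⟨κ₁₁, hpos, h₁₁⟩ := exists_pos_const
    {x : Finset V × V × V | #x.1 = k ∧ x.2.1 ∈ x.1 ∧ x.2.2 ∈ x.1.erase x.2.1}
    (fun x => edgeWeight k x.1 (Pi.single x.2.1 1 + Pi.single x.2.2 1)) (by
      rintro ⟨e, v, w⟩ ⟨he, hv, hw⟩
      refine edgeWeight_pos (by omega) he fun i hi => ?_
      by_contra h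
      have h1 : i ≠ v := fun h' => h (h' ▸ hv)
      have h2 : i ≠ w := fun h' => h (by rw [h']; exact mem_of_mem_erase hw)
      simp [h1, h2] at hi) (by
      rintro ⟨e, v, w⟩ ⟨he, hv, hw⟩ ⟨e', v', w'⟩ ⟨he', hv', hw'⟩
      obtain ⟨σ, hσ, rfl, rfl⟩ := exists_perm_map_eq_of_mem_pair (he.trans he'.symm) hv hv'
        (mem_of_mem_erase hw) (mem_of_mem_erase hw') (ne_of_mem_erase hw).symm
        (ne_of_mem_erase hw').symm
      refine edgeWeight_congr hσ ?_
      rw [Pi.add_comp, single_comp_symm, single_comp_symm])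
  have hprod : ∀ (D : V → ℝ) v n, ∏ i, D i ^ (Pi.single v n : V → ℕ) i = D v ^ n := by
    intro D v n
    rw [prod_eq_single v (fun i _ hi => by simp [hi]) (by simp)]
    simp
  -- The constant is halved because the formula sums over ordered pairs of different vertices.
  refine ⟨c, κ₀, κ₁, κ₂, κ₁₁ / 2, hc, by positivity, fun E hu hl D b => ⟨?_, ?_, ?_, ?_⟩⟩
  · intro d hd hdk
    rw [familyTrace_eq hk hu hl D b (by omega), hc' d hd,
      sum_eq_zero fun e _ => if_neg (by omega), mul_zero, add_zero]
  · rw [familyTrace_eq hk hu hl D b (by omega), hc' k (by omega)]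
    congr 2
    rw [mul_comm, ← nsmul_eq_mul, ← sum_const]
    refine sum_congr rfl fun e he => ?_
    rw [if_pos le_rfl, Nat.sub_self, piAntidiag_zero, sum_singleton, h₀ e (hu e he)]
    simp
  · rw [familyTrace_eq hk hu hl D b (by omega), hc' _ (by omega)]
    congr 2
    rw [mul_sum]
    refine sum_congr rfl fun e he => ?_
    rw [if_pos (by omega), Nat.add_sub_cancel_left, sum_piAntidiag_one, mul_sum]
    refine sum_congr rfl fun v hv => ?_
    rw [h₁ (e, v) ⟨hu e he, hv⟩, hprod, pow_one]
  · rw [familyTrace_eq hk hu hl D b le_rfl, hc' _ (by omega)]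
    congr 2
    rw [mul_sum, mul_sum, ← sum_add_distrib]
    refine sum_congr rfl fun e he => ?_
    rw [if_pos (by omega), Nat.add_sub_cancel_left]
    have := two_mul_sum_piAntidiag_two e fun z => edgeWeight k e z * ∏ i, D i ^ z i
    have h4 : ∀ v ∈ e, edgeWeight k e (Pi.single v 2) *
        ∏ i, D i ^ (Pi.single v 2 : V → ℕ) i = κ₂ * D v ^ 2 := fun v hv => by
      rw [h₂ (e, v) ⟨hu e he, hv⟩, hprod]
    have h3 : ∀ v ∈ e, ∑ w ∈ e.erase v, edgeWeight k e (Pi.single v 1 + Pi.single w 1) *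
        ∏ i, D i ^ (Pi.single v 1 + Pi.single w 1 : V → ℕ) i =
        κ₁₁ * ∑ w ∈ e.erase v, D v * D w := by
      intro v hv
      rw [mul_sum]
      refine sum_congr rfl fun w hw => ?_
      rw [h₁₁ (e, v, w) ⟨hu e he, hv, hw⟩]
      simp only [Pi.add_apply, pow_add, prod_mul_distrib, hprod, pow_one]
    rw [sum_congr rfl h3, sum_congr rfl h4, ← mul_sum e, ← mul_sum e] at this
    linarith

end Tensor

/-! ### The moments of a uniform hypergraph as family traces -/

namespace Hypergraph

open Finset MvPolynomial Tensor

variable {V W : Type*}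

theorem degree_image (f : V ≃ W) (H : Hypergraph V) (v : V) :
    (H.image f).degree (f v) = H.degree v := by
  rw [degree, degree, ← Set.ncard_image_of_injective _ (Set.image_injective.2 f.injective)]
  congr 1
  ext e
  constructor
  · rintro ⟨⟨e, he, rfl⟩, hv⟩
    exact ⟨e, ⟨he, by simpa using hv⟩, rfl⟩
  · rintro ⟨e, ⟨he, hv⟩, rfl⟩
    exact ⟨⟨e, he, rfl⟩, by simpa using hv⟩

variable [Fintype V] [DecidableEq V] [Fintype W] [DecidableEq W]

theorem Iso.moment_eq {H : Hypergraph V} {H' : Hypergraph W} (h : H.Iso H') (k : ℕ) (α : ℝ)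
    (d : ℕ) : H.moment k α d = H'.moment k α d := by
  classical
  obtain ⟨f, rfl⟩ := h
  refine trace_congr f _ _ (fun i β => ?_) d
  have h1 : (insert (f i) (Set.range (f ∘ β)) ∈ (H.image f).edgeSet) =
      (insert i (Set.range β) ∈ H.edgeSet) := by
    rw [Set.range_comp, ← Set.image_insert_eq]
    exact propext (Set.image_injective.2 f.injective).mem_set_image
  simp only [alphaTensor, Pi.add_apply, Pi.smul_apply, degTensor, adjTensor, h1,
    degree_image, Function.comp_apply, f.apply_eq_iff_eq]
  congr

/-- The edges as finsets. -/
noncomputable def edgeFamily (H : Hypergraph V) : Finset (Finset V) :=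
  open Classical in {e | (e : Set V) ∈ H.edgeSet}

omit [DecidableEq V] in
theorem mem_edgeFamily {H : Hypergraph V} {e : Finset V} :
    e ∈ H.edgeFamily ↔ (e : Set V) ∈ H.edgeSet := by
  simp [edgeFamily]

theorem card_edgeFamily_filter (H : Hypergraph V) (v : V) :
    #{e ∈ H.edgeFamily | v ∈ e} = H.degree v := by
  classical
  rw [degree, ← Set.ncard_coe_finset,
    ← Set.ncard_image_of_injective _ (Finset.coe_injective (α := V))]
  congr 1
  ext e
  constructor
  · rintro ⟨e, he, rfl⟩
    simpa [mem_edgeFamily] using he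
  · rintro ⟨he, hv⟩
    exact ⟨e.toFinset, by simp [mem_edgeFamily, he, hv], by simp⟩

omit [DecidableEq V] in
theorem card_edgeFamily (H : Hypergraph V) : #H.edgeFamily = H.edgeSet.ncard := by
  classical
  rw [← Set.ncard_coe_finset, ← Set.ncard_image_of_injective _ (Finset.coe_injective (α := V))]
  congr 1
  ext e
  constructor
  · rintro ⟨e, he, rfl⟩
    simpa [mem_edgeFamily] using he
  · intro he
    exact ⟨e.toFinset, by simp [mem_edgeFamily, he], by simp⟩

omit [Fintype V] in
theorem tuple_of_insert_eq {k : ℕ} {e : Finset V} (he : #e = k) {i : V} (hi : i ∈ e)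
    {β : Fin (k - 1) → V} (h : insert i (univ.image β) = e) :
    Function.Injective β ∧ univ.image β = e.erase i := by
  have hsub : e.erase i ⊆ univ.image β := fun x hx => by
    rw [mem_erase, ← h, mem_insert] at hx
    exact hx.2.resolve_left hx.1
  have hc : #(e.erase i) = Fintype.card (Fin (k - 1)) := by
    rw [card_erase_of_mem hi, he, Fintype.card_fin]
  have hle : #(univ.image β) ≤ Fintype.card (Fin (k - 1)) := card_image_le
  have heq := eq_of_subset_of_card_le hsub (hc ▸ hle)
  refine ⟨?_, heq.symm⟩
  rw [← Set.injOn_univ, ← coe_univ, ← card_image_iff, ← heq, hc, card_univ]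

/-- The tuples are the orderings of the other k - 1 vertices of the edge; their number cancels the
normalisation of the adjacency tensor. -/
theorem card_tuples {k : ℕ} {e : Finset V} (he : #e = k) {i : V} (hi : i ∈ e) :
    #{β : Fin (k - 1) → V | insert i (univ.image β) = e} = (k - 1).factorial := by
  have hc : Fintype.card {x // x ∈ e.erase i} = k - 1 := by
    rw [Fintype.card_coe, card_erase_of_mem hi, he]
  have hcard : Fintype.card (Fin (k - 1) ↪ {x // x ∈ e.erase i}) = (k - 1).factorial := by
    rw [Fintype.card_embedding_eq, hc, Fintype.card_fin, Nat.descFactorial_self]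
  rw [← hcard, ← card_univ, ← card_image_of_injective univ (f :=
    fun (φ : Fin (k - 1) ↪ {x // x ∈ e.erase i}) j => (φ j : V)) fun φ ψ h =>
      DFunLike.ext _ _ fun j => Subtype.ext (congrFun h j)]
  congr 1
  ext β
  simp only [mem_filter, mem_univ, true_and, mem_image]
  constructor
  · intro h
    obtain ⟨hinj, himg⟩ := tuple_of_insert_eq he hi h
    exact ⟨⟨fun j => ⟨β j, himg ▸ mem_image_of_mem β (mem_univ j)⟩, fun a b hab =>
      hinj (congrArg Subtype.val hab)⟩, rfl⟩
  · rintro ⟨φ, rfl⟩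
    have : univ.image (fun j => (φ j : V)) = e.erase i := by
      refine eq_of_subset_of_card_le (fun x hx => ?_) ?_
      · obtain ⟨j, _, rfl⟩ := mem_image.1 hx
        exact (φ j).2
      · change _ ≤ #(image (Subtype.val ∘ φ) univ)
        rw [card_image_of_injective _ (Subtype.val_injective.comp φ.injective), card_univ,
          Fintype.card_fin, card_erase_of_mem hi, he]
    rw [this, insert_erase hi]

theorem rowPoly_alphaTensor (H : Hypergraph V) {k : ℕ} (hu : H.IsUniform k) (α : ℝ)
    (i : V) : rowPoly (H.alphaTensor k α) i =
      familyRow k (fun v => α * H.degree v) (1 - α) H.edgeFamily i := by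
  classical
  have h1 : ∀ β : Fin (k - 1) → V, H.alphaTensor k α i β =
      (1 - α) * (∑ e ∈ H.edgeFamily with i ∈ e,
        if insert i (univ.image β) = e then 1 / ((k - 1).factorial : ℝ) else 0) +
      if β = fun _ => i then α * H.degree i else 0 := by
    intro β
    rw [sum_ite_eq]
    simp only [alphaTensor, Pi.add_apply, Pi.smul_apply, degTensor, adjTensor, smul_eq_mul,
      mem_filter, mem_edgeFamily, coe_insert, coe_image, coe_univ, Set.image_univ, mem_insert_self,
      and_true, funext_iff, mul_ite, mul_zero]
    rw [add_comm]
  have h2 : ∀ e ∈ H.edgeFamily, i ∈ e →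
      ∑ β : Fin (k - 1) → V, (if insert i (univ.image β) = e then 1 / ((k - 1).factorial : ℝ)
        else 0) • ∏ j, X (R := ℝ) (i, β j) = monomial (edgeArcs i e) 1 := by
    intro e he hi
    have hek : #e = k := by
      rw [← hu e (mem_edgeFamily.1 he), Set.ncard_coe_finset]
    have h3 : ∀ β : Fin (k - 1) → V, insert i (univ.image β) = e →
        ∏ j, X (R := ℝ) (i, β j) = monomial (edgeArcs i e) 1 := by
      intro β hβ
      obtain ⟨hinj, himg⟩ := tuple_of_insert_eq hek hi hβ
      rw [edgeArcs, monomial_sum_one, ← himg, prod_image fun a _ b _ h => hinj h]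
      rfl
    simp only [ite_smul, zero_smul]
    rw [← sum_filter, sum_congr rfl fun β hβ => by rw [h3 β (mem_filter.1 hβ).2], sum_const,
      card_tuples hek hi, ← Nat.cast_smul_eq_nsmul ℝ, smul_smul, mul_one_div,
      div_self (by positivity), one_smul]
  rw [rowPoly, familyRow, ← sum_congr rfl fun e he =>
    h2 e (mem_filter.1 he).1 (mem_filter.1 he).2]
  simp only [h1, add_smul, sum_add_distrib, mul_smul, sum_smul, smul_sum]
  rw [sum_comm]
  congr 1
  simp [ite_smul, mul_smul]

theorem moment_eq_familyTrace (H : Hypergraph V) {k : ℕ} (hu : H.IsUniform k) (α : ℝ)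
    (d : ℕ) : H.moment k α d = ((k : ℝ) - 1) ^ (Fintype.card V - 1) *
      familyTrace k (fun v => α * H.degree v) (1 - α) H.edgeFamily d := by
  rw [moment, trace_eq_sum_walkFunctional, familyTrace]
  simp only [rowPoly_alphaTensor H hu]

end Hypergraph

/-! ### Two criteria for the strict order -/

namespace Hypergraph

open Finset Tensor

variable {V W : Type*} [Fintype V] [DecidableEq V] [Fintype W] [DecidableEq W]

theorem sum_edgeFamily (H : Hypergraph V) {R : Type*} [CommSemiring R] (F : V → R) :
    ∑ e ∈ H.edgeFamily, ∑ v ∈ e, F v = ∑ v, (H.degree v : R) * F v := by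
  simp_rw [← card_edgeFamily_filter H, card_filter, Nat.cast_sum, sum_mul]
  rw [sum_comm]
  refine sum_congr rfl fun e _ => ?_
  rw [← sum_subset (subset_univ e)]
  · exact sum_congr rfl fun v hv => by simp [hv]
  · intro v _ hv
    simp [hv]

omit [DecidableEq V] in
theorem IsUniform.card_eq {H : Hypergraph V} {k : ℕ} (h : H.IsUniform k) :
    ∀ e ∈ H.edgeFamily, #e = k := fun e he => by
  rw [← h e (mem_edgeFamily.1 he), Set.ncard_coe_finset]

theorem IsLinear.card_inter_le {H : Hypergraph V} (h : H.IsLinear) :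
    ∀ e ∈ H.edgeFamily, ∀ f ∈ H.edgeFamily, e ≠ f → #(e ∩ f) ≤ 1 := fun e he f hf hef => by
  rw [card_le_one_iff_subsingleton, coe_inter]
  exact h _ (mem_edgeFamily.1 he) _ (mem_edgeFamily.1 hf) fun h => hef (coe_injective h)

theorem sum_degree {H : Hypergraph V} {k : ℕ} (h : H.IsUniform k) :
    ∑ v, H.degree v = k * H.edgeSet.ncard := by
  have := H.sum_edgeFamily (fun _ => 1)
  simp only [mul_one, Nat.cast_id] at this
  rw [← this, ← card_edgeFamily, mul_comm, ← smul_eq_mul, ← sum_const]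
  exact sum_congr rfl fun e he => by simp [h.card_eq e he]

theorem moment_zero_eq {H H' : Hypergraph V} {k : ℕ} (hu : H.IsUniform k) (hu' : H'.IsUniform k)
    (α : ℝ) : H.moment k α 0 = H'.moment k α 0 := by
  rw [moment_eq_familyTrace H hu, moment_eq_familyTrace H' hu', familyTrace, familyTrace]
  simp

/-- Orders 0 and 1 depend only on the numbers of vertices and edges. Since 2 < k, order 2 is still a
positive multiple of α² ∑ d². -/
theorem SLT_of_sum_degree_sq_lt {H H' : Hypergraph V} {k : ℕ} (hk : 3 ≤ k) (hu : H.IsUniform k)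
    (hu' : H'.IsUniform k) (hl : H.IsLinear) (hl' : H'.IsLinear)
    (hm : H.edgeSet.ncard = H'.edgeSet.ncard) (hV : k + 2 < Fintype.card V) {α : ℝ} (hα : 0 < α)
    (h : ∑ v, H.degree v ^ 2 < ∑ v, H'.degree v ^ 2) : SLT k α H H' := by
  obtain ⟨c, κ₀, κ₁, κ₂, κ₁₁, hc, -, hf⟩ := exists_familyTrace_formula V hk
  have hlt := (hf _ hu.card_eq hl.card_inter_le (fun v => α * H.degree v) (1 - α)).1
  have hlt' := (hf _ hu'.card_eq hl'.card_inter_le (fun v => α * H'.degree v) (1 - α)).1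
  have hpos : (0 : ℝ) < ((k : ℝ) - 1) ^ (Fintype.card V - 1) := by
    have : (3 : ℝ) ≤ k := by exact_mod_cast hk
    exact pow_pos (by linarith) _
  refine ⟨rfl, 2, by omega, ?_, fun t ht => ?_, ?_⟩
  · exact lt_of_lt_of_le (by omega) (Nat.le_mul_of_pos_right _ (pow_pos (by omega) _))
  · interval_cases t
    · exact moment_zero_eq hu hu' α
    · rw [moment_eq_familyTrace H hu, moment_eq_familyTrace H' hu', hlt 1 le_rfl (by omega),
        hlt' 1 le_rfl (by omega)]
      simp only [pow_one, ← mul_sum, ← Nat.cast_sum, sum_degree hu, sum_degree hu', hm]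
  · rw [moment_eq_familyTrace H hu, moment_eq_familyTrace H' hu', hlt 2 (by omega) (by omega),
      hlt' 2 (by omega) (by omega)]
    simp only [mul_pow, ← mul_sum]
    have h' : (∑ v, (H.degree v : ℝ) ^ 2) < ∑ v, (H'.degree v : ℝ) ^ 2 := by exact_mod_cast h
    have := hc 2
    gcongr

/-- The sums of d_v and d_v² over incidences are ∑ d² and ∑ d³. So with equal power sums all orders
up to k + 1 agree, and order k + 2 can differ only in the products of degrees within an edge. Their
coefficient is positive because 0 < α < 1. -/
theorem SLT_of_sum_edge_sq_lt {H H' : Hypergraph V} {k : ℕ} (hk : 3 ≤ k) (hu : H.IsUniform k)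
    (hu' : H'.IsUniform k) (hl : H.IsLinear) (hl' : H'.IsLinear)
    (hm : H.edgeSet.ncard = H'.edgeSet.ncard) (hV : k + 2 < Fintype.card V) {α : ℝ} (hα : 0 < α)
    (hα₁ : α < 1) (hd : ∀ t, ∑ v, H.degree v ^ t = ∑ v, H'.degree v ^ t)
    (h : ∑ e ∈ H.edgeFamily, (∑ v ∈ e, H.degree v) ^ 2 <
      ∑ e ∈ H'.edgeFamily, (∑ v ∈ e, H'.degree v) ^ 2) : SLT k α H H' := by
  obtain ⟨c, κ₀, κ₁, κ₂, κ₁₁, hc, hκ, hf⟩ := exists_familyTrace_formula V hk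
  obtain ⟨hlt, hk0, hk1, hk2⟩ :=
    hf _ hu.card_eq hl.card_inter_le (fun v => α * H.degree v) (1 - α)
  obtain ⟨hlt', hk0', hk1', hk2'⟩ :=
    hf _ hu'.card_eq hl'.card_inter_le (fun v => α * H'.degree v) (1 - α)
  have hpos : (0 : ℝ) < ((k : ℝ) - 1) ^ (Fintype.card V - 1) := by
    have : (3 : ℝ) ≤ k := by exact_mod_cast hk
    exact pow_pos (by linarith) _
  have hdR : ∀ t, ∑ v, (H.degree v : ℝ) ^ t = ∑ v, (H'.degree v : ℝ) ^ t := fun t => by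
    exact_mod_cast hd t
  have hlin : ∀ G : Hypergraph V, ∑ e ∈ G.edgeFamily, ∑ v ∈ e, α * (G.degree v : ℝ) =
      α * ∑ v, (G.degree v : ℝ) ^ 2 := fun G => by
    rw [sum_edgeFamily, mul_sum]; exact sum_congr rfl fun v _ => by ring
  have hsq : ∀ G : Hypergraph V, ∑ e ∈ G.edgeFamily, ∑ v ∈ e, (α * (G.degree v : ℝ)) ^ 2 =
      α ^ 2 * ∑ v, (G.degree v : ℝ) ^ 3 := fun G => by
    rw [sum_edgeFamily, mul_sum]; exact sum_congr rfl fun v _ => by ring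
  -- The sum over v ≠ w in an edge is the square of the degree sum minus the sum of squares; the
  -- latter adds up to ∑ d³ over all edges.
  have hmix : ∀ G : Hypergraph V, ∑ e ∈ G.edgeFamily, ∑ v ∈ e, ∑ w ∈ e.erase v,
      α * (G.degree v : ℝ) * (α * (G.degree w : ℝ)) =
      α ^ 2 * (∑ e ∈ G.edgeFamily, (∑ v ∈ e, G.degree v) ^ 2 : ℕ) -
        α ^ 2 * ∑ v, (G.degree v : ℝ) ^ 3 := fun G => by
    rw [← hsq, Nat.cast_sum, mul_sum, ← sum_sub_distrib]
    refine sum_congr rfl fun e _ => ?_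
    push_cast
    rw [sq (∑ v ∈ e, _), sum_mul_sum, mul_sum, ← sum_sub_distrib]
    refine sum_congr rfl fun v hv => ?_
    rw [← add_sum_erase e _ hv, mul_add, mul_sum]
    have : ∀ w, α * (G.degree v : ℝ) * (α * (G.degree w : ℝ)) =
      α ^ 2 * ((G.degree v : ℝ) * (G.degree w : ℝ)) := fun w => by ring
    simp only [this]
    ring
  have aux : ∀ P A B S K a y x x' : ℝ, 0 < P → 0 < B → 0 < K → 0 < a → x < x' →
      P * (A + B * (S + K * (a * x - y))) < P * (A + B * (S + K * (a * x' - y))) := by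
    intro P A B S K a y x x' hP hB hK ha hx
    gcongr
  refine ⟨rfl, k + 2, by omega, ?_, fun t ht => ?_, ?_⟩
  · exact lt_of_lt_of_le hV (Nat.le_mul_of_pos_right _ (pow_pos (by omega) _))
  · rcases Nat.eq_zero_or_pos t with rfl | ht0
    · exact moment_zero_eq hu hu' α
    rw [moment_eq_familyTrace H hu, moment_eq_familyTrace H' hu']
    refine congrArg₂ (· * ·) rfl ?_
    rcases lt_trichotomy t k with h1 | rfl | h1
    · rw [hlt t ht0 h1, hlt' t ht0 h1]
      simp only [mul_pow, ← mul_sum, hdR]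
    · rw [hk0, hk0', card_edgeFamily, card_edgeFamily, hm]
      simp only [mul_pow, ← mul_sum, hdR]
    · obtain rfl : t = k + 1 := by omega
      rw [hk1, hk1', hlin, hlin]
      simp only [mul_pow, ← mul_sum, hdR]
  · rw [moment_eq_familyTrace H hu, moment_eq_familyTrace H' hu', hk2, hk2', hmix, hmix, hsq, hsq]
    simp only [mul_pow, ← mul_sum, hdR]
    have hb : (0 : ℝ) < 1 - α := by linarith
    have h' : ((∑ e ∈ H.edgeFamily, (∑ v ∈ e, H.degree v) ^ 2 : ℕ) : ℝ) <
      (∑ e ∈ H'.edgeFamily, (∑ v ∈ e, H'.degree v) ^ 2 : ℕ) := by exact_mod_cast h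
    exact aux _ _ _ _ _ _ _ _ _ hpos (pow_pos hb k) hκ (pow_pos hα 2) h'

end Hypergraph

/-! ### The incidence graph -/

namespace Hypergraph

variable {V : Type*}

/-- The bipartite graph of the incidences between vertices and edges. -/
def incGraph (H : Hypergraph V) : SimpleGraph (V ⊕ H.edgeSet) where
  Adj
    | .inl v, .inr e => v ∈ e.1
    | .inr e, .inl v => v ∈ e.1
    | _, _ => False
  symm := ⟨by rintro (v | e) (w | f) h <;> exact h⟩
  loopless := ⟨by rintro (v | e) h <;> exact h⟩

theorem card_incGraph_edgeSet [Finite V] {H : Hypergraph V} {k : ℕ} (hu : H.IsUniform k) :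
    Nat.card H.incGraph.edgeSet = k * H.edgeSet.ncard := by
  classical
  have := Fintype.ofFinite H.edgeSet
  let f : (Σ e : H.edgeSet, e.1) → H.incGraph.edgeSet := fun p =>
    ⟨s(.inl p.2.1, .inr p.1), p.2.2⟩
  have hf : Function.Bijective f := by
    constructor
    · rintro ⟨e, v⟩ ⟨e', v'⟩ h
      have h := congrArg Subtype.val h
      simp only [f, Sym2.eq_iff, Sum.inl.injEq, Sum.inr.injEq, reduceCtorEq, and_self,
        or_false] at h
      obtain ⟨h1, rfl⟩ := h
      obtain rfl := Subtype.ext h1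
      rfl
    · rintro ⟨s, hs⟩
      induction s using Sym2.ind with
      | _ x y =>
        rcases x with v | e <;> rcases y with w | f'
        · exact hs.elim
        · exact ⟨⟨f', v, hs⟩, rfl⟩
        · exact ⟨⟨e, w, hs⟩, Subtype.ext Sym2.eq_swap⟩
        · exact hs.elim
  rw [← Nat.card_congr (Equiv.ofBijective f hf), Nat.card_sigma,
    Finset.sum_congr rfl fun e _ => (Nat.card_coe_set_eq e.1).trans (hu e.1 e.2),
    Finset.sum_const, Finset.card_univ, smul_eq_mul, mul_comm, ← Nat.card_eq_fintype_card,
    Nat.card_coe_set_eq]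

theorem IsConnected.exists_mem_edge {H : Hypergraph V} (h : H.IsConnected)
    (hV : H.vertexSet = Set.univ) [Nontrivial V] (v : V) : ∃ e ∈ H.edgeSet, v ∈ e := by
  obtain ⟨w, hw⟩ := exists_ne v
  rcases (h.2 v (by simp [hV]) w (by simp [hV])).cases_head with h1 | ⟨c, ⟨e, he, hv, _⟩, _⟩
  · exact absurd h1.symm hw
  · exact ⟨e, he, hv⟩

theorem IsConnected.incGraph_connected {H : Hypergraph V} (h : H.IsConnected)
    (hV : H.vertexSet = Set.univ) (he : ∀ e ∈ H.edgeSet, e.Nonempty) : H.incGraph.Connected := by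
  obtain ⟨v₀, hv₀⟩ := h.1
  have hv : ∀ v, H.incGraph.Reachable (.inl v₀) (.inl v) := by
    intro v
    induction h.2 v₀ hv₀ v (by simp [hV]) with
    | refl => exact .rfl
    | tail _ h1 ih =>
      obtain ⟨e, he, h2, h3⟩ := h1
      have h4 : H.incGraph.Adj (.inl _) (.inr ⟨e, he⟩) := h2
      have h5 : H.incGraph.Adj (.inl _) (.inr ⟨e, he⟩) := h3
      exact ih.trans (h4.reachable.trans h5.symm.reachable)
  refine (SimpleGraph.connected_iff_exists_forall_reachable _).2 ⟨.inl v₀, ?_⟩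
  rintro (v | e)
  · exact hv v
  · obtain ⟨v, hve⟩ := he e.1 e.2
    have : H.incGraph.Adj (.inl v) (.inr e) := hve
    exact (hv v).trans this.reachable

section Cycle

variable {H : Hypergraph V} {l : ℕ} {v : Fin (l + 1) → V} {e : Fin (l + 1) → H.edgeSet}
  {G : SimpleGraph (V ⊕ H.edgeSet)}

-- Follows the cycle the long way round, from v_{i+1} to v_i, without using e_i.
open Fin.NatCast Fin.CommRing in
theorem reachable_of_cycle (i : Fin (l + 1))
    (h : ∀ j, j ≠ i → G.Adj (.inl (v j)) (.inr (e j)) ∧ G.Adj (.inl (v (j + 1))) (.inr (e j))) :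
    G.Reachable (.inl (v (i + 1))) (.inl (v i)) := by
  have key : ∀ n : ℕ, n ≤ l →
      G.Reachable (.inl (v (i + 1))) (.inl (v (i + 1 + (n : Fin (l + 1))))) := by
    intro n hn
    induction n with
    | zero => simp
    | succ n ih =>
      have hne : i + 1 + (n : Fin (l + 1)) ≠ i := by
        intro h'
        have h1 : ((n + 1 : ℕ) : Fin (l + 1)) = 0 := by
          rw [add_assoc, add_eq_left] at h'
          exact (Nat.cast_succ n).trans ((add_comm _ _).trans h')
        have h2 := congrArg Fin.val h1
        rw [Fin.val_natCast, Nat.mod_eq_of_lt (by omega)] at h2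
        simp at h2
      obtain ⟨h1, h2⟩ := h _ hne
      have := (ih (by omega)).trans (h1.reachable.trans h2.symm.reachable)
      rwa [add_assoc (i + 1), ← Nat.cast_succ] at this
  have := key l le_rfl
  have h1 : i + 1 + (l : Fin (l + 1)) = i := by
    rw [add_assoc, add_eq_left]
    exact (add_comm _ _).trans ((Nat.cast_succ l).symm.trans (Fin.natCast_self (l + 1)))
  rwa [h1] at this

variable (hv : ∀ i, v (i + 1) ≠ v i) (he : Function.Injective e)
  (hG : ∀ j, G.Adj (.inl (v j)) (.inr (e j)) ∧ G.Adj (.inl (v (j + 1))) (.inr (e j)))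

include hv he hG

/-- The rest of the cycle together with the other incidence of e_i replaces the deleted one. The
graph G is arbitrary, so the lemma still applies after an incidence off the cycle has been deleted.
-/
theorem not_isBridge_of_cycle (i : Fin (l + 1)) {w : V} (hw : w = v i ∨ w = v (i + 1)) :
    ¬ G.IsBridge s(.inl w, .inr (e i)) := by
  have hadj : G.Adj (.inl w) (.inr (e i)) := by
    rcases hw with rfl | rfl
    exacts [(hG i).1, (hG i).2]
  rw [SimpleGraph.isBridge_iff, not_not]
  have hr : (G.deleteEdges {s(.inl w, .inr (e i))}).Reachable (.inl (v (i + 1))) (.inl (v i)) := by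
    refine reachable_of_cycle (e := e) i fun j hj => ?_
    have hne : ∀ u, s(Sum.inl u, Sum.inr (e j)) ≠ s(Sum.inl w, Sum.inr (e i)) := by
      intro u h
      simp only [Sym2.eq_iff, Sum.inl.injEq, Sum.inr.injEq, reduceCtorEq, and_self,
        or_false] at h
      exact hj (he h.2)
    simp only [SimpleGraph.deleteEdges_adj, Set.mem_singleton_iff]
    exact ⟨⟨(hG j).1, hne _⟩, ⟨(hG j).2, hne _⟩⟩
  have hne : ∀ u, u ≠ w → s(Sum.inl u, Sum.inr (e i)) ≠ s(Sum.inl w, Sum.inr (e i)) := by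
    intro u hu h
    simp only [Sym2.eq_iff, Sum.inl.injEq, reduceCtorEq, and_self,
      or_false] at h
    exact hu h.1
  rcases hw with rfl | rfl
  · have : (G.deleteEdges {s(.inl (v i), .inr (e i))}).Adj (.inl (v (i + 1))) (.inr (e i)) := by
      rw [SimpleGraph.deleteEdges_adj]
      exact ⟨(hG i).2, hne _ (hv i)⟩
    exact hr.symm.trans this.reachable
  · have : (G.deleteEdges {s(.inl (v (i + 1)), .inr (e i))}).Adj (.inl (v i)) (.inr (e i)) := by
      rw [SimpleGraph.deleteEdges_adj]
      exact ⟨(hG i).1, hne _ (hv i).symm⟩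
    exact hr.trans this.reachable

end Cycle

end Hypergraph

/-! ### Unicyclicity and the number of incidences -/

namespace Hypergraph

variable {V : Type*} {H : Hypergraph V}

theorem IsCycle.apply_finRotate_ne {l : ℕ} {v : Fin l → V} {e : Fin l → Set V}
    (h : H.IsCycle v e) (i : Fin l) : v (finRotate l i) ≠ v i := by
  intro h'
  have h1 := h.vertex_injective h'
  obtain ⟨l, rfl⟩ : ∃ l', l = l' + 2 := ⟨l - 2, by have := h.two_le; omega⟩
  rw [finRotate_apply, add_eq_left] at h1
  exact one_ne_zero h1

/-- The edge of the incidence graph that belongs to an incidence. -/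
def incEdge (H : Hypergraph V) (w : V) (f : H.edgeSet) : Sym2 (V ⊕ H.edgeSet) :=
  s(.inl w, .inr f)

theorem incEdge_inj {w w' : V} {f f' : H.edgeSet} :
    H.incEdge w f = H.incEdge w' f' ↔ w = w' ∧ f = f' := by
  simp [incEdge]

/-- The edges of the incidence graph that a cycle runs through lie in `G`. -/
def CycleIn {l : ℕ} (v : Fin l → V) (e : Fin l → Set V) (G : SimpleGraph (V ⊕ H.edgeSet)) : Prop :=
  ∀ w, ∀ f : H.edgeSet, (w, f.1) ∈ cycleIncidences v e → H.incEdge w f ∈ G.edgeSet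

theorem IsCycle.mem_edgeSet_of_mem {l : ℕ} {v : Fin l → V} {e : Fin l → Set V}
    (h : H.IsCycle v e) {w : V} {f : Set V} (hw : (w, f) ∈ cycleIncidences v e) :
    f ∈ H.edgeSet ∧ w ∈ f := by
  obtain ⟨i, h1 | h1⟩ := hw <;> obtain ⟨rfl, rfl⟩ := Prod.mk.inj h1
  exacts [⟨h.edge_mem i, h.left_mem i⟩, ⟨h.edge_mem i, h.right_mem i⟩]

theorem IsCycle.not_isBridge {l : ℕ} {v : Fin l → V} {e : Fin l → Set V}
    (h : H.IsCycle v e) {G : SimpleGraph (V ⊕ H.edgeSet)} (hG : CycleIn v e G) {w : V}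
    {f : H.edgeSet} (hw : (w, f.1) ∈ cycleIncidences v e) : ¬ G.IsBridge (H.incEdge w f) := by
  obtain ⟨l, rfl⟩ : ∃ l', l = l' + 1 := ⟨l - 1, by have := h.two_le; omega⟩
  obtain ⟨i, hi⟩ := hw
  have hrot := h.apply_finRotate_ne
  simp only [finRotate_apply] at hi hrot
  have hf : f = ⟨e i, h.edge_mem i⟩ := by
    rcases hi with hi | hi <;> exact Subtype.ext (Prod.mk.inj hi).2
  subst hf
  refine not_isBridge_of_cycle (v := v) (e := fun i => ⟨e i, h.edge_mem i⟩) hrot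
    (fun a b hab => h.edge_injective (congrArg Subtype.val hab)) (fun j => ⟨?_, ?_⟩) i
    (hi.imp (fun h => (Prod.mk.inj h).1) fun h => (Prod.mk.inj h).1)
  · exact hG (v j) ⟨e j, h.edge_mem j⟩ ⟨j, .inl rfl⟩
  · exact hG (v (j + 1)) ⟨e j, h.edge_mem j⟩ ⟨j, .inr (by rw [finRotate_apply])⟩

theorem IsCycle.cycleIn {l : ℕ} {v : Fin l → V} {e : Fin l → Set V}
    (h : H.IsCycle v e) : CycleIn v e H.incGraph := fun _ _ hw =>
  (h.mem_edgeSet_of_mem hw).2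

theorem card_deleteEdges_edgeSet {α : Type*} [Finite α] {G : SimpleGraph α} {s : Sym2 α}
    (hs : s ∈ G.edgeSet) : Nat.card (G.deleteEdges {s}).edgeSet + 1 = Nat.card G.edgeSet := by
  rw [Nat.card_coe_set_eq, Nat.card_coe_set_eq, SimpleGraph.edgeSet_deleteEdges,
    Set.ncard_sdiff_singleton_add_one hs (Set.toFinite _)]

/-- An incidence on the second cycle only could be deleted without disconnecting the graph. The
first cycle would survive and allow a second deletion, leaving a connected graph with two edges
fewer than nodes. -/
theorem cycleIncidences_subset [Finite V] (hc : H.incGraph.Connected)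
    (hcard : Nat.card H.incGraph.edgeSet = Nat.card (V ⊕ H.edgeSet))
    {l l' : ℕ} {v : Fin l → V} {e : Fin l → Set V} {v' : Fin l' → V} {e' : Fin l' → Set V}
    (h : H.IsCycle v e) (h' : H.IsCycle v' e') :
    cycleIncidences v' e' ⊆ cycleIncidences v e := by
  rintro ⟨w, f⟩ hw
  by_contra hn
  lift f to H.edgeSet using (h'.mem_edgeSet_of_mem hw).1
  have c1 : (H.incGraph.deleteEdges {H.incEdge w f}).Connected :=
    hc.connected_delete_edge_of_not_isBridge (h'.not_isBridge h'.cycleIn hw)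
  have d1 := card_deleteEdges_edgeSet (h'.cycleIn w f hw)
  set G := H.incGraph.deleteEdges {H.incEdge w f} with hGdef
  have hG : CycleIn v e G := by
    intro u f' hu
    rw [hGdef, SimpleGraph.edgeSet_deleteEdges]
    refine ⟨h.cycleIn u f' hu, fun h1 => hn ?_⟩
    obtain ⟨rfl, rfl⟩ := incEdge_inj.1 h1
    exact hu
  clear_value G
  have hl := h.two_le
  let i : Fin l := ⟨0, by omega⟩
  have hi : (v i, e i) ∈ cycleIncidences v e := ⟨i, .inl rfl⟩
  have c2 := c1.connected_delete_edge_of_not_isBridge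
    (h.not_isBridge (f := ⟨e i, h.edge_mem i⟩) hG hi)
  have d2 := card_deleteEdges_edgeSet (hG (v i) ⟨e i, h.edge_mem i⟩ hi)
  have := c2.card_vert_le_card_edgeSet_add_one
  have d3 : Nat.card (G.deleteEdges {s(Sum.inl (v i), Sum.inr ⟨e i, h.edge_mem i⟩)}).edgeSet + 1 =
    Nat.card G.edgeSet := d2
  omega

/-- The incidence graph is bipartite, so a closed walk starting at a vertex has vertices at its even
positions and edges at its odd ones. -/
theorem exists_isCycle_of_walk {G : SimpleGraph (V ⊕ H.edgeSet)} (hG : G ≤ H.incGraph) {u : V}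
    (p : G.Walk (.inl u) (.inl u)) (hp : p.IsCycle) :
    ∃ (l : ℕ) (v : Fin l → V) (e : Fin l → Set V), H.IsCycle v e ∧ CycleIn v e G := by
  have hL := hp.three_le_length
  have hside : ∀ n, n ≤ p.length → ((p.getVert n).isLeft ↔ Even n) := by
    intro n hn
    induction n with
    | zero => simp
    | succ n ih =>
      have hadj := hG (p.adj_getVert_succ (i := n) (by omega))
      rw [Nat.even_add_one, ← ih (by omega)]
      generalize p.getVert n = x at *
      generalize p.getVert (n + 1) = y at *
      rcases x with x | x <;> rcases y with y | y <;> first | exact hadj.elim | simp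
  have heven : Even p.length := by
    rw [← hside _ le_rfl]; simp
  obtain ⟨l, hl⟩ := heven
  have hv : ∀ n, 2 * n ≤ p.length → ∃ w, p.getVert (2 * n) = .inl w := fun n hn => by
    have := (hside (2 * n) hn).2 (by simp)
    exact Sum.isLeft_iff.1 this
  have he : ∀ n, 2 * n + 1 ≤ p.length → ∃ f, p.getVert (2 * n + 1) = .inr f := fun n hn => by
    have h1 := (hside (2 * n + 1) hn).not.2 (by simp)
    rw [Bool.not_eq_true, Sum.isLeft_eq_false, Sum.isRight_iff] at h1
    exact h1
  choose v hv using fun i : Fin l => hv i (by omega)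
  choose e he using fun i : Fin l => he i (by omega)
  -- For the last i, position 2i + 2 is the end of the closed walk, which is its start, as the
  -- cyclic successor requires.
  have hrot : ∀ i : Fin l, p.getVert (2 * i + 2) = .inl (v (finRotate l i)) := by
    intro i
    obtain ⟨l, rfl⟩ : ∃ l', l = l' + 1 := ⟨l - 1, by omega⟩
    rw [← hv]
    rcases eq_or_ne i (Fin.last l) with rfl | hi
    · rw [finRotate_last]
      simp only [Fin.val_last, Fin.val_zero, mul_zero, SimpleGraph.Walk.getVert_zero]
      rw [show 2 * l + 2 = p.length by omega, SimpleGraph.Walk.getVert_length]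
    · rw [coe_finRotate_of_ne_last hi, mul_add]
  have hadj1 : ∀ i : Fin l, G.Adj (.inl (v i)) (.inr (e i)) := fun i => by
    rw [← hv, ← he]; exact p.adj_getVert_succ (by omega)
  have hadj2 : ∀ i : Fin l, G.Adj (.inl (v (finRotate l i))) (.inr (e i)) := fun i => by
    rw [← hrot, ← he]; exact (p.adj_getVert_succ (by omega)).symm
  have hinj := hp.getVert_injOn'
  refine ⟨l, v, fun i => (e i).1, ⟨by omega, ?_, ?_, fun i => (e i).2, fun i => hG (hadj1 i),
    fun i => hG (hadj2 i)⟩, ?_⟩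
  · intro i j hij
    have := hinj (x₁ := 2 * i) (x₂ := 2 * j) (by simp; omega) (by simp; omega)
      (by rw [hv, hv, hij])
    omega
  · intro i j hij
    have := hinj (x₁ := 2 * i + 1) (x₂ := 2 * j + 1) (by simp; omega) (by simp; omega)
      (by rw [he, he, Subtype.ext hij])
    omega
  · rintro w f ⟨i, h1 | h1⟩
    · obtain ⟨rfl, h2⟩ := Prod.mk.inj h1
      obtain rfl := Subtype.ext h2
      exact hadj1 i
    · obtain ⟨rfl, h2⟩ := Prod.mk.inj h1
      obtain rfl := Subtype.ext h2
      exact hadj2 i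

/-- Deleting one incidence of the cycle keeps the graph connected. A remaining graph cycle would
give a hypergraph cycle with, by uniqueness, the same incidences, among them the deleted one. So a
tree remains. -/
theorem IsUnicyclic.card_incGraph_edgeSet [Finite V] (h : H.IsUnicyclic)
    (hV : H.vertexSet = Set.univ) (hne : ∀ e ∈ H.edgeSet, e.Nonempty) :
    Nat.card H.incGraph.edgeSet = Nat.card (V ⊕ H.edgeSet) := by
  obtain ⟨hconn, C, ⟨l, v, e, hcyc, rfl⟩, huniq⟩ := h
  have hc := hconn.incGraph_connected hV hne
  have hl := hcyc.two_le
  let i : Fin l := ⟨0, by omega⟩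
  have hi : (v i, e i) ∈ cycleIncidences v e := ⟨i, .inl rfl⟩
  have c1 := hc.connected_delete_edge_of_not_isBridge
    (hcyc.not_isBridge (f := ⟨e i, hcyc.edge_mem i⟩) hcyc.cycleIn hi)
  have d1 := card_deleteEdges_edgeSet (hcyc.cycleIn (v i) ⟨e i, hcyc.edge_mem i⟩ hi)
  rw [incEdge] at d1
  set G := H.incGraph.deleteEdges {s(Sum.inl (v i), Sum.inr ⟨e i, hcyc.edge_mem i⟩)} with hGdef
  have hG : G ≤ H.incGraph := SimpleGraph.deleteEdges_le _
  have hwalk : ∀ u (p : G.Walk (.inl u) (.inl u)), ¬ p.IsCycle := by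
    intro u p hp
    obtain ⟨l', v', e', h', hin⟩ := exists_isCycle_of_walk hG p hp
    have := huniq _ ⟨l', v', e', h', rfl⟩
    rw [← this] at hi
    have h2 := hin (v i) ⟨e i, hcyc.edge_mem i⟩ hi
    rw [hGdef, SimpleGraph.edgeSet_deleteEdges] at h2
    exact h2.2 rfl
  have hac : G.IsAcyclic := by
    classical
    -- A graph cycle based at an edge node is rotated to start at the next node, which is a vertex
    -- of the hypergraph.
    rintro (u | f) p hp
    · exact hwalk u p hp
    · have hadj := p.adj_snd hp.not_nil
      have hs : p.snd ∈ p.support := p.getVert_mem_support 1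
      generalize hx : p.snd = x at *
      rcases x with u | f'
      · exact hwalk u (p.rotate _ hs) (hp.rotate hs)
      · exact (hG hadj).elim
  have := (SimpleGraph.isTree_iff_connected_and_card.1 ⟨c1, hac⟩).2
  omega

end Hypergraph

/-! ### Neighbouring edges, and isomorphism from the pairs of edges that meet -/

namespace Hypergraph

open Finset

variable {V W : Type*} [Fintype V] [DecidableEq V] [Fintype W] [DecidableEq W]

/-- The edges different from `e` that meet `e`. -/
noncomputable def edgeNeighbors (H : Hypergraph V) (e : Finset V) : Finset (Finset V) :=
  {f ∈ H.edgeFamily | f ≠ e ∧ (e ∩ f).Nonempty}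

theorem mem_edgeNeighbors {H : Hypergraph V} {e f : Finset V} :
    f ∈ H.edgeNeighbors e ↔ f ∈ H.edgeFamily ∧ f ≠ e ∧ (e ∩ f).Nonempty := by
  simp [edgeNeighbors]

/-- Counting pairs of a vertex of e and an edge through it, e itself counts k times and, by
linearity, each neighbour once. -/
theorem sum_degree_edge {H : Hypergraph V} {k : ℕ} (hu : H.IsUniform k) (hl : H.IsLinear)
    {e : Finset V} (he : e ∈ H.edgeFamily) :
    ∑ v ∈ e, H.degree v = k + #(H.edgeNeighbors e) := by
  have h1 : ∑ v ∈ e, H.degree v = ∑ f ∈ H.edgeFamily, #(e ∩ f) := by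
    simp_rw [← card_edgeFamily_filter, card_filter]
    rw [sum_comm]
    exact sum_congr rfl fun f _ => by rw [← card_filter, filter_mem_eq_inter]
  rw [h1, ← add_sum_erase _ _ he, inter_self, hu.card_eq e he, edgeNeighbors, card_filter,
    ← sum_erase (a := e) H.edgeFamily (by simp)]
  congr 1
  refine sum_congr rfl fun f hf => ?_
  have h2 := hl.card_inter_le e he f (mem_of_mem_erase hf) (ne_of_mem_erase hf).symm
  split_ifs with h
  · have := card_pos.2 h.2
    omega
  · rw [card_eq_zero, ← not_nonempty_iff_eq_empty]
    exact fun h' => h ⟨ne_of_mem_erase hf, h'⟩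

/-- An enumeration of the edges of a hypergraph. -/
structure IsEdgeEnum (H : Hypergraph V) (m : ℕ) (a : ℕ → Finset V) : Prop where
  inj : ∀ i < m, ∀ j < m, a i = a j → i = j
  mem_iff : ∀ e, e ∈ H.edgeFamily ↔ ∃ i < m, a i = e

/-- The indices of the edges that contain a vertex. -/
def edgeIndices (a : ℕ → Finset V) (m : ℕ) (v : V) : Finset ℕ := {i ∈ range m | v ∈ a i}

omit [Fintype V] in
theorem mem_edgeIndices {a : ℕ → Finset V} {m i : ℕ} {v : V} :
    i ∈ edgeIndices a m v ↔ i < m ∧ v ∈ a i := by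
  simp [edgeIndices]

theorem IsEdgeEnum.card_edgeIndices {H : Hypergraph V} {m : ℕ} {a : ℕ → Finset V}
    (ha : H.IsEdgeEnum m a) (v : V) : #(edgeIndices a m v) = H.degree v := by
  rw [← card_edgeFamily_filter]
  have : {e ∈ H.edgeFamily | v ∈ e} = (edgeIndices a m v).image a := by
    ext e
    simp only [mem_filter, ha.mem_iff, mem_image, mem_edgeIndices]
    constructor
    · rintro ⟨⟨i, hi, rfl⟩, hv⟩; exact ⟨i, ⟨hi, hv⟩, rfl⟩
    · rintro ⟨i, ⟨hi, hv⟩, rfl⟩; exact ⟨⟨i, hi, rfl⟩, hv⟩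
  rw [this, card_image_of_injOn]
  intro i hi j hj h
  rw [mem_coe, mem_edgeIndices] at hi hj
  exact ha.inj i hi.1 j hj.1 h

theorem IsEdgeEnum.card_fiber_pair {H : Hypergraph V} {m : ℕ} {a : ℕ → Finset V}
    (ha : H.IsEdgeEnum m a) (hl : H.IsLinear) (hd : ∀ v, H.degree v ≤ 2) {i j : ℕ} (hi : i < m)
    (hj : j < m) (hij : i ≠ j) :
    #{v | edgeIndices a m v = {i, j}} = if (a i ∩ a j).Nonempty then 1 else 0 := by
  have h1 : ({v | edgeIndices a m v = {i, j}} : Finset V) = a i ∩ a j := by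
    ext v
    simp only [mem_filter, mem_univ, true_and, mem_inter]
    constructor
    · intro h
      exact ⟨(mem_edgeIndices.1 (h ▸ by simp : i ∈ edgeIndices a m v)).2,
        (mem_edgeIndices.1 (h ▸ by simp : j ∈ edgeIndices a m v)).2⟩
    · intro h
      symm
      refine eq_of_subset_of_card_le ?_ ?_
      · intro x hx
        rw [mem_insert, mem_singleton] at hx
        rcases hx with rfl | rfl
        exacts [mem_edgeIndices.2 ⟨hi, h.1⟩, mem_edgeIndices.2 ⟨hj, h.2⟩]
      · rw [ha.card_edgeIndices, card_pair hij]; exact hd v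
  rw [h1]
  have h2 := hl.card_inter_le (a i) ((ha.mem_iff _).2 ⟨i, hi, rfl⟩) (a j)
    ((ha.mem_iff _).2 ⟨j, hj, rfl⟩) fun h => hij (ha.inj i hi j hj h)
  split_ifs with h
  · have := card_pos.2 h
    omega
  · rw [card_eq_zero, ← not_nonempty_iff_eq_empty]; exact h

theorem IsEdgeEnum.sum_card_fiber {H : Hypergraph V} {m k : ℕ} {a : ℕ → Finset V}
    (ha : H.IsEdgeEnum m a) (hu : H.IsUniform k) {i : ℕ} (hi : i < m) :
    ∑ S ∈ (range m).powerset with i ∈ S, #{v | edgeIndices a m v = S} = k := by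
  rw [← hu.card_eq (a i) ((ha.mem_iff _).2 ⟨i, hi, rfl⟩),
    card_eq_sum_card_fiberwise (f := edgeIndices a m)
      (t := {S ∈ (range m).powerset | i ∈ S}) (s := a i)]
  · refine sum_congr rfl fun S hS => ?_
    congr 1
    ext v
    simp only [mem_filter, mem_univ, true_and, iff_and_self]
    rintro rfl
    exact (mem_edgeIndices.1 (mem_filter.1 hS).2).2
  · intro v hv
    simp only [coe_filter, mem_powerset, Set.mem_ofPred_eq, mem_edgeIndices]
    exact ⟨filter_subset _ _, hi, hv⟩

/-- Vertices are sorted by the set S of edges containing them. Degrees 1 and 2 exclude other sizes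
of S; a pair S has one vertex or none according as its edges meet; the singletons are then
determined because the classes in each edge add up to k. -/
theorem IsEdgeEnum.card_fiber_eq {H : Hypergraph V} {H' : Hypergraph W} {m k : ℕ}
    {a : ℕ → Finset V} {a' : ℕ → Finset W} (ha : H.IsEdgeEnum m a) (ha' : H'.IsEdgeEnum m a')
    (hu : H.IsUniform k) (hu' : H'.IsUniform k) (hl : H.IsLinear) (hl' : H'.IsLinear)
    (hd : ∀ v, 1 ≤ H.degree v ∧ H.degree v ≤ 2) (hd' : ∀ v, 1 ≤ H'.degree v ∧ H'.degree v ≤ 2)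
    (h : ∀ i < m, ∀ j < m, i ≠ j → ((a i ∩ a j).Nonempty ↔ (a' i ∩ a' j).Nonempty))
    (S : Finset ℕ) : #{v | edgeIndices a m v = S} = #{v | edgeIndices a' m v = S} := by
  by_cases hS : S ⊆ range m
  swap
  · have h1 : ∀ v, edgeIndices a m v ≠ S := fun v h => hS (h ▸ filter_subset _ _)
    have h2 : ∀ v, edgeIndices a' m v ≠ S := fun v h => hS (h ▸ filter_subset _ _)
    simp [h1, h2]
  have hne1 : ∀ S : Finset ℕ, S ⊆ range m → #S ≠ 1 →
      #{v | edgeIndices a m v = S} = #{v | edgeIndices a' m v = S} := by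
    intro S hS hS1
    by_cases hS2 : #S = 2
    · obtain ⟨i, j, hij, rfl⟩ := card_eq_two.1 hS2
      have hi : i < m := mem_range.1 (hS (by simp))
      have hj : j < m := mem_range.1 (hS (by simp))
      rw [ha.card_fiber_pair hl (fun v => (hd v).2) hi hj hij,
        ha'.card_fiber_pair hl' (fun v => (hd' v).2) hi hj hij]
      simp only [h i hi j hj hij]
    · have h1 : ∀ v, edgeIndices a m v ≠ S := fun v h => by
        have := hd v; rw [← ha.card_edgeIndices, h] at this; omega
      have h2 : ∀ v, edgeIndices a' m v ≠ S := fun v h => by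
        have := hd' v; rw [← ha'.card_edgeIndices, h] at this; omega
      simp [h1, h2]
  by_cases hS1 : #S = 1
  · obtain ⟨i, rfl⟩ := card_eq_one.1 hS1
    have hi : i < m := mem_range.1 (hS (by simp))
    have hmem : {i} ∈ ({S ∈ (range m).powerset | i ∈ S} : Finset (Finset ℕ)) := by
      simp [hi]
    have h1 := ha.sum_card_fiber hu hi
    have h2 := ha'.sum_card_fiber hu' hi
    rw [← add_sum_erase _ _ hmem] at h1 h2
    rw [sum_congr rfl fun S hS => hne1 S (mem_powerset.1 (mem_filter.1 (mem_of_mem_erase hS)).1)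
      fun hS1 => ?_] at h1
    · omega
    · obtain ⟨j, rfl⟩ := card_eq_one.1 hS1
      have := (mem_filter.1 (mem_of_mem_erase hS)).2
      rw [mem_singleton] at this
      subst this
      exact ne_of_mem_erase hS rfl
  · exact hne1 S hS hS1

/-- Two linear uniform hypergraphs with maximum degree two are isomorphic if their edges can be
enumerated in such a way that the same pairs of edges meet. -/
theorem IsEdgeEnum.iso {H : Hypergraph V} {H' : Hypergraph W} {m k : ℕ}
    {a : ℕ → Finset V} {a' : ℕ → Finset W} (ha : H.IsEdgeEnum m a) (ha' : H'.IsEdgeEnum m a')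
    (hV : H.vertexSet = Set.univ) (hV' : H'.vertexSet = Set.univ)
    (hu : H.IsUniform k) (hu' : H'.IsUniform k) (hl : H.IsLinear) (hl' : H'.IsLinear)
    (hd : ∀ v, 1 ≤ H.degree v ∧ H.degree v ≤ 2) (hd' : ∀ v, 1 ≤ H'.degree v ∧ H'.degree v ≤ 2)
    (h : ∀ i < m, ∀ j < m, i ≠ j → ((a i ∩ a j).Nonempty ↔ (a' i ∩ a' j).Nonempty)) :
    H.Iso H' := by
  have hfib : ∀ S, Nonempty ({v // edgeIndices a m v = S} ≃ {v // edgeIndices a' m v = S}) := by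
    intro S
    rw [← Fintype.card_eq, Fintype.card_subtype, Fintype.card_subtype]
    exact ha.card_fiber_eq ha' hu hu' hl hl' hd hd' h S
  let φ := fun S => (hfib S).some
  -- Gluing bijections between the classes gives a map that respects incidence with every edge.
  let f : V ≃ W := Equiv.ofFiberEquiv φ
  have hf : ∀ v, edgeIndices a' m (f v) = edgeIndices a m v := Equiv.ofFiberEquiv_map φ
  have hmem : ∀ i < m, ∀ v, f v ∈ a' i ↔ v ∈ a i := by
    intro i hi v
    have := Finset.ext_iff.1 (hf v) i
    simpa [mem_edgeIndices, hi] using this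
  have himg : ∀ i < m, f '' (a i : Set V) = (a' i : Set W) := by
    intro i hi
    ext w
    obtain ⟨v, rfl⟩ := f.surjective w
    simp [hmem i hi]
  refine ⟨f, Hypergraph.ext ?_ ?_⟩
  · simp [hV, hV']
  · ext e
    have hE : ∀ e : Set V, e ∈ H.edgeSet ↔ ∃ i < m, (a i : Set V) = e := fun e => by
      classical
      have := ha.mem_iff e.toFinset
      rw [mem_edgeFamily, Set.coe_toFinset] at this
      simp only [this, ← coe_inj, Set.coe_toFinset]
    have hE' : ∀ e : Set W, e ∈ H'.edgeSet ↔ ∃ i < m, (a' i : Set W) = e := fun e => by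
      classical
      have := ha'.mem_iff e.toFinset
      rw [mem_edgeFamily, Set.coe_toFinset] at this
      simp only [this, ← coe_inj, Set.coe_toFinset]
    rw [mem_edgeSet_image, hE']
    simp only [hE]
    constructor
    · rintro ⟨_, ⟨i, hi, rfl⟩, rfl⟩
      exact ⟨i, hi, (himg i hi).symm⟩
    · rintro ⟨i, hi, rfl⟩
      exact ⟨_, ⟨i, hi, rfl⟩, himg i hi⟩

end Hypergraph

/-! ### Enumerating the edges of a cycle with a pendant path -/

namespace Hypergraph

open Finset

variable {V : Type*} [Fintype V] [DecidableEq V] {H : Hypergraph V}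

/-- Otherwise the vertices covered by S would be closed under adjacency, against connectedness. -/
theorem IsConnected.exists_inter_nonempty (h : H.IsConnected)
    (hne : ∀ e ∈ H.edgeFamily, e.Nonempty) {S : Finset (Finset V)} (hS : S ⊂ H.edgeFamily)
    (hS0 : S.Nonempty) : ∃ e ∈ S, ∃ f ∈ H.edgeFamily, f ∉ S ∧ (e ∩ f).Nonempty := by
  by_contra! hcon
  obtain ⟨e₀, he₀⟩ := hS0
  obtain ⟨f₀, hf₀, hf₀S⟩ := exists_of_ssubset hS
  obtain ⟨u, hu⟩ := hne e₀ (hS.1 he₀)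
  obtain ⟨w, hw⟩ := hne f₀ hf₀
  have hmem : ∀ e ∈ H.edgeFamily, ∀ v ∈ e, v ∈ H.vertexSet := fun e he v hv =>
    mem_vertexSet_of_mem_edgeSet (mem_edgeFamily.1 he) hv
  have key : ∀ x, Relation.ReflTransGen H.Adj u x → ∃ e ∈ S, x ∈ e := by
    intro x hx
    induction hx with
    | refl => exact ⟨e₀, he₀, hu⟩
    | @tail b c _ h1 ih =>
      classical
      obtain ⟨e, he, hb⟩ := ih
      obtain ⟨f, hf, hbf, hcf⟩ := h1
      refine ⟨f.toFinset, ?_, by simpa using hcf⟩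
      by_contra hfS
      have := hcon e he f.toFinset (by simpa [mem_edgeFamily] using hf) hfS
      exact absurd (this ▸ mem_inter.2 ⟨hb, by simpa using hbf⟩) (notMem_empty b)
  obtain ⟨e, he, hwe⟩ := key w (h.2 u (hmem _ (hS.1 he₀) _ hu) w (hmem _ hf₀ _ hw))
  have := hcon e he f₀ hf₀ hf₀S
  exact absurd (this ▸ mem_inter.2 ⟨hwe, hw⟩) (notMem_empty w)

/-- The pairs of indices of edges that meet in a hypercycle with `g` edges, one edge of which
meets the end of a hyperpath. -/
def LollipopAdj (g i j : ℕ) : Prop :=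
  (j < g ∧ (j = i + 1 ∨ (i = 0 ∧ j + 1 = g))) ∨ (j = g ∧ i = 0) ∨ (g < j ∧ j = i + 1)

/-- A cycle of edges, in which the first edge has at most three neighbours and all other edges of
the hypergraph have at most two. -/
structure IsLollipopCycle (H : Hypergraph V) (g : ℕ) (a : ℕ → Finset V) : Prop where
  inj : ∀ i < g, ∀ j < g, a i = a j → i = j
  mem : ∀ i < g, a i ∈ H.edgeFamily
  meet : ∀ i, i + 1 < g → (a i ∩ a (i + 1)).Nonempty
  meet_last : (a (g - 1) ∩ a 0).Nonempty
  card_first : #(H.edgeNeighbors (a 0)) ≤ 3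
  card_le : ∀ e ∈ H.edgeFamily, e ≠ a 0 → #(H.edgeNeighbors e) ≤ 2

/-- A partial enumeration of the edges along a cycle and a pendant path. -/
structure IsLollipopEnum (H : Hypergraph V) (g s : ℕ) (a : ℕ → Finset V) : Prop where
  inj : ∀ i < g + s, ∀ j < g + s, a i = a j → i = j
  mem : ∀ i < g + s, a i ∈ H.edgeFamily
  meet_iff : ∀ j < g + s, ∀ i < j, ((a i ∩ a j).Nonempty ↔ LollipopAdj g i j)
  -- Only the tip may have neighbours not yet listed: the edge `a 0` as long as there is no pendant
  -- edge, and the last pendant edge afterwards.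
  closed : ∀ i < g + s, i ≠ (if s = 0 then 0 else g + s - 1) →
    ∀ f ∈ H.edgeNeighbors (a i), ∃ j < g + s, a j = f

omit [Fintype V] in
theorem eq_of_card_le_two {s : Finset (Finset V)} (hs : #s ≤ 2) {e f : Finset V} (he : e ∈ s)
    (hf : f ∈ s) (hef : e ≠ f) : s = {e, f} :=
  (eq_of_subset_of_card_le (insert_subset he (singleton_subset_iff.2 hf))
    (hs.trans_eq (card_pair hef).symm)).symm

/-- The predecessor and the successor on the cycle exhaust the two neighbours allowed to every edge
but the first. Hence there are no chords. -/
theorem IsLollipopCycle.isLollipopEnum {g : ℕ} (hg : 3 ≤ g) {a : ℕ → Finset V}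
    (h : H.IsLollipopCycle g a) : H.IsLollipopEnum g 0 a := by
  have hnbr : ∀ i, i ≠ 0 → i < g →
      H.edgeNeighbors (a i) = {a (i - 1), a (if i + 1 = g then 0 else i + 1)} := by
    intro i hi hig
    refine eq_of_card_le_two (h.card_le _ (h.mem i hig) fun h' => hi (h.inj _ hig _ (by omega) h'))
      ?_ ?_ fun h' => ?_
    · refine mem_edgeNeighbors.2 ⟨h.mem _ (by omega), fun h' => ?_, ?_⟩
      · have := h.inj _ (by omega) _ hig h'; omega
      · have := h.meet (i - 1) (by omega)
        rwa [show i - 1 + 1 = i by omega, inter_comm] at this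
    · split_ifs with h1
      · refine mem_edgeNeighbors.2 ⟨h.mem _ (by omega), fun h' => ?_, ?_⟩
        · have := h.inj _ (by omega) _ hig h'; omega
        · have := h.meet_last
          rwa [show g - 1 = i by omega] at this
      · refine mem_edgeNeighbors.2 ⟨h.mem _ (by omega), fun h' => ?_, h.meet i (by omega)⟩
        have := h.inj _ (by omega) _ hig h'; omega
    · have := h.inj _ (by omega) _ (by split_ifs <;> omega) h'
      split_ifs at this <;> omega
  refine ⟨h.inj, h.mem, fun j hj i hij => ⟨fun h1 => ?_, ?_⟩, fun i hi hi0 f hf => ?_⟩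
  · have h2 : a i ∈ H.edgeNeighbors (a j) := mem_edgeNeighbors.2 ⟨h.mem i (by omega),
      fun h' => by have := h.inj _ (by omega) _ hj h'; omega, by rwa [inter_comm]⟩
    rw [hnbr j (by omega) hj, mem_insert, mem_singleton] at h2
    rcases h2 with h2 | h2
    · have := h.inj _ (by omega) _ (by omega) h2
      exact .inl ⟨hj, .inl (by omega)⟩
    · have := h.inj _ (by omega) _ (by split_ifs <;> omega) h2
      split_ifs at this
      · exact .inl ⟨hj, .inr ⟨this, by omega⟩⟩
      · omega
  · rintro (⟨_, rfl | ⟨rfl, h2⟩⟩ | h1 | h1)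
    · exact h.meet i hj
    · have := h.meet_last
      rwa [show g - 1 = j by omega, inter_comm] at this
    · omega
    · omega
  · simp only [if_true] at hi0
    rw [hnbr i hi0 hi, mem_insert, mem_singleton] at hf
    rcases hf with rfl | rfl
    · exact ⟨i - 1, by omega, rfl⟩
    · exact ⟨_, by split_ifs <;> omega, rfl⟩

/-- Connectedness provides an unlisted edge meeting a listed one, which by `closed` must be the tip
and only the tip. The new edge uses up the last neighbour allowed to the tip, so it becomes the new
tip. -/
theorem IsLollipopEnum.exists_succ {g s : ℕ} (hg : 3 ≤ g) {a : ℕ → Finset V}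
    (h : H.IsLollipopEnum g s a) (hconn : H.IsConnected) (hne : ∀ e ∈ H.edgeFamily, e.Nonempty)
    (hm : g + s < #H.edgeFamily) (h0 : #(H.edgeNeighbors (a 0)) ≤ 3)
    (h2 : ∀ e ∈ H.edgeFamily, e ≠ a 0 → #(H.edgeNeighbors e) ≤ 2) :
    ∃ b, H.IsLollipopEnum g (s + 1) b ∧ b 0 = a 0 := by
  have hinj : Set.InjOn a (range (g + s)) := fun i hi j hj hij =>
    h.inj i (by simpa using hi) j (by simpa using hj) hij
  obtain ⟨e, he, f, hf, hfS, hef⟩ := hconn.exists_inter_nonempty hne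
    (S := (range (g + s)).image a) (by
      refine Finset.ssubset_iff_subset_ne.2 ⟨fun e he => ?_, fun h' => ?_⟩
      · obtain ⟨i, hi, rfl⟩ := mem_image.1 he
        exact h.mem i (mem_range.1 hi)
      · have := card_image_of_injOn hinj
        rw [h', card_range] at this
        omega) ⟨a 0, mem_image_of_mem a (mem_range.2 (by omega))⟩
  obtain ⟨o, ho, rfl⟩ := mem_image.1 he
  rw [mem_range] at ho
  have hfa : ∀ i < g + s, a i ≠ f := fun i hi h' =>
    hfS (h' ▸ mem_image_of_mem a (mem_range.2 hi))
  have hnf : ∀ i < g + s, (a i ∩ f).Nonempty → i = if s = 0 then 0 else g + s - 1 := by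
    intro i hi hif
    by_contra hne
    obtain ⟨j, hj, hja⟩ := h.closed i hi hne f (mem_edgeNeighbors.2 ⟨hf, (hfa i hi).symm, hif⟩)
    exact hfa j hj hja
  have hoeq := hnf o ho hef
  let b : ℕ → Finset V := fun i => if i = g + s then f else a i
  have hb : ∀ i < g + s, b i = a i := fun i hi => if_neg hi.ne
  have hbf : b (g + s) = f := if_pos rfl
  have hfn : f ∈ H.edgeNeighbors (a o) := mem_edgeNeighbors.2 ⟨hf, (hfa o ho).symm, hef⟩
  have hnbr : ∀ i < g + s, i ≠ o → (a i ∩ a o).Nonempty → a i ∈ H.edgeNeighbors (a o) :=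
    fun i hi hio hne => mem_edgeNeighbors.2 ⟨h.mem i hi, fun h' => hio (h.inj i hi o ho h'),
      by rwa [inter_comm]⟩
  refine ⟨b, ⟨fun i hi j hj hij => ?_, fun i hi => ?_, fun j hj i hij => ?_, ?_⟩, hb 0 (by omega)⟩
  · rcases Nat.lt_succ_iff_lt_or_eq.1 hi with hi | rfl <;>
      rcases Nat.lt_succ_iff_lt_or_eq.1 hj with hj | rfl
    · rw [hb i hi, hb j hj] at hij; exact h.inj i hi j hj hij
    · rw [hb i hi] at hij; exact absurd (hij.trans hbf) (hfa i hi)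
    · rw [hb j hj] at hij; exact absurd (hij.symm.trans hbf) (hfa j hj)
    · rfl
  · rcases Nat.lt_succ_iff_lt_or_eq.1 hi with hi | rfl
    · rw [hb i hi]; exact h.mem i hi
    · exact hbf.symm ▸ hf
  · rcases Nat.lt_succ_iff_lt_or_eq.1 hj with hj | rfl
    · rw [hb i (by omega), hb j hj]; exact h.meet_iff j hj i hij
    · have hij : i < g + s := hij
      change (b i ∩ b (g + s)).Nonempty ↔ LollipopAdj g i (g + s)
      rw [hb i hij, hbf]
      have : LollipopAdj g i (g + s) ↔ i = if s = 0 then 0 else g + s - 1 := by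
        unfold LollipopAdj
        split_ifs <;> omega
      rw [this]
      exact ⟨hnf i hij, fun h' => by rw [h', ← hoeq]; exact hef⟩
  · intro i hi hio f' hf'
    rw [if_neg (by omega)] at hio
    have hi' : i < g + s := by omega
    rw [hb i hi'] at hf'
    by_cases hio' : i = o
    · subst hio'
      by_cases hs : s = 0
      · rw [if_pos hs] at hoeq
        subst hoeq
        have h1 := hnbr 1 (by omega) (by omega) (by
          rw [inter_comm]; exact (h.meet_iff 1 (by omega) 0 (by omega)).2 (.inl ⟨by omega, .inl rfl⟩))
        have h3 := hnbr (g - 1) (by omega) (by omega) (by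
          rw [inter_comm]
          exact (h.meet_iff (g - 1) (by omega) 0 (by omega)).2
            (.inl ⟨by omega, .inr ⟨rfl, by omega⟩⟩))
        -- These are all three neighbours allowed to `a 0`, so no unlisted neighbour is left.
        have hcard : #({a 1, a (g - 1), f} : Finset (Finset V)) = 3 := by
          rw [card_eq_three]
          refine ⟨_, _, _, fun h' => ?_, hfa 1 (by omega), hfa _ (by omega), rfl⟩
          have := h.inj _ (by omega) _ (by omega) h'
          omega
        have heq : ({a 1, a (g - 1), f} : Finset (Finset V)) = H.edgeNeighbors (a 0) := by
          refine eq_of_subset_of_card_le ?_ (by rw [hcard]; exact h0)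
          simp [insert_subset_iff, h1, h3, hfn]
        rw [← heq] at hf'
        simp only [mem_insert, mem_singleton] at hf'
        rcases hf' with rfl | rfl | rfl
        exacts [⟨1, by omega, hb _ (by omega)⟩, ⟨g - 1, by omega, hb _ (by omega)⟩,
          ⟨g + s, by omega, hbf⟩]
      · rw [if_neg hs] at hoeq
        -- The predecessor of the tip; the first pendant edge, number g, hangs on edge 0 and not on
        -- edge g - 1.
        have hprev : ∃ j < g + s, j ≠ i ∧ (a j ∩ a i).Nonempty := by
          refine ⟨if s = 1 then 0 else i - 1, by split_ifs <;> omega, by split_ifs <;> omega, ?_⟩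
          refine (h.meet_iff i hi' _ (by split_ifs <;> omega)).2 ?_
          unfold LollipopAdj
          split_ifs <;> omega
        obtain ⟨j, hj, hji, hmeet⟩ := hprev
        have heq := eq_of_card_le_two
          (h2 (a i) (h.mem i hi') fun h' => by have := h.inj _ hi' _ (by omega) h'; omega)
          (hnbr j hj hji hmeet) hfn (hfa j hj)
        rw [heq, mem_insert, mem_singleton] at hf'
        rcases hf' with rfl | rfl
        exacts [⟨j, by omega, hb _ hj⟩, ⟨g + s, by omega, hbf⟩]
    · obtain ⟨j, hj, rfl⟩ := h.closed i hi' (fun h' => hio' (h'.trans hoeq.symm)) f' hf'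
      exact ⟨j, by omega, hb j hj⟩

theorem IsLollipopCycle.exists_enum {g : ℕ} (hg : 3 ≤ g) {a : ℕ → Finset V}
    (h : H.IsLollipopCycle g a) (hconn : H.IsConnected) (hne : ∀ e ∈ H.edgeFamily, e.Nonempty)
    {m : ℕ} (hm : #H.edgeFamily = m) (hgm : g ≤ m) :
    ∃ b, H.IsEdgeEnum m b ∧
      ∀ j < m, ∀ i < j, ((b i ∩ b j).Nonempty ↔ LollipopAdj g i j) := by
  have key : ∀ s, g + s ≤ m → ∃ b, H.IsLollipopEnum g s b ∧ b 0 = a 0 := by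
    intro s hs
    induction s with
    | zero => exact ⟨a, h.isLollipopEnum hg, rfl⟩
    | succ s ih =>
      obtain ⟨b, hb, hb0⟩ := ih (by omega)
      obtain ⟨b', hb', hb0'⟩ := hb.exists_succ hg hconn hne (by omega)
        (by rw [hb0]; exact h.card_first) (by rw [hb0]; exact h.card_le)
      exact ⟨b', hb', hb0'.trans hb0⟩
  obtain ⟨b, hb, -⟩ := key (m - g) (by omega)
  have hgs : g + (m - g) = m := by omega
  obtain ⟨h1, h2, h3, -⟩ := hb
  rw [hgs] at h1 h2 h3
  refine ⟨b, ⟨h1, fun e => ?_⟩, h3⟩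
  have hsub : (range m).image b = H.edgeFamily := by
    refine eq_of_subset_of_card_le (fun e he => ?_) ?_
    · obtain ⟨i, hi, rfl⟩ := mem_image.1 he
      exact h2 i (mem_range.1 hi)
    · rw [card_image_of_injOn, card_range, hm]
      exact fun i hi j hj hij => h1 i (by simpa using hi) j (by simpa using hj) hij
  simp [← hsub]

end Hypergraph

/-! ### Counting in linear unicyclic hypergraphs -/

namespace Hypergraph

open Finset

variable {V W : Type*} [Fintype V] [DecidableEq V] [Fintype W] [DecidableEq W]
  {H : Hypergraph V} {k m g : ℕ}

omit [DecidableEq V] in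
theorem IsLinearUnicyclic.card_add (h : H.IsLinearUnicyclic k m g) (hk : 1 ≤ k) :
    Fintype.card V + m = k * m := by
  have hne : ∀ e ∈ H.edgeSet, e.Nonempty := fun e he =>
    Set.nonempty_of_ncard_ne_zero (by have := h.uniform e he; omega)
  have h1 := h.unicyclic.card_incGraph_edgeSet h.vertexSet_eq hne
  rw [card_incGraph_edgeSet h.uniform, Nat.card_sum, Nat.card_eq_fintype_card,
    Nat.card_coe_set_eq, h.card_edges] at h1
  exact h1.symm

omit [DecidableEq V] in
theorem IsUniform.edge_nonempty (hu : H.IsUniform k) (hk : 1 ≤ k) :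
    ∀ e ∈ H.edgeFamily, e.Nonempty := fun e he =>
  card_pos.1 (by have := hu.card_eq e he; omega)

omit [DecidableEq V] in
theorem IsConnected.one_le_degree (h : H.IsConnected) (hV : H.vertexSet = Set.univ)
    [Nontrivial V] (v : V) : 1 ≤ H.degree v := by
  classical
  obtain ⟨e, he, hv⟩ := h.exists_mem_edge hV v
  rw [← card_edgeFamily_filter]
  exact card_pos.2 ⟨e.toFinset, by simpa [mem_edgeFamily] using ⟨he, hv⟩⟩

/-- Lists the cycle edges periodically over ℕ, from any chosen edge, so that later arguments may
treat that edge as number 0. -/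
theorem IsCycle.exists_enum {l : ℕ} {v : Fin l → V} {e : Fin l → Set V} (h : H.IsCycle v e)
    (i₀ : Fin l) : ∃ a : ℕ → Finset V, (∀ i < l, ∀ j < l, a i = a j → i = j) ∧
      (∀ i, a i ∈ H.edgeFamily) ∧ (∀ i, (a i ∩ a (i + 1)).Nonempty) ∧ (∀ i, a (i + l) = a i) ∧
      (a 0 : Set V) = e i₀ ∧ (∀ i, ∃ j, (a i : Set V) = e j) ∧ ∀ j, ∃ i < l, (a i : Set V) = e j := by
  classical
  have hl : 0 < l := i₀.pos
  let b : ℕ → Fin l := fun n => ⟨(i₀ + n) % l, Nat.mod_lt _ hl⟩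
  have hrot : ∀ n, finRotate l (b n) = b (n + 1) := by
    intro n
    obtain ⟨l, rfl⟩ : ∃ l', l = l' + 1 := ⟨l - 1, by omega⟩
    rw [finRotate_apply]
    ext
    simp [b, Fin.val_add, add_assoc]
  refine ⟨fun n => (e (b n)).toFinset, fun i hi j hj hij => ?_, fun i => ?_, fun i => ?_,
    fun i => ?_, ?_, fun i => ⟨b i, Set.coe_toFinset _⟩, fun j => ?_⟩
  · have h1 := congrArg Fin.val (h.edge_injective (Set.toFinset_inj.1 hij))
    have h2 : i ≡ j [MOD l] := Nat.ModEq.add_left_cancel' _ h1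
    rwa [Nat.ModEq, Nat.mod_eq_of_lt hi, Nat.mod_eq_of_lt hj] at h2
  · rw [mem_edgeFamily, Set.coe_toFinset]
    exact h.edge_mem _
  · refine ⟨v (b (i + 1)), ?_⟩
    rw [mem_inter, Set.mem_toFinset, Set.mem_toFinset]
    exact ⟨hrot i ▸ h.right_mem (b i), h.left_mem _⟩
  · have : b (i + l) = b i := by ext; simp [b, ← add_assoc]
    simp only [this]
  · have : b 0 = i₀ := by ext; simp [b, Nat.mod_eq_of_lt]
    simp [this]
  · refine ⟨(j + (l - i₀)) % l, Nat.mod_lt _ hl, ?_⟩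
    have : b ((j + (l - i₀)) % l) = j := by
      ext
      simp only [b, Nat.add_mod_mod]
      rw [show (i₀ : ℕ) + (j + (l - i₀)) = j + l by omega, Nat.add_mod_right,
        Nat.mod_eq_of_lt j.2]
    simp [this]

omit [Fintype V] [DecidableEq V] in
theorem IsLinearUnicyclic.exists_isCycle (h : H.IsLinearUnicyclic k m g) :
    ∃ (v : Fin g → V) (e : Fin g → Set V), H.IsCycle v e := by
  obtain ⟨_, C, ⟨l, v, e, hc, -⟩, -⟩ := h.unicyclic
  have := Nat.sInf_mem (s := {l | ∃ (v : Fin l → V) (e : Fin l → Set V), H.IsCycle v e})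
    ⟨l, v, e, hc⟩
  rw [← girth, h.girth_eq] at this
  exact this

theorem edgeNeighbors_of_enum (hg : 3 ≤ g) {a : ℕ → Finset V}
    (hinj : ∀ i < g, ∀ j < g, a i = a j → i = j) (hmem : ∀ i, a i ∈ H.edgeFamily)
    (hmeet : ∀ i, (a i ∩ a (i + 1)).Nonempty) (hper : ∀ i, a (i + g) = a i) :
    a 1 ∈ H.edgeNeighbors (a 0) ∧ a (g - 1) ∈ H.edgeNeighbors (a 0) ∧ a 1 ≠ a (g - 1) := by
  refine ⟨mem_edgeNeighbors.2 ⟨hmem _, fun h => ?_, hmeet 0⟩,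
    mem_edgeNeighbors.2 ⟨hmem _, fun h => ?_, ?_⟩, fun h => ?_⟩
  · have := hinj _ (by omega) _ (by omega) h; omega
  · have := hinj _ (by omega) _ (by omega) h; omega
  · have := hmeet (g - 1)
    rwa [show g - 1 + 1 = 0 + g by omega, hper, inter_comm] at this
  · have := hinj _ (by omega) _ (by omega) h; omega

section MaxDegreeTwo

variable (h : H.IsLinearUnicyclic k m g) (hk : 3 ≤ k) (hd : ∀ v, 1 ≤ H.degree v ∧ H.degree v ≤ 2)

include h in
theorem IsLinearUnicyclic.sum_degree_eq : ∑ v, H.degree v = k * m := by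
  rw [sum_degree h.uniform, h.card_edges]

include h hd

/-- On {1, 2} the function d ↦ d^t is affine, so each power sum is determined by ∑ d = km and n. -/
theorem IsLinearUnicyclic.sum_degree_pow (t : ℕ) :
    ∑ v, (H.degree v : ℤ) ^ t = (2 ^ t - 1) * (k * m) + (2 - 2 ^ t) * Fintype.card V := by
  have h1 : ∀ v, (H.degree v : ℤ) ^ t = (2 ^ t - 1) * H.degree v + (2 - 2 ^ t) := by
    intro v
    obtain ⟨h1, h2⟩ := hd v
    generalize H.degree v = d at *
    interval_cases d <;> push_cast <;> ring
  simp only [h1, sum_add_distrib, ← mul_sum, sum_const, card_univ, nsmul_eq_mul]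
  rw [← Nat.cast_sum, h.sum_degree_eq]
  push_cast
  ring

include hk

/-- Summing `sum_degree_edge` over the edges gives ∑ d² = km plus the total number of neighbours,
while ∑ d² = 3km - 2n. With n = (k - 1)m the total is 2m. -/
theorem IsLinearUnicyclic.sum_edgeNeighbors :
    ∑ e ∈ H.edgeFamily, ((#(H.edgeNeighbors e) : ℤ) - 2) = 0 := by
  have h1 := H.sum_edgeFamily H.degree
  rw [sum_congr rfl fun e he => sum_degree_edge h.uniform h.linear he, sum_add_distrib,
    sum_const, card_edgeFamily, h.card_edges, smul_eq_mul] at h1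
  have h2 := h.sum_degree_pow hd 2
  have h3 := h.card_add (by omega)
  have h4 : ∑ v, (H.degree v : ℤ) ^ 2 = (∑ v, H.degree v * H.degree v : ℕ) := by
    push_cast; exact sum_congr rfl fun v _ => sq _
  simp only [Nat.cast_id] at h1
  rw [h4, ← h1] at h2
  rw [sum_sub_distrib, sum_const, card_edgeFamily, h.card_edges, ← Nat.cast_sum]
  zify at h3
  push_cast at h2 ⊢
  rw [nsmul_eq_mul]
  linarith

theorem IsLinearUnicyclic.sum_edge_sq :
    ((∑ e ∈ H.edgeFamily, (∑ v ∈ e, H.degree v) ^ 2 : ℕ) : ℤ) =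
      m * (k + 2) ^ 2 + ∑ e ∈ H.edgeFamily, ((#(H.edgeNeighbors e) : ℤ) - 2) ^ 2 := by
  rw [sum_congr rfl fun e he => by rw [sum_degree_edge h.uniform h.linear he]]
  have h1 := h.sum_edgeNeighbors hk hd
  have h2 : ∀ e : Finset V, ((k : ℤ) + #(H.edgeNeighbors e)) ^ 2 = (k + 2) ^ 2 +
      2 * (k + 2) * ((#(H.edgeNeighbors e) : ℤ) - 2) + ((#(H.edgeNeighbors e) : ℤ) - 2) ^ 2 :=
    fun e => by ring
  push_cast
  simp only [h2, sum_add_distrib, ← mul_sum, h1, sum_const, card_edgeFamily, h.card_edges]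
  simp

/-- The first edge has excess at most 1, all others at most 0, and the excesses sum to 0. So no
other excess lies below -1, and there x² = -x. -/
theorem IsLinearUnicyclic.sum_sq_le_two {a : ℕ → Finset V} (ha : H.IsLollipopCycle g a)
    (hg : 1 ≤ g) :
    ∑ e ∈ H.edgeFamily, ((#(H.edgeNeighbors e) : ℤ) - 2) ^ 2 ≤ 2 := by
  have h1 := h.sum_edgeNeighbors hk hd
  have h0 := ha.mem 0 (by omega)
  rw [← add_sum_erase _ _ h0] at h1 ⊢
  set x : Finset V → ℤ := fun e => (#(H.edgeNeighbors e) : ℤ) - 2 with hx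
  change x (a 0) + ∑ e ∈ H.edgeFamily.erase (a 0), x e = 0 at h1
  change x (a 0) ^ 2 + ∑ e ∈ H.edgeFamily.erase (a 0), x e ^ 2 ≤ 2
  have hx0 : x (a 0) ≤ 1 := by have := ha.card_first; simp only [hx]; omega
  have hxe : ∀ e ∈ H.edgeFamily.erase (a 0), x e ≤ 0 := fun e he => by
    have := ha.card_le e (mem_of_mem_erase he) (ne_of_mem_erase he)
    simp only [hx]; omega
  have hsum := sum_nonpos hxe
  have hsq : ∀ e ∈ H.edgeFamily.erase (a 0), x e ^ 2 ≤ - x e := by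
    intro e he
    have h3 : -1 ≤ x e := by
      have := single_le_sum (f := fun e => - x e) (fun e he => neg_nonneg.2 (hxe e he)) he
      rw [sum_neg_distrib] at this
      linarith
    nlinarith [hxe e he]
  have := sum_le_sum hsq
  rw [sum_neg_distrib] at this
  nlinarith

theorem IsLinearUnicyclic.exists_isLollipopCycle_of_eq (hg : 3 ≤ g) (hgm : m = g) :
    ∃ a, H.IsLollipopCycle g a := by
  obtain ⟨v, e, hc⟩ := h.exists_isCycle
  obtain ⟨a, hinj, hmem, hmeet, hper, h0, hae, hea⟩ := hc.exists_enum ⟨0, by omega⟩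
  have himg : (range g).image a = H.edgeFamily := by
    refine eq_of_subset_of_card_le (fun e he => ?_) ?_
    · obtain ⟨i, _, rfl⟩ := mem_image.1 he
      exact hmem i
    · rw [card_image_of_injOn, card_range, card_edgeFamily, h.card_edges, hgm]
      exact fun i hi j hj hij => hinj i (by simpa using hi) j (by simpa using hj) hij
  have h2 : ∀ f ∈ H.edgeFamily, 0 ≤ (#(H.edgeNeighbors f) : ℤ) - 2 := by
    intro f hf
    rw [← himg, mem_image] at hf
    obtain ⟨i, _, rfl⟩ := hf
    obtain ⟨j, hj⟩ := hae i
    -- When m = g every edge lies on the cycle. Restarting the enumeration at it shows that it has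
    -- at least two neighbours; since the excesses sum to 0, each has exactly two.
    obtain ⟨b, binj, bmem, bmeet, bper, hb0, -⟩ := hc.exists_enum j
    rw [← hj, coe_inj] at hb0
    have h3 := edgeNeighbors_of_enum hg binj bmem bmeet bper
    have h4 := card_le_card (insert_subset h3.1 (singleton_subset_iff.2 h3.2.1))
    rw [card_pair h3.2.2, hb0] at h4
    omega
  have h3 := (sum_eq_zero_iff_of_nonneg h2).1 (h.sum_edgeNeighbors hk hd)
  refine ⟨a, hinj, fun i _ => hmem i, fun i _ => hmeet i, ?_, ?_, fun e he _ => ?_⟩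
  · have := hmeet (g - 1)
    rwa [show g - 1 + 1 = 0 + g by omega, hper] at this
  · have := h3 _ (hmem 0); omega
  · have := h3 _ he; omega

theorem IsLinearUnicyclic.two_le_sum_sq (hg : 3 ≤ g) (hgm : g < m) :
    2 ≤ ∑ e ∈ H.edgeFamily, ((#(H.edgeNeighbors e) : ℤ) - 2) ^ 2 ∧
    (∑ e ∈ H.edgeFamily, ((#(H.edgeNeighbors e) : ℤ) - 2) ^ 2 = 2 →
      ∃ a, H.IsLollipopCycle g a) := by
  obtain ⟨v, e, hc⟩ := h.exists_isCycle
  obtain ⟨b, binj, bmem, -, -, -, hbe, heb⟩ := hc.exists_enum ⟨0, by omega⟩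
  have hcard : #((range g).image b) = g := by
    rw [card_image_of_injOn, card_range]
    exact fun i hi j hj hij => binj i (by simpa using hi) j (by simpa using hj) hij
  obtain ⟨p, hp, f, hf, hfS, hpf⟩ := h.unicyclic.1.exists_inter_nonempty
    (h.uniform.edge_nonempty (by omega)) (S := (range g).image b) (by
      refine Finset.ssubset_iff_subset_ne.2 ⟨fun e he => ?_, fun h' => ?_⟩
      · obtain ⟨i, _, rfl⟩ := mem_image.1 he
        exact bmem i
      · rw [h', card_edgeFamily, h.card_edges] at hcard
        omega) ⟨b 0, mem_image_of_mem b (mem_range.2 (by omega))⟩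
  obtain ⟨o, -, rfl⟩ := mem_image.1 hp
  obtain ⟨j, hj⟩ := hbe o
  obtain ⟨a, ainj, amem, ameet, aper, ha0, hae, -⟩ := hc.exists_enum j
  rw [← hj, coe_inj] at ha0
  rw [← ha0] at hpf
  have haf : ∀ i, a i ≠ f := by
    rintro i rfl
    obtain ⟨j, hj⟩ := hae i
    obtain ⟨i', hi', hi⟩ := heb j
    rw [← hj, coe_inj] at hi
    exact hfS (mem_image.2 ⟨i', mem_range.2 hi', hi⟩)
  obtain ⟨h1, h2, h12⟩ := edgeNeighbors_of_enum hg ainj amem ameet aper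
  have hf' : f ∈ H.edgeNeighbors (a 0) := mem_edgeNeighbors.2 ⟨hf, (haf 0).symm, hpf⟩
  have h3 : 3 ≤ #(H.edgeNeighbors (a 0)) := by
    rw [← card_eq_three.2 ⟨_, _, _, h12, haf 1, haf (g - 1), rfl⟩]
    exact card_le_card (by simp [insert_subset_iff, h1, h2, hf'])
  have hsum := h.sum_edgeNeighbors hk hd
  rw [← add_sum_erase _ _ (amem 0)] at hsum ⊢
  set x : Finset V → ℤ := fun e => (#(H.edgeNeighbors e) : ℤ) - 2 with hx
  change x (a 0) + ∑ e ∈ H.edgeFamily.erase (a 0), x e = 0 at hsum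
  change 2 ≤ x (a 0) ^ 2 + ∑ e ∈ H.edgeFamily.erase (a 0), x e ^ 2 ∧
    (x (a 0) ^ 2 + ∑ e ∈ H.edgeFamily.erase (a 0), x e ^ 2 = 2 → _)
  -- Integers satisfy x² + x ≥ 0, so the other squares sum to at least the excess x₀ of `a 0`, and
  -- the total is at least x₀² + x₀ ≥ 2. Equality forces x₀ = 1 and x² + x = 0, hence x ≤ 0, for all
  -- other edges.
  have hx0 : 1 ≤ x (a 0) := by simp only [hx]; omega
  have hnn : ∀ e ∈ H.edgeFamily.erase (a 0), 0 ≤ x e ^ 2 + x e := by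
    intro e _
    rcases le_or_gt 0 (x e) with h' | h'
    · positivity
    · nlinarith
  have hle := sum_nonneg hnn
  rw [sum_add_distrib] at hle
  refine ⟨by nlinarith, fun hQ => ?_⟩
  have hx1 : x (a 0) = 1 := by nlinarith
  have hz := (sum_eq_zero_iff_of_nonneg hnn).1 (by
    rw [sum_add_distrib]; rw [hx1] at hQ hsum; linarith)
  refine ⟨a, ainj, fun i _ => amem i, fun i _ => ameet i, ?_, ?_, fun e he hne => ?_⟩
  · have := ameet (g - 1)
    rwa [show g - 1 + 1 = 0 + g by omega, aper] at this
  · simp only [hx] at hx1; omega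
  · have := hz e (mem_erase.2 ⟨hne, he⟩)
    have h' : x e ≤ 0 := by nlinarith
    simp only [hx] at h'; omega

end MaxDegreeTwo

end Hypergraph

/-! ### The hypercycle with a pendant hyperpath -/

namespace Hypergraph

theorem val_finRotate {g : ℕ} (i : Fin g) :
    (finRotate g i : ℕ) = if (i : ℕ) + 1 = g then 0 else (i : ℕ) + 1 := by
  obtain ⟨g, rfl⟩ : ∃ g', g = g' + 1 := ⟨g - 1, by have := i.pos; omega⟩
  rw [coe_finRotate]
  simp [Fin.ext_iff]

theorem hypercycle_mem_iff {k g : ℕ} {i : Fin g} {x : CycleVertex k g} :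
    x ∈ ({Sum.inl i, Sum.inl (finRotate g i)} ∪ Set.range fun j => Sum.inr (i, j) :
      Set (CycleVertex k g)) ↔
    (∃ a, x = .inl a ∧ (a = i ∨ a = finRotate g i)) ∨ ∃ j, x = .inr (i, j) := by
  rcases x with a | ⟨a, b⟩ <;> simp [eq_comm]

theorem ncard_edge {A B : Type*} {n : ℕ} {a b : A} (hab : a ≠ b) (i : B) :
    ({Sum.inl a, Sum.inl b} ∪ Set.range fun j : Fin n => Sum.inr (i, j) :
      Set (A ⊕ B × Fin n)).ncard = 2 + n := by
  rw [Set.ncard_union_eq _ (Set.toFinite _) (Set.toFinite _), Set.ncard_pair (by simpa using hab),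
    Set.ncard_range_of_injective, Nat.card_fin]
  · intro i j h
    simpa using h
  · rw [Set.disjoint_left]
    rintro x (rfl | rfl) <;> simp

theorem hypercycle_edge_injective {k g : ℕ} (hk : 3 ≤ k) : Function.Injective fun i : Fin g =>
    ({Sum.inl i, Sum.inl (finRotate g i)} ∪ Set.range fun j => Sum.inr (i, j) :
      Set (CycleVertex k g)) := by
  intro i i' h
  have h1 : (Sum.inr (i, ⟨0, by omega⟩) : CycleVertex k g) ∈
      ({Sum.inl i, Sum.inl (finRotate g i)} ∪ Set.range fun j => Sum.inr (i, j) :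
        Set (CycleVertex k g)) := by simp
  have h2 := h.le h1
  simpa [eq_comm] using h2

theorem hypercycle_isCored_inr {k g : ℕ} (p : Fin g × Fin (k - 2)) :
    (hypercycle k g).IsCored (.inr p) := by
  rw [IsCored, degree, Set.ncard_eq_one]
  refine ⟨{Sum.inl p.1, Sum.inl (finRotate g p.1)} ∪ Set.range fun j => Sum.inr (p.1, j), ?_⟩
  ext e
  simp only [Set.mem_ofPred_eq, Set.mem_singleton_iff]
  constructor
  · rintro ⟨⟨i, rfl⟩, h⟩
    obtain rfl : i = p.1 := by
      rcases hypercycle_mem_iff.1 h with ⟨_, h, _⟩ | ⟨j, h⟩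
      · cases h
      · rw [Sum.inr.inj h]
    rfl
  · rintro rfl
    exact ⟨⟨p.1, rfl⟩, .inr ⟨p.2, rfl⟩⟩

/-- Each u_i lies in the two different edges numbered i and its predecessor. -/
theorem exists_of_isCored {k g : ℕ} (hk : 3 ≤ k) (hg : 3 ≤ g) {c : CycleVertex k g}
    (hc : (hypercycle k g).IsCored c) : ∃ p, c = .inr p := by
  rcases c with i | p
  · rw [IsCored, degree, Set.ncard_eq_one] at hc
    obtain ⟨e, he⟩ := hc
    have h1 := he.le ⟨⟨i, rfl⟩, .inl (.inl rfl)⟩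
    have h2 := he.le ⟨⟨(finRotate g).symm i, rfl⟩, .inl (.inr
      (congrArg Sum.inl ((finRotate g).apply_symm_apply i)).symm)⟩
    have h3 := hypercycle_edge_injective hk (h1.trans h2.symm)
    have h4 := val_finRotate ((finRotate g).symm i)
    rw [Equiv.apply_symm_apply, ← show i = _ from h3] at h4
    have := i.2
    split_ifs at h4 <;> omega
  · exact ⟨p, rfl⟩

theorem coalMap_injective {V W : Type*} [DecidableEq W] (v : V) (w : W) :
    Function.Injective (coalMap v w) := by
  intro x y h
  unfold coalMap at h
  split_ifs at h with h1 h2 h2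
  · exact h1.trans h2.symm
  · simpa using h

variable {k g r : ℕ}

/-- The vertices of the coalescence of a hypercycle and a hyperpath. -/
abbrev CyclePathVertex (k g r : ℕ) : Type :=
  CoalVertex (CycleVertex k g) (Sum.inl 0 : PathVertex k r)

/-- Incidence in the coalescence of a hypercycle and a hyperpath, the edges of the hypercycle being
numbered from `0` to `g - 1` and those of the hyperpath from `g` to `g + r - 1`. -/
def CyclePathInc (p : Fin g × Fin (k - 2)) (n : ℕ) : CyclePathVertex k g r → Prop
  | .inl (.inl a) => n < g ∧ (n = a ∨ n + 1 = a ∨ (n + 1 = g ∧ (a : ℕ) = 0))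
  | .inl (.inr q) => n = q.1 ∨ (n = g ∧ q = p)
  | .inr ⟨.inl a, _⟩ => n = g + a ∨ n + 1 = g + a
  | .inr ⟨.inr q, _⟩ => n = g + q.1

theorem image_hypercycle_edge (p : Fin g × Fin (k - 2)) (i : Fin g) :
    (Sum.inl '' ({Sum.inl i, Sum.inl (finRotate g i)} ∪ Set.range fun j => Sum.inr (i, j) :
      Set (CycleVertex k g)) : Set (CyclePathVertex k g r)) = {x | CyclePathInc p i x} := by
  have hi := i.2
  have hrot := val_finRotate i
  ext x
  rcases x with (a | q) | ⟨a | q, h⟩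
  · have ha := a.2
    simp only [Set.mem_image, hypercycle_mem_iff, Sum.inl.injEq, exists_eq_right,
      exists_eq_left', reduceCtorEq, exists_false, or_false, Set.mem_ofPred_eq, CyclePathInc]
    simp only [Fin.ext_iff]
    split_ifs at hrot <;> omega
  · obtain ⟨q1, q2⟩ := q
    simp [CyclePathInc, Fin.ext_iff, hi.ne, eq_comm]
  · have ha : (a : ℕ) ≠ 0 := fun h' => h (congrArg Sum.inl (Fin.ext h'))
    simp only [Set.mem_image, reduceCtorEq, and_false, exists_false, Set.mem_ofPred_eq,
      CyclePathInc, false_iff]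
    omega
  · simp only [Set.mem_image, reduceCtorEq, and_false, exists_false, Set.mem_ofPred_eq,
      CyclePathInc, false_iff]
    omega

theorem image_hyperpath_edge (p : Fin g × Fin (k - 2)) (i : Fin r) :
    coalMap (.inr p : CycleVertex k g) (Sum.inl 0 : PathVertex k r) ''
      ({Sum.inl i.castSucc, Sum.inl i.succ} ∪ Set.range fun j => Sum.inr (i, j)) =
    {x | CyclePathInc p (g + i) x} := by
  have hi := i.2
  have key : ∀ (y : PathVertex k r) (x : {y : PathVertex k r // y ≠ .inl 0}),
      coalMap (.inr p : CycleVertex k g) (Sum.inl 0 : PathVertex k r) y = .inr x ↔ y = x.1 := by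
    intro y x
    unfold coalMap
    split_ifs with h
    · simpa [h] using x.2.symm
    · simp [Subtype.ext_iff]
  have key' : ∀ (y : PathVertex k r) (x : CycleVertex k g),
      coalMap (.inr p : CycleVertex k g) (Sum.inl 0 : PathVertex k r) y = .inl x ↔
        y = .inl 0 ∧ x = .inr p := by
    intro y x
    unfold coalMap
    split_ifs with h
    · simp [h, eq_comm]
    · simp [h]
  ext x
  rcases x with x | ⟨a | q, h⟩
  · rcases x with a | q
    · simp [key', CyclePathInc]
    · have := q.1.2
      simp only [Set.mem_image, key', Set.mem_ofPred_eq, CyclePathInc]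
      constructor
      · rintro ⟨y, hy, rfl, h⟩
        have : (i : ℕ) = 0 := by
          rcases hy with (h | h) | ⟨_, h⟩
          · have := congrArg Fin.val (Sum.inl.inj h); simpa using this.symm
          · exact absurd (Sum.inl.inj h).symm (Fin.succ_ne_zero i)
          · cases h
        exact .inr ⟨by omega, Sum.inr.inj h⟩
      · rintro (h | ⟨h, rfl⟩)
        · omega
        · exact ⟨_, .inl (.inl (congrArg Sum.inl (Fin.ext (by simp; omega)))), rfl, rfl⟩
  · simp only [Set.mem_image, key, exists_eq_right, Set.mem_ofPred_eq, CyclePathInc]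
    simp [Fin.ext_iff]
    omega
  · obtain ⟨q1, q2⟩ := q
    simp only [Set.mem_image, key, exists_eq_right, Set.mem_ofPred_eq, CyclePathInc]
    simp [Fin.ext_iff, eq_comm]

/-- With edges given by numbers and incidence by arithmetic conditions, linearity, degrees and
neighbours reduce mainly to linear arithmetic. -/
theorem mem_cyclePath_edgeSet (p : Fin g × Fin (k - 2)) {e : Set (CyclePathVertex k g r)} :
    e ∈ (cyclePath k g r (.inr p)).edgeSet ↔ ∃ n < g + r, {x | CyclePathInc p n x} = e := by
  constructor
  · rintro (⟨_, ⟨i, rfl⟩, rfl⟩ | ⟨_, ⟨i, rfl⟩, rfl⟩)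
    · exact ⟨i, by omega, (image_hypercycle_edge p i).symm⟩
    · exact ⟨g + i, by omega, (image_hyperpath_edge p i).symm⟩
  · rintro ⟨n, hn, rfl⟩
    by_cases h : n < g
    · exact .inl ⟨_, ⟨⟨n, h⟩, rfl⟩, image_hypercycle_edge p ⟨n, h⟩⟩
    · refine .inr ⟨_, ⟨⟨n - g, by omega⟩, rfl⟩, (image_hyperpath_edge p ⟨n - g, by omega⟩).trans ?_⟩
      simp only [show g + (n - g) = n by omega]

theorem cyclePath_isUniform (hk : 3 ≤ k) (hg : 3 ≤ g) (p : Fin g × Fin (k - 2)) :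
    (cyclePath k g r (.inr p)).IsUniform k := by
  rintro e (⟨_, ⟨i, rfl⟩, rfl⟩ | ⟨_, ⟨i, rfl⟩, rfl⟩)
  · rw [Set.ncard_image_of_injective _ Sum.inl_injective, ncard_edge]
    · omega
    · intro h
      have := val_finRotate i
      rw [← h] at this
      split_ifs at this <;> omega
  · rw [Set.ncard_image_of_injective _ (coalMap_injective _ _), ncard_edge]
    · omega
    · exact (Fin.castSucc_lt_succ (i := i)).ne

theorem cyclePath_vertexSet (c : CycleVertex k g) :
    (cyclePath k g r c).vertexSet = Set.univ := by
  refine Set.eq_univ_of_forall fun x => ?_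
  rcases x with x | x
  · exact .inl ⟨x, trivial, rfl⟩
  · exact .inr ⟨x.1, trivial, dif_neg x.2⟩

/-- A vertex w, available since k ≥ 3, tells the edges apart. In the second case it is one of the
path, which lies in a single edge even if the path is attached at a w of the cycle. -/
theorem cyclePathInc_injective (hk : 3 ≤ k) (p : Fin g × Fin (k - 2)) {n n' : ℕ} (hn : n < g + r)
    (hn' : n' < g + r) (h : {x : CyclePathVertex k g r | CyclePathInc p n x} =
      {x | CyclePathInc p n' x}) : n = n' := by
  wlog hle : n ≤ n' generalizing n n'
  · exact (this hn' hn h.symm (by omega)).symm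
  by_cases hg : n' < g
  · have h1 : (.inl (.inr (⟨n, by omega⟩, ⟨0, by omega⟩)) : CyclePathVertex k g r) ∈
      {x : CyclePathVertex k g r | CyclePathInc p n x} := .inl rfl
    rcases h.le h1 with h2 | h2
    · exact h2.symm
    · omega
  · have h1 : (.inr ⟨.inr (⟨n' - g, by omega⟩, ⟨0, by omega⟩), by simp⟩ :
        CyclePathVertex k g r) ∈ {x : CyclePathVertex k g r | CyclePathInc p n' x} := by
      simp only [Set.mem_ofPred_eq, CyclePathInc]; omega
    have h2 := h.ge h1
    simp only [Set.mem_ofPred_eq, CyclePathInc] at h2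
    omega

theorem cyclePath_card_edges (hk : 3 ≤ k) (p : Fin g × Fin (k - 2)) :
    (cyclePath k g r (.inr p)).edgeSet.ncard = g + r := by
  have : (cyclePath k g r (.inr p)).edgeSet =
      (fun n => {x | CyclePathInc p n x}) '' (Finset.range (g + r) : Set ℕ) := by
    ext e
    simp [mem_cyclePath_edgeSet]
  rw [this, Set.InjOn.ncard_image, Set.ncard_coe_finset, Finset.card_range]
  intro n hn n' hn' h
  exact cyclePathInc_injective hk p (by simpa using hn) (by simpa using hn') h

theorem card_cyclePathVertex (hk : 3 ≤ k) :
    Fintype.card (CyclePathVertex k g r) + (g + r) = k * (g + r) := by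
  have : Fintype.card {x : PathVertex k r // x ≠ .inl 0} = r + r * (k - 2) := by
    rw [Fintype.card_subtype_compl]
    simp
  rw [Fintype.card_sum, this]
  obtain ⟨k, rfl⟩ : ∃ k', k = k' + 2 := ⟨k - 2, by omega⟩
  simp
  ring

theorem cyclePath_isLinear (hg : 3 ≤ g) (p : Fin g × Fin (k - 2)) :
    (cyclePath k g r (.inr p)).IsLinear := by
  intro e he f hf hef
  obtain ⟨n, hn, rfl⟩ := (mem_cyclePath_edgeSet p).1 he
  obtain ⟨n', hn', rfl⟩ := (mem_cyclePath_edgeSet p).1 hf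
  have hnn : n ≠ n' := fun h => hef (h ▸ rfl)
  have hne : ∀ a : Fin (r + 1), (Sum.inl a : PathVertex k r) ≠ .inl 0 → (a : ℕ) ≠ 0 :=
    fun a h h' => h (congrArg Sum.inl (Fin.ext h'))
  rintro x ⟨hx, hx'⟩ y ⟨hy, hy'⟩
  rcases x with (a | q) | ⟨a | q, h⟩ <;> rcases y with (a' | q') | ⟨a' | q', h'⟩ <;>
    simp only [Set.mem_ofPred_eq, CyclePathInc] at hx hx' hy hy' <;>
    try have := hne _ h
  all_goals try have := hne _ h'
  all_goals try omega
  · rw [Fin.ext_iff.2 (show (a : ℕ) = a' by omega)]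
  · rw [show q = p by by_contra h; simp only [h, and_false, or_false] at hx hx'; omega,
      show q' = p by by_contra h; simp only [h, and_false, or_false] at hy hy'; omega]
  · congr
    omega

theorem cyclePath_isConnected (p : Fin g × Fin (k - 2)) :
    (cyclePath k g r (.inr p)).IsConnected := by
  have hadj : ∀ n < g + r, ∀ x y, CyclePathInc p n x → CyclePathInc p n y →
      (cyclePath k g r (.inr p)).Adj x y := fun n hn x y hx hy =>
    ⟨_, (mem_cyclePath_edgeSet p).2 ⟨n, hn, rfl⟩, hx, hy⟩
  have hg : 0 < g := p.1.pos
  have h1 : ∀ n, ∀ hn : n < g, Relation.ReflTransGen (cyclePath k g r (.inr p)).Adj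
      (.inl (.inl ⟨0, hg⟩)) (.inl (.inl ⟨n, hn⟩)) := by
    intro n hn
    induction n with
    | zero => exact .refl
    | succ n ih =>
      refine (ih (by omega)).tail (hadj n (by omega) _ _ ?_ ?_) <;> simp [CyclePathInc] <;> omega
  have h2 : ∀ q, Relation.ReflTransGen (cyclePath k g r (.inr p)).Adj
      (.inl (.inl ⟨0, hg⟩)) (.inl (.inr q)) := fun q =>
    (h1 q.1 q.1.2).tail (hadj q.1 (by omega) _ _ (by simp [CyclePathInc]) (.inl rfl))
  have h3 : ∀ n, ∀ hn : n < r, Relation.ReflTransGen (cyclePath k g r (.inr p)).Adj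
      (.inl (.inl ⟨0, hg⟩)) (.inr ⟨.inl ⟨n + 1, by omega⟩, by simp [Fin.ext_iff]⟩) := by
    intro n hn
    induction n with
    | zero =>
      exact (h2 p).tail (hadj g (by omega) _ _ (.inr ⟨rfl, rfl⟩) (by simp [CyclePathInc]))
    | succ n ih =>
      exact (ih (by omega)).tail (hadj (g + (n + 1)) (by omega) _ _ (by simp [CyclePathInc])
        (by simp [CyclePathInc]; omega))
  have h4 : ∀ x, Relation.ReflTransGen (cyclePath k g r (.inr p)).Adj (.inl (.inl ⟨0, hg⟩)) x := by
    intro x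
    rcases x with (a | q) | ⟨a | q, h⟩
    · exact h1 a a.2
    · exact h2 q
    · have : (a : ℕ) ≠ 0 := fun h' => h (congrArg Sum.inl (Fin.ext h'))
      have h5 := h3 (a - 1) (by omega)
      have h6 : (⟨a - 1 + 1, by omega⟩ : Fin (r + 1)) = a := Fin.ext (by simp; omega)
      simpa only [h6] using h5
    · exact (h3 q.1 q.1.2).tail (hadj (g + q.1) (by omega) _ _
        (by simp [CyclePathInc]; omega) rfl)
  have : Std.Symm (cyclePath k g r (.inr p)).Adj := ⟨fun _ _ h => h.symm⟩
  have hsymm : ∀ x y, Relation.ReflTransGen (cyclePath k g r (.inr p)).Adj x y →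
      Relation.ReflTransGen (cyclePath k g r (.inr p)).Adj y x := fun x y h =>
    Relation.ReflTransGen.stdSymm.symm _ _ h
  refine ⟨?_, fun u _ v _ => (hsymm _ _ (h4 u)).trans (h4 v)⟩
  rw [cyclePath_vertexSet]
  exact ⟨.inl (.inr p), trivial⟩

/-- The edges of the hypercycle form a cycle. -/
theorem cyclePath_isCycle (hk : 3 ≤ k) (hg : 3 ≤ g) (p : Fin g × Fin (k - 2)) :
    (cyclePath k g r (.inr p)).IsCycle (fun i : Fin g => .inl (.inl i))
      (fun i => {x | CyclePathInc p i x}) := by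
  refine ⟨by omega, fun i j h => by simpa using h, fun i j h => Fin.ext ?_, fun i => ?_,
    fun i => ?_, fun i => ?_⟩
  · exact cyclePathInc_injective hk p (by omega) (by omega) h
  · exact (mem_cyclePath_edgeSet p).2 ⟨i, by omega, rfl⟩
  · simp [CyclePathInc]
  · have := val_finRotate i
    simp only [Set.mem_ofPred_eq, CyclePathInc]
    split_ifs at this <;> omega

theorem cyclePath_degree_le_two (hg : 3 ≤ g) (p : Fin g × Fin (k - 2))
    (x : CyclePathVertex k g r) : (cyclePath k g r (.inr p)).degree x ≤ 2 := by
  have key : ∃ a b, ∀ n, CyclePathInc p n x → n = a ∨ n = b := by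
    rcases x with (a | q) | ⟨a | q, h⟩
    · exact ⟨a, if (a : ℕ) = 0 then g - 1 else a - 1, fun n hn => by
        simp only [CyclePathInc] at hn
        split_ifs <;> omega⟩
    · exact ⟨q.1, g, fun n hn => hn.imp_right And.left⟩
    · exact ⟨g + a, g + a - 1, fun n hn => by simp only [CyclePathInc] at hn; omega⟩
    · exact ⟨g + q.1, g, fun n hn => .inl hn⟩
  obtain ⟨a, b, hab⟩ := key
  refine (Set.ncard_le_ncard (t := {{x | CyclePathInc p a x}, {x | CyclePathInc p b x}}) ?_
    (Set.toFinite _)).trans ((Set.ncard_insert_le _ _).trans (by rw [Set.ncard_singleton]))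
  rintro e ⟨he, hx⟩
  obtain ⟨n, -, rfl⟩ := (mem_cyclePath_edgeSet p).1 he
  rcases hab n hx with rfl | rfl
  exacts [.inl rfl, .inr rfl]

end Hypergraph

/-! ### The extremal hypergraph belongs to the class -/

namespace Hypergraph

open Finset

theorem cycleIncidences_snd {V : Type*} {l : ℕ} (v : Fin l → V) (e : Fin l → Set V) :
    Prod.snd '' cycleIncidences v e = Set.range e := by
  ext f
  constructor
  · rintro ⟨_, ⟨i, rfl | rfl⟩, rfl⟩ <;> exact ⟨i, rfl⟩
  · rintro ⟨i, rfl⟩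
    exact ⟨_, ⟨i, .inl rfl⟩, rfl⟩

/-- For a connected hypergraph the count n + m = km makes all cycles have the same incidences, so
one known cycle settles uniqueness. The length is the number of edges in the incidence set, which
gives the girth. -/
theorem IsLinearUnicyclic.of_isCycle {V : Type*} [Finite V] {H : Hypergraph V} {k m g : ℕ}
    (hV : H.vertexSet = Set.univ) (hu : H.IsUniform k) (hk : 1 ≤ k) (hl : H.IsLinear)
    (hconn : H.IsConnected) (hm : H.edgeSet.ncard = m) (hcard : Nat.card V + m = k * m)
    {v : Fin g → V} {e : Fin g → Set V} (hc : H.IsCycle v e) : H.IsLinearUnicyclic k m g := by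
  have hne : ∀ e ∈ H.edgeSet, e.Nonempty := fun e he =>
    Set.nonempty_of_ncard_ne_zero (by have := hu e he; omega)
  have hinc := hconn.incGraph_connected hV hne
  have hcard' : Nat.card H.incGraph.edgeSet = Nat.card (V ⊕ H.edgeSet) := by
    rw [card_incGraph_edgeSet hu, Nat.card_sum, Nat.card_coe_set_eq, hm, hcard]
  have huniq : ∀ {l : ℕ} {v' : Fin l → V} {e' : Fin l → Set V}, H.IsCycle v' e' →
      cycleIncidences v' e' = cycleIncidences v e := fun h =>
    (cycleIncidences_subset hinc hcard' hc h).antisymm (cycleIncidences_subset hinc hcard' h hc)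
  have hlen : ∀ {l : ℕ} {v' : Fin l → V} {e' : Fin l → Set V}, H.IsCycle v' e' → l = g := by
    intro l v' e' h
    have h1 := congrArg (fun s => (Prod.snd '' s).ncard) (huniq h)
    simpa only [cycleIncidences_snd, Set.ncard_range_of_injective h.edge_injective,
      Set.ncard_range_of_injective hc.edge_injective, Nat.card_fin] using h1
  refine ⟨hV, hu, hl, ⟨hconn, _, ⟨g, v, e, hc, rfl⟩, ?_⟩, hm, ?_⟩
  · rintro _ ⟨l, v', e', h, rfl⟩
    exact huniq h
  · have : {l | ∃ (v : Fin l → V) (e : Fin l → Set V), H.IsCycle v e} = {g} := by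
      ext l
      constructor
      · rintro ⟨v', e', h⟩
        exact hlen h
      · rintro rfl
        exact ⟨v, e, hc⟩
    rw [girth, this, csInf_singleton]

variable {k g r : ℕ}

theorem cyclePath_isLinearUnicyclic (hk : 3 ≤ k) (hg : 3 ≤ g) (p : Fin g × Fin (k - 2)) :
    (cyclePath k g r (.inr p)).IsLinearUnicyclic k (g + r) g :=
  .of_isCycle (cyclePath_vertexSet _) (cyclePath_isUniform hk hg p) (by omega)
    (cyclePath_isLinear hg p) (cyclePath_isConnected p) (cyclePath_card_edges hk p)
    (by rw [Nat.card_eq_fintype_card, card_cyclePathVertex hk]) (cyclePath_isCycle hk hg p)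

theorem card_edgeNeighbors_cyclePath_le (p : Fin g × Fin (k - 2))
    {e : Finset (CyclePathVertex k g r)} {n : ℕ} (he : (e : Set (CyclePathVertex k g r)) = {x | CyclePathInc p n x})
    {T : Finset ℕ} (hT : ∀ n' < g + r, n' ≠ n → ∀ x : CyclePathVertex k g r,
      CyclePathInc p n x → CyclePathInc p n' x → n' ∈ T) :
    #((cyclePath k g r (.inr p)).edgeNeighbors e) ≤ #T := by
  classical
  refine (card_le_card (t := T.image fun n => {x | CyclePathInc p n x}.toFinset) ?_).trans
    card_image_le
  intro f hf
  obtain ⟨hf, hfe, x, hx⟩ := mem_edgeNeighbors.1 hf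
  obtain ⟨n', hn', h'⟩ := (mem_cyclePath_edgeSet p).1 (mem_edgeFamily.1 hf)
  rw [mem_inter, ← mem_coe, ← mem_coe, he, ← h'] at hx
  refine mem_image.2 ⟨n', hT n' hn' ?_ x hx.1 hx.2, ?_⟩
  · rintro rfl
    exact hfe (coe_injective (h'.symm.trans he.symm))
  · rw [← coe_inj, Set.coe_toFinset, h']

/-- The enumeration starts at the cycle edge carrying the attaching vertex, the only edge that can
have three neighbours. -/
theorem cyclePath_exists_isLollipopCycle (hk : 3 ≤ k) (hg : 3 ≤ g) (p : Fin g × Fin (k - 2)) :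
    ∃ a, (cyclePath k g r (.inr p)).IsLollipopCycle g a := by
  obtain ⟨a, hinj, hmem, hmeet, hper, ha0, -⟩ :=
    (cyclePath_isCycle (r := r) hk hg p).exists_enum p.1
  have hp := p.1.2
  have hne : ∀ a : Fin (r + 1), (Sum.inl a : PathVertex k r) ≠ .inl 0 → (a : ℕ) ≠ 0 :=
    fun a h h' => h (congrArg Sum.inl (Fin.ext h'))
  refine ⟨a, hinj, fun i _ => hmem i, fun i _ => hmeet i, ?_, ?_, fun e he hea => ?_⟩
  · have := hmeet (g - 1)
    rwa [show g - 1 + 1 = 0 + g by omega, hper] at this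
  -- The candidates are the two adjacent cycle edges and the first path edge, number g. If the path
  -- is trivial there is no edge g, but only an upper bound is needed.
  · refine (card_edgeNeighbors_cyclePath_le p ha0 (T := {if (p.1 : ℕ) + 1 = g then 0 else (p.1 : ℕ) + 1,
      if (p.1 : ℕ) = 0 then g - 1 else (p.1 : ℕ) - 1, g}) ?_).trans card_le_three
    intro n' hn' hnn x hx hx'
    simp only [mem_insert, mem_singleton]
    rcases x with (b | q) | ⟨b | q, h⟩ <;> simp only [CyclePathInc] at hx hx' <;>
      try have := hne _ h
    all_goals split_ifs <;> omega
  · obtain ⟨n, hn, h'⟩ := (mem_cyclePath_edgeSet p).1 (mem_edgeFamily.1 he)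
    have hnp : n ≠ p.1 := by
      rintro rfl
      exact hea (coe_injective (h'.symm.trans ha0.symm))
    refine (card_edgeNeighbors_cyclePath_le p h'.symm (T := if n < g then
      {if n + 1 = g then 0 else n + 1, if n = 0 then g - 1 else n - 1} else
      {if n = g then (p.1 : ℕ) else n - 1, n + 1}) ?_).trans (by split_ifs <;> exact card_le_two)
    intro n' hn' hnn x hx hx'
    rcases x with (b | q) | ⟨b | q, h⟩ <;> simp only [CyclePathInc] at hx hx' <;>
      try have := hne _ h
    · rw [if_pos hx.1]
      simp only [mem_insert, mem_singleton]
      split_ifs <;> omega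
    · have hq : q = p := by
        by_contra hq
        simp only [hq, and_false, or_false] at hx hx'
        omega
      subst hq
      rw [if_neg (by omega)]
      simp only [mem_insert, mem_singleton]
      split_ifs <;> omega
    · rw [if_neg (by omega)]
      simp only [mem_insert, mem_singleton]
      split_ifs <;> omega
    · omega

end Hypergraph

/-! ### Comparison with an arbitrary hypergraph of the class -/

namespace Hypergraph

open Finset

section Image

variable {V W : Type*} {H : Hypergraph V} {k : ℕ}

theorem IsUniform.image_equiv (hu : H.IsUniform k) (f : V ≃ W) : (H.image f).IsUniform k := by
  rintro _ ⟨e, he, rfl⟩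
  rw [Set.ncard_image_of_injective _ f.injective, hu e he]

theorem IsLinear.image_equiv (hl : H.IsLinear) (f : V ≃ W) : (H.image f).IsLinear := by
  rintro _ ⟨e, he, rfl⟩ _ ⟨e', he', rfl⟩ hne
  rw [← Set.image_inter f.injective]
  exact (hl e he e' he' fun h => hne (h ▸ rfl)).image f

theorem ncard_edgeSet_image (f : V ≃ W) : (H.image f).edgeSet.ncard = H.edgeSet.ncard :=
  Set.ncard_image_of_injective _ (Set.image_injective.2 f.injective)

variable [Fintype V] [Fintype W]

theorem sum_degree_pow_image (f : V ≃ W) (t : ℕ) :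
    ∑ w, (H.image f).degree w ^ t = ∑ v, H.degree v ^ t := by
  simp only [← f.sum_comp, degree_image]

theorem sum_edge_sq_image (f : V ≃ W) :
    ∑ e ∈ (H.image f).edgeFamily, (∑ v ∈ e, (H.image f).degree v) ^ 2 =
      ∑ e ∈ H.edgeFamily, (∑ v ∈ e, H.degree v) ^ 2 := by
  have : (H.image f).edgeFamily = H.edgeFamily.map (mapEmbedding f.toEmbedding).toEmbedding := by
    ext e
    simp only [mem_edgeFamily, mem_map, RelEmbedding.coe_toEmbedding, mapEmbedding_apply]
    constructor
    · rintro ⟨s, hs, h⟩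
      refine ⟨e.map f.symm.toEmbedding, ?_, ?_⟩
      · rw [coe_map, ← h]
        simpa [Set.image_image] using hs
      · ext; simp
    · rintro ⟨s, hs, rfl⟩
      exact ⟨s, hs, by simp⟩
  rw [this, sum_map]
  refine sum_congr rfl fun e _ => ?_
  simp [degree_image]

end Image

variable {V W : Type*} [Fintype V] [DecidableEq V] [Fintype W] [DecidableEq W]
  {H : Hypergraph V} {H' : Hypergraph W} {k m g : ℕ}

theorem Iso.SEq {α : ℝ} (h : H.Iso H') : SEq k α H H' :=
  ⟨Fintype.card_congr h.choose, fun t _ => h.moment_eq k α t⟩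

theorem SLT.not_SEq {α : ℝ} (h : SLT k α H H') : ¬ SEq k α H H' := fun h' => by
  obtain ⟨-, d, -, hd, -, hlt⟩ := h
  exact hlt.ne (h'.2 d hd)

theorem SLT_of_image {α : ℝ} (f : V ≃ W) (h : SLT k α (H.image f) H') : SLT k α H H' := by
  have hc := Fintype.card_congr f
  have hm := fun t => Iso.moment_eq (H := H) ⟨f, rfl⟩ k α t
  obtain ⟨h1, d, h2, h3, h4, h5⟩ := h
  exact ⟨hc.trans h1, d, h2, by rwa [hc], fun t ht => (hm t).trans (h4 t ht), (hm d).trans_lt h5⟩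

theorem IsLollipopCycle.iso (h : H.IsLinearUnicyclic k m g) (h' : H'.IsLinearUnicyclic k m g)
    (hk : 3 ≤ k) (hg : 3 ≤ g) (hgm : g ≤ m) (hd : ∀ v, 1 ≤ H.degree v ∧ H.degree v ≤ 2)
    (hd' : ∀ v, 1 ≤ H'.degree v ∧ H'.degree v ≤ 2) {a : ℕ → Finset V} {a' : ℕ → Finset W}
    (ha : H.IsLollipopCycle g a) (ha' : H'.IsLollipopCycle g a') : H.Iso H' := by
  obtain ⟨b, hb, hadj⟩ := ha.exists_enum hg h.unicyclic.1 (h.uniform.edge_nonempty (by omega))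
    ((card_edgeFamily H).trans h.card_edges) hgm
  obtain ⟨b', hb', hadj'⟩ := ha'.exists_enum hg h'.unicyclic.1
    (h'.uniform.edge_nonempty (by omega)) ((card_edgeFamily H').trans h'.card_edges) hgm
  refine hb.iso hb' h.vertexSet_eq h'.vertexSet_eq h.uniform h'.uniform h.linear h'.linear hd hd'
    fun i hi j hj hij => ?_
  rcases lt_or_gt_of_ne hij with hlt | hlt
  · rw [hadj j hj i hlt, hadj' j hj i hlt]
  · rw [inter_comm, inter_comm (b' i), hadj i hi j hlt, hadj' i hi j hlt]

/-- A linear unicyclic hypergraph of maximum degree two that consists of a cycle with a pendant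
path comes first in `S_α`-order. -/
theorem IsLollipopCycle.SLT_or_iso (h : H.IsLinearUnicyclic k m g)
    (h' : H'.IsLinearUnicyclic k m g) (hk : 3 ≤ k) (hg : 3 ≤ g) (hgm : g ≤ m) {α : ℝ}
    (hα₀ : 0 < α) (hα₁ : α < 1) (hd : ∀ v, H.degree v ≤ 2) {a : ℕ → Finset V}
    (ha : H.IsLollipopCycle g a) : SLT k α H H' ∨ H.Iso H' := by
  have hV := h.card_add (by omega)
  have hW := h'.card_add (by omega)
  have hVW : Fintype.card V = Fintype.card W := by omega
  -- Since m ≥ 3, n = (k - 1)m ≥ 3k - 3 > k + 2, so order k + 2 is among those that the order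
  -- compares.
  have hbig : k + 2 < Fintype.card W := by nlinarith
  have : Nontrivial V := Fintype.one_lt_card_iff_nontrivial.1 (by omega)
  have : Nontrivial W := Fintype.one_lt_card_iff_nontrivial.1 (by omega)
  replace hd : ∀ v, 1 ≤ H.degree v ∧ H.degree v ≤ 2 := fun v =>
    ⟨h.unicyclic.1.one_le_degree h.vertexSet_eq v, hd v⟩
  have hd1 := h'.unicyclic.1.one_le_degree h'.vertexSet_eq
  -- Both criteria compare hypergraphs on one vertex type, so H is transported to W.
  let f : V ≃ W := Fintype.equivOfCardEq hVW
  have hm : (H.image f).edgeSet.ncard = H'.edgeSet.ncard := by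
    rw [ncard_edgeSet_image, h.card_edges, h'.card_edges]
  have hsum := h.sum_degree_pow hd
  by_cases hd' : ∀ v, H'.degree v ≤ 2
  · replace hd' : ∀ v, 1 ≤ H'.degree v ∧ H'.degree v ≤ 2 := fun v => ⟨hd1 v, hd' v⟩
    rcases hgm.eq_or_lt with rfl | hlt
    · obtain ⟨a', ha'⟩ := h'.exists_isLollipopCycle_of_eq hk hd' hg rfl
      exact .inr (ha.iso h h' hk hg hgm hd hd' ha')
    · obtain ⟨hQ, hQ2⟩ := h'.two_le_sum_sq hk hd' hg hlt
      rcases hQ.eq_or_lt with hQ | hQ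
      · obtain ⟨a', ha'⟩ := hQ2 hQ.symm
        exact .inr (ha.iso h h' hk hg hgm hd hd' ha')
      · refine .inl (SLT_of_image f (SLT_of_sum_edge_sq_lt hk (h.uniform.image_equiv f) h'.uniform
          (h.linear.image_equiv f) h'.linear hm hbig hα₀ hα₁ (fun t => ?_) ?_))
        · rw [sum_degree_pow_image]
          have := hsum t
          rw [hVW, ← h'.sum_degree_pow hd'] at this
          exact_mod_cast this
        · rw [sum_edge_sq_image]
          have h1 := h.sum_edge_sq hk hd
          have h2 := h'.sum_edge_sq hk hd'
          have h3 := h.sum_sq_le_two hk hd ha (by omega)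
          zify
          push_cast at h1 h2
          linarith
  · push Not at hd'
    obtain ⟨w, hw⟩ := hd'
    refine .inl (SLT_of_image f (SLT_of_sum_degree_sq_lt hk (h.uniform.image_equiv f) h'.uniform
      (h.linear.image_equiv f) h'.linear hm hbig hα₀ ?_))
    rw [sum_degree_pow_image]
    have h1 := hsum 2
    -- (d - 1)(d - 2) ≥ 0 for d ≥ 1, strictly if d ≥ 3. The left-hand side is 3km - 2n, which is the
    -- value of ∑ d² for H.
    have h2 : ∑ v, (3 * (H'.degree v : ℤ) - 2) < ∑ v, (H'.degree v : ℤ) ^ 2 := by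
      refine sum_lt_sum (fun v _ => ?_) ⟨w, mem_univ w, ?_⟩
      · have := hd1 v
        rcases this.eq_or_lt with h | h
        · rw [← h]; norm_num
        · zify at h; nlinarith
      · zify at hw; nlinarith
    rw [sum_sub_distrib, ← mul_sum, ← Nat.cast_sum, h'.sum_degree_eq, sum_const, card_univ,
      ← hVW, nsmul_eq_mul] at h2
    zify
    push_cast at h2
    linarith

end Hypergraph

theorem mainTheorem12 (k m g : ℕ) (hk : 3 ≤ k) (hg : 3 ≤ g) (hgm : g ≤ m)
    (α : ℝ) (hα₀ : 0 < α) (hα₁ : α < 1) :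
    (∃ c, (Hypergraph.hypercycle k g).IsCored c) ∧
    ∀ c, (Hypergraph.hypercycle k g).IsCored c →
      (Hypergraph.cyclePath k g (m - g) c).IsLinearUnicyclic k m g ∧
      ∀ (V : Type u) [Fintype V] [DecidableEq V] (H : Hypergraph V),
        H.IsLinearUnicyclic k m g →
          Hypergraph.SLE k α (Hypergraph.cyclePath k g (m - g) c) H ∧
          (Hypergraph.SEq k α (Hypergraph.cyclePath k g (m - g) c) H ↔
            Hypergraph.Iso (Hypergraph.cyclePath k g (m - g) c) H) := by
  refine ⟨⟨_, Hypergraph.hypercycle_isCored_inr (⟨0, by omega⟩, ⟨0, by omega⟩)⟩, fun c hc => ?_⟩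
  obtain ⟨p, rfl⟩ := Hypergraph.exists_of_isCored hk hg hc
  have h := Hypergraph.cyclePath_isLinearUnicyclic (r := m - g) hk hg p
  rw [show g + (m - g) = m by omega] at h
  refine ⟨h, fun V _ _ H hH => ?_⟩
  obtain ⟨a, ha⟩ := Hypergraph.cyclePath_exists_isLollipopCycle (r := m - g) hk hg p
  rcases ha.SLT_or_iso h hH hk hg hgm hα₀ hα₁ (Hypergraph.cyclePath_degree_le_two hg p) with
    hlt | hiso
  · exact ⟨.inl hlt, fun h' => absurd h' hlt.not_SEq, fun h' => h'.SEq⟩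
  · exact ⟨.inr hiso.SEq, fun _ => hiso, fun h' => h'.SEq⟩
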